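/- **Conventions.** For an array of components, $S_{[i_1\cdots i_P]}=\frac1{P!}\sum_{\sigma}\mathrm{sgn}(\sigma)S_{i_{\sigma(1)}\cdots i_{\sigma(P)}}$; the wedge product is $(A\wedge B)_{i_1\cdots i_{P+Q}}=A_{[i_1\cdots i_P}B_{i_{P+1}\cdots i_{P+Q}]}$, and $(d\eta)_{ij}=\frac12(\partial_i\eta_j-\partial_j\eta_i)$. The curvature components of a metric with Christoffel symbols $\Gamma^k_{ij}$ are $R_{kji}{}^h=\partial_k\Gamma^h_{ji}-\partial_j\Gamma^h_{ki}+\Gamma^h_{k\ell}\Gamma^\ell_{ji}-\Gamma^h_{j\ell}\Gamma^\ell_{ki}$. **Setting.** Let $k\ge 1$ and let $(M,g,\phi,\xi,\eta)$ be a closed Sasakian manifold of dimension $4k+1$: $g$ is a Riemannian metric, $\phi$ a field of endomorphisms, $\xi$ a vector field and $\eta$ a 1-form, all smooth, with $\phi^2=-\mathrm{id}+\eta\otimes\xi$, $\eta(\xi)=1$, $\phi\xi=0$, $\eta\circ\phi=0$, $g(X,Y)=g(\phi X,\phi Y)+\eta(X)\eta(Y)$, $\phi_{ij}:=\phi_i{}^kg_{kj}=-(d\eta)_{ij}$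 and $\nabla_i\phi_j{}^k=g_{ij}\xi^k-\eta_j\delta_i{}^k$. Assume that the integral curves of $\xi$ are closed with a common period, and let $a:S^1\times M\to M$ be the resulting smooth circle action by rotation along them, so that $\partial_\theta a(\theta,m)=c\,\xi(a(\theta,m))$ for a constant $c>0$. For $\rho\in\mathbb R$ let $h_\rho=g+\rho^2\,\eta\otimes\eta$, with curvature $\bar R$, and let $$K_{\nu\lambda_1\cdots\lambda_{4k+1}}=\bar R_{\lambda_1\kappa_1\nu}{}^{\kappa_0}\,\bar R_{\lambda_2\lambda_3\kappa_2}{}^{\kappa_1}\,\bar R_{\lambda_4\lambda_5\kappa_3}{}^{\kappa_2}\cdots\bar R_{\lambda_{4k}\lambda_{4k+1}\kappa_0}{}^{\kappa_{2k}} .$$ On the free loop space $LM=C^\infty(S^1,M)$ let $$CS^W(\gamma)(X_1,\dots,X_{4k+1})=\int_0^{2\pi}K_{\nu[\lambda_1\cdots\lambda_{4k+1}]}(\gamma(\theta))\,\dot\gamma^\nu(\theta)\,X_1^{\lambda_1}(\theta)\cdots X_{4k+1}^{\lambda_{4k+1}}(\theta)\,d\theta ,$$ and let $a^L:M\to LM$,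 $a^L(m)(\theta)=a(\theta,m)$. **Proposition.** 1. There are smooth $(4k+1)$-forms $a_0,a_2,\dots,a_{4k}$ on $M$, independent of $\rho$, such that in all local coordinates and for all $\rho\in\mathbb R$ $$K_{j[i_1\cdots i_{4k+1}]}\,\xi^j=-(1+\rho^2)^2\left(a_{4k}\rho^{4k}+a_{4k-2}\rho^{4k-2}+\cdots+a_0\right)_{i_1\cdots i_{4k+1}},$$ $$(a_{4k})_{i_1\cdots i_{4k+1}}=(-1)^k4^k(4k+2)\,\eta_{[i_1}\phi_{i_2i_3}\cdots\phi_{i_{4k}i_{4k+1}]}=(-1)^k4^k(4k+2)\left(\eta\wedge(d\eta)^{2k}\right)_{i_1\cdots i_{4k+1}},$$ and $a_{4k}$ is nonzero at every point of $M$. 2. There is a $\rho_0$ such that for every $\rho\ge\rho_0$ the form $(a^L)^*CS^W$ of $h_\rho$ is nonzero at every point of $M$. -/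

import Mathlib

open scoped Manifold ContDiff

noncomputable section

namespace SasakiCS

/-! ### Index notation: skew-symmetrization and wedge product of component arrays -/

/-- `S_{[i_1 ⋯ i_P]} = (1/P!) ∑_σ sgn(σ) S_{i_{σ(1)} ⋯ i_{σ(P)}}`. -/
def skew {ι : Type*} {P : ℕ} (S : (Fin P → ι) → ℝ) (i : Fin P → ι) : ℝ :=
  ((P.factorial : ℝ))⁻¹ *
    ∑ σ : Equiv.Perm (Fin P), ((Equiv.Perm.sign σ : ℤ) : ℝ) * S (fun q => i (σ q))

/-- `(A ∧ B)_{i_1 ⋯ i_{P+Q}} = A_{[i_1 ⋯ i_P} B_{i_{P+1} ⋯ i_{P+Q}]}`. -/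
def wedge {ι : Type*} {P Q : ℕ} (A : (Fin P → ι) → ℝ) (B : (Fin Q → ι) → ℝ) :
    (Fin (P + Q) → ι) → ℝ :=
  skew fun i => A (fun q => i (Fin.castAdd Q q)) * B (fun q => i (Fin.natAdd P q))

/-- The wedge powers `β^m = β ∧ ⋯ ∧ β` (`m` factors) of a 2-form, with `β^0 = 1`. -/
def wedgePow {ι : Type*} (β : (Fin 2 → ι) → ℝ) : (m : ℕ) → (Fin (2 * m) → ι) → ℝ
  | 0 => fun _ => 1
  | m + 1 => wedge (wedgePow β m) β

/-! ### Local coordinates -/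

/-- The coordinate space `ℝ^d`. -/
abbrev Coord (d : ℕ) : Type := EuclideanSpace ℝ (Fin d)

/-- The partial derivative `∂_i f` at `x`. -/
def pd {d : ℕ} (i : Fin d) (f : Coord d → ℝ) (x : Coord d) : ℝ :=
  fderiv ℝ f x (EuclideanSpace.single i 1)

/-- Christoffel symbols `Γ^k_{ij} = ½ G^{kℓ} (∂_i G_{jℓ} + ∂_j G_{iℓ} - ∂_ℓ G_{ij})` of a metric
with coordinate components `G_{ij}`. -/
def christoffel {d : ℕ} (G : Coord d → Matrix (Fin d) (Fin d) ℝ) (k i j : Fin d)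
    (x : Coord d) : ℝ :=
  (1 / 2) * ∑ l, (G x)⁻¹ k l *
    (pd i (fun y => G y j l) x + pd j (fun y => G y i l) x - pd l (fun y => G y i j) x)

/-- Curvature components
`R_{kji}{}^h = ∂_k Γ^h_{ji} - ∂_j Γ^h_{ki} + Γ^h_{kℓ} Γ^ℓ_{ji} - Γ^h_{jℓ} Γ^ℓ_{ki}`. -/
def curv {d : ℕ} (G : Coord d → Matrix (Fin d) (Fin d) ℝ) (k j i h : Fin d) (x : Coord d) : ℝ :=
  pd k (christoffel G h j i) x - pd j (christoffel G h k i) x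
    + ∑ l, christoffel G h k l x * christoffel G l j i x
    - ∑ l, christoffel G h j l x * christoffel G l k i x

/-- The trace `K_{ν λ_1 ⋯ λ_{4k+1}}`, that is
`R_{λ_1 κ_1 ν}{}^{κ_0} R_{λ_2 λ_3 κ_2}{}^{κ_1} ⋯ R_{λ_{4k} λ_{4k+1} κ_0}{}^{κ_{2k}}`
summed over `κ_0, …, κ_{2k}`; the indices of `κ` are cyclic and those of `lam` start at `0`. -/
def K {d : ℕ} (k : ℕ) (G : Coord d → Matrix (Fin d) (Fin d) ℝ) (ν : Fin d)
    (lam : Fin (4 * k + 1) → Fin d) (x : Coord d) : ℝ :=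
  ∑ κ : Fin (2 * k + 1) → Fin d,
    curv G (lam 0) (κ 1) ν (κ 0) x *
      ∏ s : Fin (2 * k),
        curv G (lam ⟨2 * s + 1, by omega⟩) (lam ⟨2 * s + 2, by omega⟩)
          (κ (s.succ + 1)) (κ s.succ) x

/-- The skew-symmetrization `K_{ν [λ_1 ⋯ λ_{4k+1}]}`. -/
def KSkew {d : ℕ} (k : ℕ) (G : Coord d → Matrix (Fin d) (Fin d) ℝ) (ν : Fin d)
    (lam : Fin (4 * k + 1) → Fin d) (x : Coord d) : ℝ :=
  skew (fun i => K k G ν i x) lam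

section Manifold

variable {d : ℕ} {M : Type*} [TopologicalSpace M] [ChartedSpace (Coord d) M]

/-- The coordinate vector field `∂_i` of the chart `e`, at the point with coordinates `x`. -/
def frame (e : OpenPartialHomeomorph M (Coord d)) (x : Coord d) (i : Fin d) :
    TangentSpace (𝓡 d) (e.symm x) :=
  mfderiv (𝓡 d) (𝓡 d) e.symm x (EuclideanSpace.single i (1 : ℝ) : Coord d)

/-- The components `v^i` of a tangent vector in the chart `e`. -/
def comp (e : OpenPartialHomeomorph M (Coord d)) {p : M} (v : TangentSpace (𝓡 d) p)
    (i : Fin d) : ℝ :=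
  (EuclideanSpace.proj i : Coord d →L[ℝ] ℝ) (mfderiv (𝓡 d) (𝓡 d) e p v)

/-- A tensor field of type `(0,2)`. -/
abbrev Tensor02 (d : ℕ) (M : Type*) [TopologicalSpace M] [ChartedSpace (Coord d) M] : Type _ :=
  (p : M) → TangentSpace (𝓡 d) p →L[ℝ] TangentSpace (𝓡 d) p →L[ℝ] ℝ

/-- The components `B_{ij} = B(∂_i, ∂_j)` in the chart `e`. -/
def comp02 (B : Tensor02 d M) (e : OpenPartialHomeomorph M (Coord d)) (x : Coord d) :
    Matrix (Fin d) (Fin d) ℝ :=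
  Matrix.of fun i j => B (e.symm x) (frame e x i) (frame e x j)

/-- The components `β_i = β(∂_i)` of a 1-form in the chart `e`. -/
def comp01 (β : (p : M) → TangentSpace (𝓡 d) p →L[ℝ] ℝ)
    (e : OpenPartialHomeomorph M (Coord d)) (x : Coord d) (i : Fin d) : ℝ :=
  β (e.symm x) (frame e x i)

/-- The components `X^i` of a vector field in the chart `e`. -/
def comp10 (X : (p : M) → TangentSpace (𝓡 d) p)
    (e : OpenPartialHomeomorph M (Coord d)) (x : Coord d) (i : Fin d) : ℝ :=
  comp e (X (e.symm x)) i

/-- The components `F_j{}^i`, with `F(∂_j) = F_j{}^i ∂_i`, of a field of endomorphisms. -/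
def comp11 (F : (p : M) → TangentSpace (𝓡 d) p →L[ℝ] TangentSpace (𝓡 d) p)
    (e : OpenPartialHomeomorph M (Coord d)) (x : Coord d) (j i : Fin d) : ℝ :=
  comp e (F (e.symm x) (frame e x j)) i

/-- `(dβ)_{ij} = ½ (∂_i β_j - ∂_j β_i)`, the exterior derivative of a 1-form in the chart `e`,
normalized in accordance with `wedge`. -/
def dComp (β : (p : M) → TangentSpace (𝓡 d) p →L[ℝ] ℝ)
    (e : OpenPartialHomeomorph M (Coord d)) (x : Coord d) (i j : Fin d) : ℝ :=
  (1 / 2) * (pd i (fun y => comp01 β e y j) x - pd j (fun y => comp01 β e y i) x)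

/-- `∇_i F_j{}^k = ∂_i F_j{}^k + Γ^k_{iℓ} F_j{}^ℓ - Γ^ℓ_{ij} F_ℓ{}^k`, for the Levi-Civita
connection of `B`, in the chart `e`. -/
def nabla11 (B : Tensor02 d M) (F : (p : M) → TangentSpace (𝓡 d) p →L[ℝ] TangentSpace (𝓡 d) p)
    (e : OpenPartialHomeomorph M (Coord d)) (x : Coord d) (i j k : Fin d) : ℝ :=
  pd i (fun y => comp11 F e y j k) x
    + ∑ l, christoffel (comp02 B e) k i l x * comp11 F e x j l
    - ∑ l, christoffel (comp02 B e) l i j x * comp11 F e x l k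

end Manifold

/-! ### Sasakian manifolds -/

/-- A Sasakian structure `(g, φ, ξ, η)` on `M`. -/
structure Sasakian (d : ℕ) (M : Type*) [TopologicalSpace M] [ChartedSpace (Coord d) M]
    [IsManifold (𝓡 d) ∞ M] where
  /-- the Riemannian metric -/
  g : Bundle.ContMDiffRiemannianMetric (𝓡 d) ∞ (Coord d) (TangentSpace (𝓡 d) : M → Type _)
  /-- the field of endomorphisms -/
  φ : (p : M) → TangentSpace (𝓡 d) p →L[ℝ] TangentSpace (𝓡 d) p
  /-- the characteristic vector field -/
  ξ : (p : M) → TangentSpace (𝓡 d) p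
  /-- the 1-form -/
  η : (p : M) → TangentSpace (𝓡 d) p →L[ℝ] ℝ
  smooth_φ : ContMDiff (𝓡 d) ((𝓡 d).prod 𝓘(ℝ, Coord d →L[ℝ] Coord d)) ∞
    (fun p : M => Bundle.TotalSpace.mk' (Coord d →L[ℝ] Coord d)
      (E := fun p : M => TangentSpace (𝓡 d) p →L[ℝ] TangentSpace (𝓡 d) p) p (φ p))
  smooth_ξ : ContMDiff (𝓡 d) ((𝓡 d).prod 𝓘(ℝ, Coord d)) ∞
    (fun p : M => Bundle.TotalSpace.mk' (Coord d) (E := (TangentSpace (𝓡 d) : M → Type _)) p (ξ p))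
  smooth_η : ContMDiff (𝓡 d) ((𝓡 d).prod 𝓘(ℝ, Coord d →L[ℝ] ℝ)) ∞
    (fun p : M => Bundle.TotalSpace.mk' (Coord d →L[ℝ] ℝ)
      (E := fun p : M => TangentSpace (𝓡 d) p →L[ℝ] ℝ) p (η p))
  -- almost contact structure
  φ_φ : ∀ p v, φ p (φ p v) = -v + η p v • ξ p
  η_ξ : ∀ p, η p (ξ p) = 1
  φ_ξ : ∀ p, φ p (ξ p) = 0
  η_φ : ∀ p v, η p (φ p v) = 0
  -- associated metric
  g_eq : ∀ p v w, g.inner p v w = g.inner p (φ p v) (φ p w) + η p v * η p w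
  /-- contact metric structure: `φ = -dη`, where `φ_{ij} = φ_i{}^k g_{kj}` -/
  contact : ∀ e ∈ IsManifold.maximalAtlas (𝓡 d) ∞ M, ∀ x ∈ e.target, ∀ i j : Fin d,
    g.inner (e.symm x) (φ (e.symm x) (frame e x i)) (frame e x j) = -dComp η e x i j
  /-- `∇_i φ_j{}^k = g_{ij} ξ^k - η_j δ_i{}^k` -/
  normal : ∀ e ∈ IsManifold.maximalAtlas (𝓡 d) ∞ M, ∀ x ∈ e.target, ∀ i j k : Fin d,
    nabla11 g.inner φ e x i j k =
      comp02 g.inner e x i j * comp10 ξ e x k - comp01 η e x j * (if i = k then 1 else 0)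

section

variable {d : ℕ} {M : Type*} [TopologicalSpace M] [ChartedSpace (Coord d) M]
  [IsManifold (𝓡 d) ∞ M]

/-- The metric `h_ρ = g + ρ² η ⊗ η`. -/
def Sasakian.h (S : Sasakian d M) (ρ : ℝ) : Tensor02 d M :=
  fun p => S.g.inner p + ρ ^ 2 • (S.η p).smulRight (S.η p)

/-- The tensor `φ_{ij} = φ_i{}^k g_{kj}`. -/
def Sasakian.φLow (S : Sasakian d M) : Tensor02 d M :=
  fun p => (S.g.inner p).comp (S.φ p)

/-- The components `(η ∧ (dη)^{2k})_{i_1 ⋯ i_{4k+1}}` in the chart `e`. -/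
def Sasakian.etaDeta (S : Sasakian d M) (k : ℕ) (e : OpenPartialHomeomorph M (Coord d))
    (x : Coord d) (i : Fin (4 * k + 1) → Fin d) : ℝ :=
  wedge (fun j : Fin 1 → Fin d => comp01 S.η e x (j 0))
    (wedgePow (fun j => dComp S.η e x (j 0) (j 1)) (2 * k))
    (fun q : Fin (1 + 2 * (2 * k)) => i (Fin.cast (by omega) q))

/-- The components `η_{[i_1} φ_{i_2 i_3} ⋯ φ_{i_{4k} i_{4k+1}]}` in the chart `e`. -/
def Sasakian.etaPhi (S : Sasakian d M) (k : ℕ) (e : OpenPartialHomeomorph M (Coord d))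
    (x : Coord d) (i : Fin (4 * k + 1) → Fin d) : ℝ :=
  skew (fun j : Fin (4 * k + 1) → Fin d => comp01 S.η e x (j 0) *
    ∏ s : Fin (2 * k),
      comp02 S.φLow e x (j ⟨2 * s + 1, by omega⟩) (j ⟨2 * s + 2, by omega⟩)) i

end

/-- A smooth differential form of degree `q` on `M`. -/
structure DForm (d q : ℕ) (M : Type*) [TopologicalSpace M] [ChartedSpace (Coord d) M]
    [IsManifold (𝓡 d) ∞ M] where
  /-- the value at a point -/
  val : (p : M) → TangentSpace (𝓡 d) p [⋀^Fin q]→ₗ[ℝ] ℝ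
  smooth : ∀ e ∈ IsManifold.maximalAtlas (𝓡 d) ∞ M, ∀ i : Fin q → Fin d,
    ContDiffOn ℝ ∞ (fun x => val (e.symm x) (fun s => frame e x (i s))) e.target

/-- The components `α_{i_1 ⋯ i_q} = α(∂_{i_1}, …, ∂_{i_q})` in the chart `e`. -/
def DForm.comp {d q : ℕ} {M : Type*} [TopologicalSpace M] [ChartedSpace (Coord d) M]
    [IsManifold (𝓡 d) ∞ M] (α : DForm d q M) (e : OpenPartialHomeomorph M (Coord d))
    (x : Coord d) (i : Fin q → Fin d) : ℝ :=
  α.val (e.symm x) (fun s => frame e x (i s))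

/-! ### The Wodzicki-Chern-Simons form on the loop space -/

section Loop

variable {d : ℕ} {M : Type*} [TopologicalSpace M] [ChartedSpace (Coord d) M]

/-- `K_{ν [λ_1 ⋯ λ_{4k+1}]} v^ν w_1^{λ_1} ⋯ w_{4k+1}^{λ_{4k+1}}` for the metric `B` and tangent
vectors at `p`, computed in the preferred chart at `p`. -/
def KForm (k : ℕ) (B : Tensor02 d M) (p : M) (v : TangentSpace (𝓡 d) p)
    (w : Fin (4 * k + 1) → TangentSpace (𝓡 d) p) : ℝ :=
  ∑ ν : Fin d, ∑ lam : Fin (4 * k + 1) → Fin d,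
    KSkew k (comp02 B (chartAt (Coord d) p)) ν lam (chartAt (Coord d) p p) *
      comp (chartAt (Coord d) p) v ν * ∏ s, comp (chartAt (Coord d) p) (w s) (lam s)

/-- The free loop space `LM = C^∞(S¹, M)`. -/
abbrev LoopSpace (d : ℕ) (M : Type*) [TopologicalSpace M] [ChartedSpace (Coord d) M] : Type _ :=
  ContMDiffMap (𝓡 1) (𝓡 d) Circle M ∞

/-- The velocity `γ̇(θ)` of a loop, as a tangent vector at `γ(e^{iθ})`. -/
def velocity (γ : LoopSpace d M) (θ : ℝ) : TangentSpace (𝓡 d) (γ (Circle.exp θ)) :=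
  mfderiv 𝓘(ℝ, ℝ) (𝓡 d) (fun t : ℝ => γ (Circle.exp t)) θ (1 : ℝ)

/-- The Wodzicki-Chern-Simons form of the metric `B` at the loop `γ`, evaluated on the vector
fields `X_1, …, X_{4k+1}` along `γ`:
`∫_0^{2π} K_{ν [λ_1 ⋯ λ_{4k+1}]}(γ(θ)) γ̇^ν(θ) X_1^{λ_1}(θ) ⋯ X_{4k+1}^{λ_{4k+1}}(θ) dθ`. -/
def CSW (k : ℕ) (B : Tensor02 d M) (γ : LoopSpace d M)
    (X : Fin (4 * k + 1) → (z : Circle) → TangentSpace (𝓡 d) (γ z)) : ℝ :=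
  ∫ θ in (0 : ℝ)..(2 * Real.pi),
    KForm k B (γ (Circle.exp θ)) (velocity γ θ) (fun s => X s (Circle.exp θ))

/-- A smooth action of the circle on `M`. -/
def IsSmoothAction (d : ℕ) (M : Type*) [TopologicalSpace M] [ChartedSpace (Coord d) M]
    [MulAction Circle M] : Prop :=
  ContMDiff ((𝓡 1).prod (𝓡 d)) (𝓡 d) ∞ (fun q : Circle × M => q.1 • q.2)

variable [MulAction Circle M]

/-- The map `a^L : M → LM`, `a^L(m)(θ) = a(θ, m)`, of a smooth circle action. -/
def orbitLoop (ha : IsSmoothAction d M) (m : M) : LoopSpace d M :=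
  ⟨fun z => z • m, ha.comp (contMDiff_id.prodMk contMDiff_const)⟩

/-- The differential of `a^L` at `m`: the vector `v` is sent to the field
`z ↦ d(a(z, ·))_m v` along the loop `a^L(m)`. -/
def orbitLoopDeriv (ha : IsSmoothAction d M) (m : M) (v : TangentSpace (𝓡 d) m) (z : Circle) :
    TangentSpace (𝓡 d) (orbitLoop ha m z) :=
  mfderiv (𝓡 d) (𝓡 d) (fun p : M => z • p) m v

/-- The pullback `(a^L)^* CS^W` for the metric `B`, at `m`. -/
def pullbackCSW (k : ℕ) (B : Tensor02 d M) (ha : IsSmoothAction d M) (m : M)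
    (v : Fin (4 * k + 1) → TangentSpace (𝓡 d) m) : ℝ :=
  CSW k B (orbitLoop ha m) (fun s => orbitLoopDeriv ha m (v s))

/-- The action rotates the integral curves of the vector field `ξ`: it is generated by a positive
constant multiple of `ξ`, so that all integral curves of `ξ` are closed with a common period and
`a(θ, ·)` is the rotation by the angle `θ` along them. -/
def IsRotationAlong (d : ℕ) {M : Type*} [TopologicalSpace M] [ChartedSpace (Coord d) M]
    [MulAction Circle M] (ξ : (p : M) → TangentSpace (𝓡 d) p) : Prop :=
  ∃ c : ℝ, 0 < c ∧ ∀ (m : M) (θ : ℝ),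
    HasMFDerivAt 𝓘(ℝ, ℝ) (𝓡 d) (fun t : ℝ => Circle.exp t • m) θ
      ((ContinuousLinearMap.id ℝ ℝ).smulRight
        (c • ξ (Circle.exp θ • m) : TangentSpace (𝓡 d) (Circle.exp θ • m)))

end Loop

end SasakiCS

end

/-!
# The contraction of the Wodzicki-Chern-Simons form with the characteristic vector field

In a chart, an array of components `S_{i_1 ⋯ i_P}` is turned into the element
`br S = ∑ S_{i_1 ⋯ i_P} dx^{i_1} ∧ ⋯ ∧ dx^{i_P}` of the exterior algebra of `ℝ^d`. This is
insensitive to skew-symmetrization and takes `wedge` to the product, and in degree `d` the skew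
array is recovered from the linear form `top` (`top_br`, `skew_eq_det_mul`). Let `Ω` be the matrix
of the curvature forms `R_{kji}{}^h dx^k ∧ dx^j`.

*The contraction.* On a Sasakian manifold `∇ξ = -φ`, so the Levi-Civita connection of
`h_ρ = g + t η ⊗ η`, `t = ρ²`, differs from that of `g` by `-t (φ ⊗ η + η ⊗ φ)`
(`LocalSasaki.conn_def`). This gives its curvature (`LocalSasaki.curvM_def`) and
`R_{kji}{}^h ξ^i = (1 + t)² (η_j δ_k^h - η_k δ_j^h)` (`LocalSasaki.curvM_def_ξ`). Inserted into the
trace that defines `K`, the first of these two terms produces `∑_i Ω^h_i ∧ dx^i`, which is zero by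
the Bianchi identity, and the second one leaves
`K_{ν [λ_1 ⋯ λ_{4k+1}]} ξ^ν = -(1 + t)² η ∧ tr Ω^{2k}` (`IsMetric.br_K`).

*The expansion.* Modulo `η`, the matrix `Ω` of `h_ρ` is `Ω_g + t Ψ` with `Ψ = 2 (ω J - N)`, where
`J` is the matrix of `φ`, `ω = φ_{kj} dx^k ∧ dx^j` and `N^h_i = Φ^h ∧ Φ_i` with `Φ^h = φ_j{}^h dx^j`.
Hence `η ∧ tr Ω^{2k}` is a polynomial in `t` with leading coefficient `η ∧ tr Ψ^{2k}`. The relations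
`N² = 0`, `N J N = -ω N`, `J² N = N J² = -N`, `J³ = -J` give
`tr Ψ^{2k} = (-1)^k 4^k (4k + 2) ω^{2k}` (`LocalSasaki.trace_matPsi_pow`). Moreover `ω = -dη`, and
`η ∧ ω^{2k} ≠ 0` because `ω` is nondegenerate on the kernel of `η`
(`LocalSasaki.lin_η_mul_fund_pow_ne_zero`).

*Globalization.* The matrices `Ω` of two charts are conjugate up to pull-back by the transition map
(`trace_Om_pow_eq_pull`), so `η ∧ tr Ω^{2k}` is a form on the manifold, encoded as a `Density`. The
coefficients of the powers of `t` in `η ∧ tr Ω^{2k}` are linear combinations of its values at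
`t = 0, …, 2k`, and are therefore smooth forms as well (`Sasakian.exists_coefficients`).

*The loop space.* The loops `a^L(m)` have velocity `c ξ`, so the integrand of the pulled back form is
`c` times the form `-(1 + ρ²)² ∑ a_{2r} ρ^{2r}`, applied to vectors moved by the circle action. By
compactness the quotients `a_{2r} / a_{4k}` are bounded, and this form has no zeros for large `ρ`
(`Sasakian.exists_contraction_ne_zero`). On a frame the integrand is then a continuous function of
the angle without zeros, whose integral is not zero (`Sasakian.pullbackCSW_ne_zero`).
-/

open scoped Manifold ContDiff

noncomputable section

namespace SasakiCS

open Filter Topology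

/-! ### Component arrays as elements of the exterior algebra -/

/-- The exterior algebra in which arrays of components of forms are multiplied. -/
abbrev Ext (d : ℕ) : Type := ExteriorAlgebra ℝ (Fin d → ℝ)

/-- The generator `dx^i`. -/
def th {d : ℕ} (i : Fin d) : Ext d := ExteriorAlgebra.ι ℝ (Pi.single i (1 : ℝ))

theorem th_mul_swap {d : ℕ} (i j : Fin d) : th i * th j = -(th j * th i) :=
  eq_neg_of_add_eq_zero_left (ExteriorAlgebra.ι_add_mul_swap _ _)

/-- Products of two generators are central. -/
theorem th_mul_th_commute {d : ℕ} (i j : Fin d) (x : Ext d) : Commute (th i * th j) x := by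
  induction x using ExteriorAlgebra.induction with
  | algebraMap r => exact (Algebra.commutes r _).symm
  | ι m =>
    have h : ∀ u v : Fin d → ℝ, ExteriorAlgebra.ι ℝ u * ExteriorAlgebra.ι ℝ v =
        -(ExteriorAlgebra.ι ℝ v * ExteriorAlgebra.ι ℝ u) := fun u v =>
      eq_neg_of_add_eq_zero_left (ExteriorAlgebra.ι_add_mul_swap _ _)
    unfold Commute SemiconjBy th
    rw [mul_assoc, h (Pi.single j 1) m, mul_neg, ← mul_assoc, h (Pi.single i 1) m, neg_mul, neg_neg,
      mul_assoc]
  | mul a b ha hb => exact ha.mul_right hb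
  | add a b ha hb => exact ha.add_right hb

/-- The form `∑ S_{i_1 ⋯ i_P} dx^{i_1} ∧ ⋯ ∧ dx^{i_P}` of an array of components, which need not
be skew. -/
def br {d P : ℕ} (S : (Fin P → Fin d) → ℝ) : Ext d :=
  ∑ i, S i • ExteriorAlgebra.ιMulti ℝ P (fun q => (Pi.single (i q) 1 : Fin d → ℝ))

theorem br_perm {d P : ℕ} (S : (Fin P → Fin d) → ℝ) (σ : Equiv.Perm (Fin P)) :
    br (fun i => S (fun q => i (σ q))) = ((Equiv.Perm.sign σ : ℤ) : ℝ) • br S := by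
  unfold br
  rw [Finset.smul_sum, ← Equiv.sum_comp (Equiv.arrowCongr σ (Equiv.refl (Fin d)))]
  refine Finset.sum_congr rfl fun i _ => ?_
  have h1 : (fun q => (Equiv.arrowCongr σ (Equiv.refl (Fin d))) i (σ q)) = i := by
    ext q; simp [Equiv.arrowCongr]
  have h2 : (fun q => (Pi.single ((Equiv.arrowCongr σ (Equiv.refl (Fin d))) i q) 1 : Fin d → ℝ)) =
      (fun q => (Pi.single (i q) 1 : Fin d → ℝ)) ∘ (σ⁻¹ : Equiv.Perm (Fin P)) := by
    ext q; simp [Equiv.arrowCongr]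
  beta_reduce
  rw [h1, h2, AlternatingMap.map_perm, smul_comm, Equiv.Perm.sign_inv]
  rcases Int.units_eq_one_or (Equiv.Perm.sign σ) with h | h <;> simp [h]

theorem sign_mul_sign {P : ℕ} (σ : Equiv.Perm (Fin P)) :
    ((Equiv.Perm.sign σ : ℤ) : ℝ) * ((Equiv.Perm.sign σ : ℤ) : ℝ) = 1 := by
  rcases Int.units_eq_one_or (Equiv.Perm.sign σ) with h | h <;> simp [h]

/-- Skew-symmetrization of the components does not change the form. -/
theorem br_skew {d P : ℕ} (S : (Fin P → Fin d) → ℝ) : br (skew S) = br S := by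
  have h : br (skew S) = ((P.factorial : ℝ))⁻¹ • ∑ σ : Equiv.Perm (Fin P),
      ((Equiv.Perm.sign σ : ℤ) : ℝ) • br (fun i => S (fun q => i (σ q))) := by
    simp only [br, skew, Finset.smul_sum]
    rw [Finset.sum_comm]
    refine Finset.sum_congr rfl fun i _ => ?_
    rw [Finset.mul_sum, Finset.sum_smul]
    refine Finset.sum_congr rfl fun σ _ => ?_
    rw [smul_smul, smul_smul, mul_assoc]
  rw [h]
  simp only [br_perm, smul_smul, sign_mul_sign, one_smul, Finset.sum_const, Finset.card_univ,
    Fintype.card_perm, Fintype.card_fin]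
  rw [← Nat.cast_smul_eq_nsmul ℝ, smul_smul, inv_mul_cancel₀ (by positivity), one_smul]

theorem ιMulti_append {d P Q : ℕ} (u : Fin P → Fin d → ℝ) (v : Fin Q → Fin d → ℝ) :
    ExteriorAlgebra.ιMulti ℝ (P + Q) (Fin.append u v) =
      ExteriorAlgebra.ιMulti ℝ P u * ExteriorAlgebra.ιMulti ℝ Q v := by
  simp only [ExteriorAlgebra.ιMulti_apply]
  rw [List.ofFn_add, List.prod_append]
  simp

theorem br_mul {d P Q : ℕ} (A : (Fin P → Fin d) → ℝ) (B : (Fin Q → Fin d) → ℝ) :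
    br (fun i : Fin (P + Q) → Fin d =>
      A (fun q => i (Fin.castAdd Q q)) * B (fun q => i (Fin.natAdd P q))) = br A * br B := by
  unfold br
  rw [Finset.sum_mul_sum, ← Finset.sum_product', ← Equiv.sum_comp (Fin.appendEquiv P Q)]
  refine Finset.sum_congr (by simp) fun p _ => ?_
  have h : (fun q => (Pi.single (Fin.append p.1 p.2 q) 1 : Fin d → ℝ)) =
      Fin.append (fun q => (Pi.single (p.1 q) 1 : Fin d → ℝ)) (fun q => Pi.single (p.2 q) 1) := by
    ext q
    refine Fin.addCases (fun q => ?_) (fun q => ?_) q <;> simp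
  simp only [Fin.appendEquiv, Equiv.coe_fn_mk, Fin.append_left, Fin.append_right]
  rw [h, ιMulti_append, smul_mul_smul_comm]

theorem br_cast {d P Q : ℕ} (h : Q = P) (S : (Fin Q → Fin d) → ℝ) :
    br (fun i : Fin P → Fin d => S (fun q => i (Fin.cast h q))) = br S := by
  subst h; rfl

theorem br_wedge {d P Q : ℕ} (A : (Fin P → Fin d) → ℝ) (B : (Fin Q → Fin d) → ℝ) :
    br (wedge A B) = br A * br B := by
  unfold wedge
  rw [br_skew, br_mul]

theorem br_wedgePow {d : ℕ} (β : (Fin 2 → Fin d) → ℝ) (m : ℕ) :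
    br (wedgePow β m) = br β ^ m := by
  induction m with
  | zero => simp [wedgePow, br, ExteriorAlgebra.ιMulti_zero_apply]
  | succ m ih => rw [wedgePow, pow_succ, ← ih]; exact br_wedge _ _

theorem br_one {d : ℕ} (c : Fin d → ℝ) :
    br (fun i : Fin 1 → Fin d => c (i 0)) = ∑ i, c i • th i := by
  unfold br
  rw [← Equiv.sum_comp (Equiv.funUnique (Fin 1) (Fin d)).symm]
  simp [ExteriorAlgebra.ιMulti_apply, th]

theorem br_two {d : ℕ} (c : Fin d → Fin d → ℝ) :
    br (fun i : Fin 2 → Fin d => c (i 0) (i 1)) = ∑ i, ∑ j, c i j • (th i * th j) := by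
  unfold br
  rw [← Equiv.sum_comp (finTwoArrowEquiv (Fin d)).symm, Fintype.sum_prod_type]
  simp only [finTwoArrowEquiv, ExteriorAlgebra.ιMulti_apply,
    List.ofFn_succ, List.ofFn_zero, List.prod_cons, List.prod_nil, mul_one]
  rfl

/-- The bracket of an array that is a product of a 1-index factor and of 2-index factors. -/
theorem br_pairs {d P m : ℕ} (hP : P = 2 * m + 1) (c : Fin d → ℝ)
    (B : Fin m → Fin d → Fin d → ℝ) :
    br (fun i : Fin P → Fin d => c (i ⟨0, by omega⟩) *
      ∏ s : Fin m, B s (i ⟨2 * s + 1, by omega⟩) (i ⟨2 * s + 2, by omega⟩)) =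
    (∑ i, c i • th i) * (List.ofFn fun s => ∑ i, ∑ j, B s i j • (th i * th j)).prod := by
  subst hP
  induction m with
  | zero =>
    simp only [List.ofFn_zero, List.prod_nil, mul_one]
    rw [← br_one]
    congr 1; ext i; simp
  | succ m ih =>
    rw [List.ofFn_succ', List.concat_eq_append, List.prod_append, ← mul_assoc,
      ← ih (fun s => B s.castSucc), List.prod_singleton, ← br_two, ← br_mul]
    congr 1; ext i
    rw [Fin.prod_univ_castSucc, mul_assoc]
    rfl

/-! ### The top degree -/

/-- The coefficient of the top degree part of a form. -/
def top (d : ℕ) : Ext d →ₗ[ℝ] ℝ :=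
  ExteriorAlgebra.liftAlternating
    (fun n => if h : n = d then
      (Matrix.detRowAlternating (n := Fin d) (R := ℝ)).domDomCongr (finCongr h.symm) else 0)

theorem top_ιMulti {d : ℕ} (v : Fin d → Fin d → ℝ) :
    top d (ExteriorAlgebra.ιMulti ℝ d v) = Matrix.det (Matrix.of v) := by
  unfold top
  rw [ExteriorAlgebra.liftAlternating_apply_ιMulti]
  simp
  rfl

theorem top_ιMulti_of_ne {d n : ℕ} (h : n ≠ d) (v : Fin n → Fin d → ℝ) :
    top d (ExteriorAlgebra.ιMulti ℝ n v) = 0 := by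
  unfold top
  rw [ExteriorAlgebra.liftAlternating_apply_ιMulti]
  simp [h]

/-- A linear substitution acts on the top degree by its determinant. -/
theorem top_map {d : ℕ} (f : (Fin d → ℝ) →ₗ[ℝ] (Fin d → ℝ)) (x : Ext d) :
    top d (ExteriorAlgebra.map f x) = LinearMap.det f * top d x := by
  have h : (top d) ∘ₗ (ExteriorAlgebra.map f).toLinearMap = (LinearMap.det f) • top d := by
    refine ExteriorAlgebra.lhom_ext fun n => ?_
    ext v
    simp only [LinearMap.compAlternatingMap_apply, LinearMap.comp_apply, LinearMap.smul_apply,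
      AlgHom.toLinearMap_apply, ExteriorAlgebra.map_apply_ιMulti]
    by_cases hn : n = d
    · subst hn
      rw [top_ιMulti, top_ιMulti, ← LinearMap.det_toMatrix', smul_eq_mul, mul_comm,
        ← Matrix.det_transpose (LinearMap.toMatrix' f), ← Matrix.det_mul]
      congr 1
      ext i j
      have := congrFun (LinearMap.toMatrix'_mulVec f (v i)) j
      simp only [Matrix.of_apply, Function.comp, Matrix.mul_apply, Matrix.transpose_apply, ← this,
        Matrix.mulVec, dotProduct, mul_comm]
    · rw [top_ιMulti_of_ne hn, top_ιMulti_of_ne hn, smul_zero]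
  exact LinearMap.congr_fun h x

theorem skew_perm {ι : Type*} {P : ℕ} (S : (Fin P → ι) → ℝ) (i : Fin P → ι)
    (τ : Equiv.Perm (Fin P)) :
    skew S (fun q => i (τ q)) = ((Equiv.Perm.sign τ : ℤ) : ℝ) * skew S i := by
  unfold skew
  rw [mul_left_comm]
  congr 1
  rw [Finset.mul_sum, ← Equiv.sum_comp (Equiv.mulLeft τ⁻¹)]
  refine Finset.sum_congr rfl fun σ _ => ?_
  simp only [Equiv.coe_mulLeft, Equiv.Perm.sign_mul, Equiv.Perm.sign_inv, Equiv.Perm.mul_apply,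
    ← Equiv.Perm.mul_apply τ τ⁻¹, mul_inv_cancel, Equiv.Perm.one_apply]
  push_cast
  ring

theorem skew_eq_zero {ι : Type*} {P : ℕ} (S : (Fin P → ι) → ℝ) (i : Fin P → ι) {p q : Fin P}
    (hpq : p ≠ q) (h : i p = i q) : skew S i = 0 := by
  have h1 := skew_perm S i (Equiv.swap p q)
  have h2 : (fun r => i (Equiv.swap p q r)) = i := by
    ext r
    rcases eq_or_ne r p with rfl | hp
    · simp [h]
    · rcases eq_or_ne r q with rfl | hq
      · simp [h]
      · rw [Equiv.swap_apply_of_ne_of_ne hp hq]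
  rw [h2, Equiv.Perm.sign_swap hpq] at h1
  simp at h1
  linarith

/-- In top degree a skew array is determined by its component `1 2 ⋯ d`. -/
theorem skew_eq_det_mul {d : ℕ} (S : (Fin d → Fin d) → ℝ) (i : Fin d → Fin d) :
    skew S i = Matrix.det (Matrix.of fun q => (Pi.single (i q) 1 : Fin d → ℝ)) * skew S id := by
  by_cases h : Function.Injective i
  · let τ : Equiv.Perm (Fin d) := Equiv.ofBijective i (Finite.injective_iff_bijective.1 h)
    have h1 := skew_perm S id τ
    have h2 : (Matrix.of fun q => (Pi.single (i q) 1 : Fin d → ℝ)) = τ.permMatrix ℝ := by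
      ext q r
      simp [Equiv.Perm.permMatrix, PEquiv.toMatrix_apply, Pi.single_apply, τ, eq_comm]
    rw [h2, Matrix.det_permutation]
    exact h1
  · simp only [Function.Injective, not_forall] at h
    obtain ⟨p, q, h1, h2⟩ := h
    rw [skew_eq_zero S i h2 h1, Matrix.det_zero_of_row_eq h2
        (show (Pi.single (i p) 1 : Fin d → ℝ) = Pi.single (i q) 1 by rw [h1]), zero_mul]

theorem top_br {d : ℕ} (S : (Fin d → Fin d) → ℝ) :
    top d (br S) = (d.factorial : ℝ) * skew S id := by
  rw [← br_skew]
  have h : ∀ i : Fin d → Fin d, skew S i • top d (ExteriorAlgebra.ιMulti ℝ d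
      (fun q => (Pi.single (i q) 1 : Fin d → ℝ))) =
      if Function.Injective i then skew S id else 0 := by
    intro i
    rw [top_ιMulti]
    split_ifs with h
    · let τ : Equiv.Perm (Fin d) := Equiv.ofBijective i (Finite.injective_iff_bijective.1 h)
      have h2 : (Matrix.of fun q => (Pi.single (i q) 1 : Fin d → ℝ)) = τ.permMatrix ℝ := by
        ext q r
        simp [Equiv.Perm.permMatrix, PEquiv.toMatrix_apply, Pi.single_apply, τ, eq_comm]
      rw [skew_eq_det_mul, h2, Matrix.det_permutation, smul_eq_mul, mul_right_comm, sign_mul_sign,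
        one_mul]
    · simp only [Function.Injective, not_forall] at h
      obtain ⟨p, q, h1, h2⟩ := h
      rw [skew_eq_zero S i h2 h1, zero_smul]
  unfold br
  rw [map_sum]
  simp only [map_smul, h]
  rw [← Finset.sum_filter, Finset.sum_const, nsmul_eq_mul]
  congr 2
  rw [← Fintype.card_subtype, Fintype.card_congr (Equiv.subtypeInjectiveEquivEmbedding _ _),
    Fintype.card_embedding_eq]
  simp [Nat.descFactorial_self]

theorem br_eq_zero_of_top {d : ℕ} (S : (Fin d → Fin d) → ℝ) (h : top d (br S) = 0) :
    br S = 0 := by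
  have h1 : skew S id = 0 := by
    rw [top_br] at h
    exact (mul_eq_zero.1 h).resolve_left (by positivity)
  rw [← br_skew]
  unfold br
  refine Finset.sum_eq_zero fun i _ => ?_
  rw [skew_eq_det_mul, h1, mul_zero, zero_smul]

/-! ### Calculus in coordinates -/

section pd
variable {d : ℕ} {f g : Coord d → ℝ} {x : Coord d} {U : Set (Coord d)}

theorem pd_add (i : Fin d) (hf : DifferentiableAt ℝ f x) (hg : DifferentiableAt ℝ g x) :
    pd i (fun y => f y + g y) x = pd i f x + pd i g x := by
  unfold pd; rw [fderiv_fun_add hf hg]; rfl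

theorem pd_sub (i : Fin d) (hf : DifferentiableAt ℝ f x) (hg : DifferentiableAt ℝ g x) :
    pd i (fun y => f y - g y) x = pd i f x - pd i g x := by
  unfold pd; rw [fderiv_fun_sub hf hg]; rfl

theorem pd_mul (i : Fin d) (hf : DifferentiableAt ℝ f x) (hg : DifferentiableAt ℝ g x) :
    pd i (fun y => f y * g y) x = pd i f x * g x + f x * pd i g x := by
  unfold pd; rw [fderiv_fun_mul hf hg]
  simp only [add_apply, smul_apply, smul_eq_mul]
  ring

theorem pd_sum {ι : Type*} (s : Finset ι) (F : ι → Coord d → ℝ) (i : Fin d)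
    (hF : ∀ a ∈ s, DifferentiableAt ℝ (F a) x) :
    pd i (fun y => ∑ a ∈ s, F a y) x = ∑ a ∈ s, pd i (F a) x := by
  unfold pd; rw [fderiv_fun_sum hF]; simp

theorem pd_const (i : Fin d) (c : ℝ) : pd i (fun _ => c) x = 0 := by
  unfold pd; simp

theorem pd_neg (i : Fin d) : pd i (fun y => -f y) x = -pd i f x := by
  unfold pd; rw [fderiv_fun_neg]; rfl

theorem pd_congr (i : Fin d) (h : f =ᶠ[𝓝 x] g) : pd i f x = pd i g x := by
  unfold pd; rw [h.fderiv_eq]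

theorem pd_congr_on (i : Fin d) (hU : IsOpen U) (hx : x ∈ U) (h : ∀ y ∈ U, f y = g y) :
    pd i f x = pd i g x :=
  pd_congr i (by filter_upwards [hU.mem_nhds hx] with y hy using h y hy)

theorem diffAt_of_smoothOn (hU : IsOpen U) (hf : ContDiffOn ℝ ∞ f U) (hx : x ∈ U) :
    DifferentiableAt ℝ f x :=
  (hf.contDiffAt (hU.mem_nhds hx)).differentiableAt (by simp)

theorem contDiffOn_pd (i : Fin d) (hU : IsOpen U) (hf : ContDiffOn ℝ ∞ f U) :
    ContDiffOn ℝ ∞ (pd i f) U := by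
  have h := hf.fderiv_of_isOpen hU (m := ∞) (by simp)
  exact h.clm_apply contDiffOn_const

theorem pd_comm (i j : Fin d) (hU : IsOpen U) (hf : ContDiffOn ℝ ∞ f U) (hx : x ∈ U) :
    pd i (pd j f) x = pd j (pd i f) x := by
  have h := hf.contDiffAt (hU.mem_nhds hx)
  have h1 : DifferentiableAt ℝ (fderiv ℝ f) x :=
    (h.fderiv_right (m := 1) (by norm_cast)).differentiableAt (by simp)
  have h2 : IsSymmSndFDerivAt ℝ f x := h.isSymmSndFDerivAt (by simp; norm_cast)
  unfold pd
  rw [fderiv_clm_apply h1 (differentiableAt_const _), fderiv_clm_apply h1 (differentiableAt_const _)]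
  simpa using h2.eq _ _

theorem pd_comp (i : Fin d) {τ : Coord d → Coord d} (hf : DifferentiableAt ℝ f (τ x))
    (hτ : DifferentiableAt ℝ τ x) :
    pd i (fun y => f (τ y)) x = ∑ a, pd i (fun y => τ y a) x * pd a f (τ x) := by
  unfold pd
  have h1 : fderiv ℝ (fun y => f (τ y)) x = (fderiv ℝ f (τ x)).comp (fderiv ℝ τ x) :=
    fderiv_comp x hf hτ
  have h2 : ∀ a, fderiv ℝ (fun y => τ y a) x (EuclideanSpace.single i 1) =
      (fderiv ℝ τ x (EuclideanSpace.single i 1)) a := fun a => by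
    have : (fun y => τ y a) = fun y => (EuclideanSpace.proj a : Coord d →L[ℝ] ℝ) (τ y) := rfl
    rw [this]
    exact congrArg (fun L => L (EuclideanSpace.single i (1 : ℝ)))
      ((EuclideanSpace.proj a : Coord d →L[ℝ] ℝ).hasFDerivAt.comp x hτ.hasFDerivAt).fderiv
  have h3 : ∀ v : Coord d, v = ∑ a, v a • EuclideanSpace.single a (1 : ℝ) := fun v => by
    ext b; simp [Finset.sum_apply, Pi.single_apply]
  rw [h1, ContinuousLinearMap.comp_apply, h3 (fderiv ℝ τ x _), map_sum]
  simp only [map_smul, smul_eq_mul, h2]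

end pd

/-- The entrywise partial derivative of a matrix of functions. -/
def dM {d : ℕ} (i : Fin d) (F : Coord d → Matrix (Fin d) (Fin d) ℝ) (x : Coord d) :
    Matrix (Fin d) (Fin d) ℝ :=
  Matrix.of fun a b => pd i (fun y => F y a b) x

/-- Smoothness of the entries of a matrix of functions. -/
def SmoothM {d : ℕ} (F : Coord d → Matrix (Fin d) (Fin d) ℝ) (U : Set (Coord d)) : Prop :=
  ∀ a b, ContDiffOn ℝ ∞ (fun y => F y a b) U

section dM
variable {d : ℕ} {F G : Coord d → Matrix (Fin d) (Fin d) ℝ} {x : Coord d} {U : Set (Coord d)}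

theorem dM_congr (i : Fin d) (hU : IsOpen U) (hx : x ∈ U) (h : ∀ y ∈ U, F y = G y) :
    dM i F x = dM i G x := by
  ext a b; exact pd_congr_on i hU hx fun y hy => by rw [h y hy]

theorem SmoothM.mul (hF : SmoothM F U) (hG : SmoothM G U) : SmoothM (fun y => F y * G y) U := by
  intro a b
  simp only [Matrix.mul_apply]
  exact ContDiffOn.sum fun l _ => (hF a l).mul (hG l b)

theorem SmoothM.dM (i : Fin d) (hU : IsOpen U) (hF : SmoothM F U) : SmoothM (dM i F) U :=
  fun a b => contDiffOn_pd i hU (hF a b)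

theorem dM_mul (i : Fin d) (hU : IsOpen U) (hF : SmoothM F U) (hG : SmoothM G U) (hx : x ∈ U) :
    dM i (fun y => F y * G y) x = dM i F x * G x + F x * dM i G x := by
  ext a b
  simp only [dM, Matrix.of_apply, Matrix.add_apply, Matrix.mul_apply]
  rw [pd_sum, ← Finset.sum_add_distrib]
  · exact Finset.sum_congr rfl fun l _ => pd_mul i (diffAt_of_smoothOn hU (hF a l) hx)
      (diffAt_of_smoothOn hU (hG l b) hx)
  · exact fun l _ => (diffAt_of_smoothOn hU (hF a l) hx).mul (diffAt_of_smoothOn hU (hG l b) hx)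

theorem dM_add (i : Fin d) (hU : IsOpen U) (hF : SmoothM F U) (hG : SmoothM G U) (hx : x ∈ U) :
    dM i (fun y => F y + G y) x = dM i F x + dM i G x := by
  ext a b
  exact pd_add i (diffAt_of_smoothOn hU (hF a b) hx) (diffAt_of_smoothOn hU (hG a b) hx)

theorem dM_comm (i j : Fin d) (hU : IsOpen U) (hF : SmoothM F U) (hx : x ∈ U) :
    dM i (dM j F) x = dM j (dM i F) x := by
  ext a b; exact pd_comm i j hU (hF a b) hx

theorem SmoothM.inv (hF : SmoothM F U) (h : ∀ y ∈ U, IsUnit (F y).det) :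
    SmoothM (fun y => (F y)⁻¹) U := by
  have hdet : ∀ H : Coord d → Matrix (Fin d) (Fin d) ℝ, SmoothM H U →
      ContDiffOn ℝ ∞ (fun y => (H y).det) U := fun H hH => by
    simp only [Matrix.det_apply]
    exact ContDiffOn.sum fun σ _ => by
      simp only [Units.smul_def, zsmul_eq_mul]
      exact contDiffOn_const.mul (contDiffOn_prod fun q _ => hH _ _)
  intro a b
  have h1 : ∀ y, (F y)⁻¹ a b = ((F y).det)⁻¹ * (F y).adjugate a b := fun y => by
    rw [Matrix.inv_def, Matrix.smul_apply, smul_eq_mul, Ring.inverse_eq_inv]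
  simp only [h1]
  refine ((hdet F hF).inv fun y hy => (h y hy).ne_zero).mul ?_
  simp only [Matrix.adjugate_apply]
  refine hdet _ fun p q => ?_
  simp only [Matrix.updateRow_apply]
  split_ifs
  · exact contDiffOn_const
  · exact hF p q

end dM

/-! ### The Levi-Civita connection and its curvature in coordinates -/

/-- The matrices `(ω_i)^k_j = Γ^k_{ij}` of the Levi-Civita connection. -/
def conn {d : ℕ} (G : Coord d → Matrix (Fin d) (Fin d) ℝ) (i : Fin d) (x : Coord d) :
    Matrix (Fin d) (Fin d) ℝ :=
  Matrix.of fun k j => christoffel G k i j x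

/-- The matrices `(Ω_{kj})^h_i = R_{kji}{}^h` of the curvature. -/
def curvM {d : ℕ} (G : Coord d → Matrix (Fin d) (Fin d) ℝ) (k j : Fin d) (x : Coord d) :
    Matrix (Fin d) (Fin d) ℝ :=
  Matrix.of fun h i => curv G k j i h x

/-- A smooth nondegenerate symmetric tensor on an open set of coordinates; its signature plays no
role. The symmetry is required at all points, so that the components can be exchanged under a
derivative. -/
structure IsMetric {d : ℕ} (G : Coord d → Matrix (Fin d) (Fin d) ℝ) (U : Set (Coord d)) :
    Prop where
  isOpen : IsOpen U
  smooth : SmoothM G U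
  symm : ∀ y, (G y).IsSymm
  unit : ∀ y ∈ U, IsUnit (G y).det

section LeviCivita
variable {d : ℕ} {G : Coord d → Matrix (Fin d) (Fin d) ℝ} {x : Coord d} {U : Set (Coord d)}

theorem curvM_eq (k j : Fin d) :
    curvM G k j x = dM k (conn G j) x - dM j (conn G k) x
      + conn G k x * conn G j x - conn G j x * conn G k x := by
  ext h i
  simp only [curvM, curv, dM, conn, Matrix.of_apply, Matrix.sub_apply, Matrix.add_apply,
    Matrix.mul_apply]

theorem IsMetric.smooth_conn (hG : IsMetric G U) (i : Fin d) : SmoothM (conn G i) U := by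
  intro k j
  simp only [conn, christoffel, Matrix.of_apply]
  refine contDiffOn_const.mul (ContDiffOn.sum fun l _ => (hG.smooth.inv hG.unit k l).mul ?_)
  exact ((contDiffOn_pd _ hG.isOpen (hG.smooth _ _)).add
    (contDiffOn_pd _ hG.isOpen (hG.smooth _ _))).sub (contDiffOn_pd _ hG.isOpen (hG.smooth _ _))

theorem IsMetric.smooth_curvM (hG : IsMetric G U) (k j : Fin d) : SmoothM (curvM G k j) U := by
  intro h i
  simp only [curvM, curv, Matrix.of_apply]
  have hc := hG.smooth_conn
  have hs : ∀ a b, ContDiffOn ℝ ∞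
      (fun y => ∑ l, christoffel G h a l y * christoffel G l b i y) U := fun a b =>
    ContDiffOn.sum fun l _ => (hc a h l).mul (hc b l i)
  exact (((contDiffOn_pd k hG.isOpen (hc j h i)).sub (contDiffOn_pd j hG.isOpen (hc k h i))).add
    (hs k j)).sub (hs j k)

theorem IsMetric.christoffel_symm (hG : IsMetric G U) (k i j : Fin d) (y : Coord d) :
    christoffel G k i j y = christoffel G k j i y := by
  have h : ∀ l, pd l (fun y => G y i j) y = pd l (fun y => G y j i) y := fun l => by
    congr 1; ext z; exact ((hG.symm z).apply i j).symm
  unfold christoffel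
  congr 1
  refine Finset.sum_congr rfl fun l _ => ?_
  rw [h l]; ring

/-- The Christoffel symbols of the first kind. -/
theorem IsMetric.lower_christoffel (hG : IsMetric G U) (hx : x ∈ U) (m i j : Fin d) :
    ∑ k, G x m k * christoffel G k i j x = (1 / 2) *
      (pd i (fun y => G y j m) x + pd j (fun y => G y i m) x - pd m (fun y => G y i j) x) := by
  let t : Fin d → ℝ := fun l =>
    pd i (fun y => G y j l) x + pd j (fun y => G y i l) x - pd l (fun y => G y i j) x
  have h1 : ∀ k, christoffel G k i j x = (1 / 2) * ((G x)⁻¹.mulVec t) k := fun k => rfl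
  have h2 : (G x).mulVec ((G x)⁻¹.mulVec t) = t := by
    rw [Matrix.mulVec_mulVec, Matrix.mul_nonsing_inv _ (hG.unit x hx), Matrix.one_mulVec]
  have h3 := congrFun h2 m
  simp only [h1]
  change _ = (1 / 2) * t m
  rw [← h3]
  change _ = (1 / 2) * ∑ k, G x m k * ((G x)⁻¹.mulVec t) k
  rw [Finset.mul_sum]
  exact Finset.sum_congr rfl fun k _ => by ring

/-- The Levi-Civita connection is metric. -/
theorem IsMetric.dM_eq (hG : IsMetric G U) (hx : x ∈ U) (i : Fin d) :
    dM i G x = (conn G i x).transpose * G x + G x * conn G i x := by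
  ext j l
  have hs : ∀ m a b, pd m (fun y => G y a b) x = pd m (fun y => G y b a) x := fun m a b => by
    congr 1; ext z; exact ((hG.symm z).apply a b).symm
  have h1 := hG.lower_christoffel hx l i j
  have h2 := hG.lower_christoffel hx j i l
  rw [hs i l j, hs j i l] at h2
  rw [hs j i l] at h1
  simp only [dM, conn, Matrix.of_apply, Matrix.add_apply, Matrix.mul_apply, Matrix.transpose_apply]
  have h3 : ∑ m, christoffel G m i j x * G x m l = ∑ m, G x l m * christoffel G m i j x :=
    Finset.sum_congr rfl fun m _ => by rw [mul_comm, (hG.symm x).apply l m]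
  rw [h3, h1, h2]; ring

/-- A torsion-free metric connection is the Levi-Civita connection. -/
theorem IsMetric.eq_conn (hG : IsMetric G U) (hx : x ∈ U)
    (C : Fin d → Matrix (Fin d) (Fin d) ℝ) (htor : ∀ i j k, C i k j = C j k i)
    (hmet : ∀ i, dM i G x = (C i).transpose * G x + G x * C i) (i : Fin d) :
    C i = conn G i x := by
  have key : G x * C i = G x * conn G i x := by
    ext m j
    have e : ∀ a b c, pd a (fun y => G y b c) x =
        ∑ m, G x c m * C a m b + ∑ m, G x b m * C a m c := fun a b c => by
      have := congrFun (congrFun (hmet a) b) c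
      simp only [dM, Matrix.of_apply, Matrix.add_apply, Matrix.mul_apply,
        Matrix.transpose_apply] at this
      rw [this]
      congr 1
      exact Finset.sum_congr rfl fun m _ => by rw [mul_comm, (hG.symm x).apply c m]
    have h := hG.lower_christoffel hx m i j
    rw [e i j m, e j i m, e m i j] at h
    simp only [conn, Matrix.of_apply, Matrix.mul_apply]
    rw [h]
    simp only [htor j i, htor m i, htor m j]
    ring
  have h2 := congrArg (fun A => (G x)⁻¹ * A) key
  simpa only [← Matrix.mul_assoc, Matrix.nonsing_inv_mul _ (hG.unit x hx), Matrix.one_mul] using h2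

end LeviCivita

/-! ### Change of coordinates -/

/-- The Jacobian matrix `∂_i τ^a`. -/
def jac {d : ℕ} (τ : Coord d → Coord d) (x : Coord d) : Matrix (Fin d) (Fin d) ℝ :=
  Matrix.of fun a i => pd i (fun y => τ y a) x

section Change
variable {d : ℕ} {G G' : Coord d → Matrix (Fin d) (Fin d) ℝ} {U V : Set (Coord d)}
  {τ : Coord d → Coord d} {x : Coord d}

theorem smoothM_jac (hU : IsOpen U) (hτ : ContDiffOn ℝ ∞ τ U) : SmoothM (jac τ) U := by
  intro a b
  refine contDiffOn_pd b hU ?_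
  exact (EuclideanSpace.proj a : Coord d →L[ℝ] ℝ).contDiff.comp_contDiffOn hτ

theorem dM_comp (i : Fin d) {F : Coord d → Matrix (Fin d) (Fin d) ℝ}
    (hV : IsOpen V) (hF : SmoothM F V) (hx : τ x ∈ V) (hτ : DifferentiableAt ℝ τ x) :
    dM i (fun y => F (τ y)) x = ∑ a, jac τ x a i • dM a F (τ x) := by
  ext p q
  rw [Matrix.sum_apply]
  exact pd_comp i (diffAt_of_smoothOn hV (hF p q) hx) hτ

theorem smoothM_comp {F : Coord d → Matrix (Fin d) (Fin d) ℝ} (hF : SmoothM F V)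
    (hτ : ContDiffOn ℝ ∞ τ U) (hm : Set.MapsTo τ U V) : SmoothM (fun y => F (τ y)) U :=
  fun a b => (hF a b).comp hτ hm

theorem dM_jac (hU : IsOpen U) (hτ : ContDiffOn ℝ ∞ τ U) (hx : x ∈ U) (i j a : Fin d) :
    dM i (jac τ) x a j = dM j (jac τ) x a i :=
  pd_comm i j hU ((EuclideanSpace.proj a : Coord d →L[ℝ] ℝ).contDiff.comp_contDiffOn hτ) hx

/-- The transformation law of the Levi-Civita connection. -/
theorem jac_mul_conn (hG : IsMetric G U) (hG' : IsMetric G' V) (hτ : ContDiffOn ℝ ∞ τ U)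
    (hm : Set.MapsTo τ U V) (hP : ∀ y ∈ U, IsUnit (jac τ y).det)
    (hGG : ∀ y ∈ U, G y = (jac τ y).transpose * G' (τ y) * jac τ y) (hx : x ∈ U) (i : Fin d) :
    jac τ x * conn G i x =
      (∑ a, jac τ x a i • conn G' a (τ x)) * jac τ x + dM i (jac τ) x := by
  set P := jac τ x with hPdef
  set A : Fin d → Matrix (Fin d) (Fin d) ℝ := fun i => ∑ a, P a i • conn G' a (τ x) with hA
  have hJ := smoothM_jac hG.isOpen hτ
  have hPi : P * P⁻¹ = 1 := Matrix.mul_nonsing_inv _ (hP x hx)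
  have h := hG.eq_conn hx (fun i => P⁻¹ * (A i * P + dM i (jac τ) x)) ?_ ?_ i
  · rw [← h, ← Matrix.mul_assoc, hPi, Matrix.one_mul]
  · intro i j k
    simp only [Matrix.mul_apply (M := P⁻¹), Matrix.add_apply]
    refine Finset.sum_congr rfl fun c _ => ?_
    rw [dM_jac hG.isOpen hτ hx i j c]
    congr 2
    simp only [hA, Matrix.mul_apply, Matrix.sum_apply, Matrix.smul_apply, smul_eq_mul,
      Finset.sum_mul]
    rw [Finset.sum_comm]
    refine Finset.sum_congr rfl fun a _ => Finset.sum_congr rfl fun b _ => ?_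
    rw [show conn G' b (τ x) c a = conn G' a (τ x) c b from hG'.christoffel_symm _ _ _ _]
    ring
  · intro i
    have hJt : SmoothM (fun y => (jac τ y).transpose) U := fun a b => hJ b a
    have hGτ := smoothM_comp hG'.smooth hτ hm
    rw [dM_congr i hG.isOpen hx hGG, dM_mul i hG.isOpen (hJt.mul hGτ) hJ hx,
      dM_mul i hG.isOpen hJt hGτ hx,
      dM_comp i hG'.isOpen hG'.smooth (hm hx) ((hτ.contDiffAt (hG.isOpen.mem_nhds hx)).differentiableAt
        (by simp))]
    have e1 : dM i (fun y => (jac τ y).transpose) x = (dM i (jac τ) x).transpose := rfl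
    have e2 : ∑ a, jac τ x a i • dM a G' (τ x) = (A i).transpose * G' (τ x) + G' (τ x) * A i := by
      simp only [hG'.dM_eq (hm hx), hA, Matrix.transpose_sum, Matrix.transpose_smul,
        Finset.sum_mul, Finset.mul_sum, smul_add, Finset.sum_add_distrib, Matrix.smul_mul,
        Matrix.mul_smul]
      rfl
    set D := dM i (jac τ) x
    have e3 : (P⁻¹ * (A i * P + D)).transpose * G x =
        (A i * P + D).transpose * G' (τ x) * P := by
      rw [hGG x hx, Matrix.transpose_mul, ← Matrix.mul_assoc, ← Matrix.mul_assoc,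
        Matrix.mul_assoc _ _ P.transpose, ← Matrix.transpose_mul P, hPi, Matrix.transpose_one,
        Matrix.mul_one]
    have e4 : G x * (P⁻¹ * (A i * P + D)) = P.transpose * G' (τ x) * (A i * P + D) := by
      rw [hGG x hx, ← Matrix.mul_assoc, Matrix.mul_assoc _ _ P⁻¹, hPi, Matrix.mul_one]
    rw [e1, e2, e3, e4, Matrix.transpose_add, Matrix.transpose_mul]
    noncomm_ring

/-- The transformation law of the curvature. -/
theorem jac_mul_curvM (hG : IsMetric G U) (hG' : IsMetric G' V) (hτ : ContDiffOn ℝ ∞ τ U)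
    (hm : Set.MapsTo τ U V) (hP : ∀ y ∈ U, IsUnit (jac τ y).det)
    (hGG : ∀ y ∈ U, G y = (jac τ y).transpose * G' (τ y) * jac τ y) (hx : x ∈ U) (k j : Fin d) :
    jac τ x * curvM G k j x =
      (∑ a, ∑ b, (jac τ x a k * jac τ x b j) • curvM G' a b (τ x)) * jac τ x := by
  have hU := hG.isOpen
  have hJ := smoothM_jac hU hτ
  set A : Fin d → Coord d → Matrix (Fin d) (Fin d) ℝ :=
    fun i y => ∑ a, jac τ y a i • conn G' a (τ y) with hA
  have hcs : ∀ a, SmoothM (fun y => conn G' a (τ y)) U := fun a =>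
    smoothM_comp (hG'.smooth_conn a) hτ hm
  have hAs : ∀ i, SmoothM (A i) U := fun i p q => by
    simp only [hA, Matrix.sum_apply, Matrix.smul_apply, smul_eq_mul]
    exact ContDiffOn.sum fun a _ => (hJ a i).mul (hcs a p q)
  have hτx := (hτ.contDiffAt (hU.mem_nhds hx)).differentiableAt (n := ∞) (by simp)
  have hdA : ∀ k j, dM k (A j) x = ∑ a, dM k (jac τ) x a j • conn G' a (τ x) +
      ∑ a, ∑ b, (jac τ x a k * jac τ x b j) • dM a (conn G' b) (τ x) := fun k j => by
    have e : ∀ b, dM k (fun y => conn G' b (τ y)) x = ∑ a, jac τ x a k • dM a (conn G' b) (τ x) :=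
      fun b => dM_comp k hG'.isOpen (hG'.smooth_conn b) (hm hx) hτx
    have e' : dM k (A j) x = ∑ b, (dM k (jac τ) x b j • conn G' b (τ x) +
        jac τ x b j • dM k (fun y => conn G' b (τ y)) x) := by
      ext p q
      simp only [hA, dM, Matrix.of_apply, Matrix.sum_apply, Matrix.smul_apply, smul_eq_mul,
        Matrix.add_apply]
      rw [pd_sum]
      · exact Finset.sum_congr rfl fun b _ => pd_mul k (diffAt_of_smoothOn hU (hJ b j) hx)
          (diffAt_of_smoothOn hU (hcs b p q) hx)
      · exact fun b _ => (diffAt_of_smoothOn hU (hJ b j) hx).mul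
          (diffAt_of_smoothOn hU (hcs b p q) hx)
    rw [e', Finset.sum_add_distrib]
    congr 1
    rw [Finset.sum_comm]
    refine Finset.sum_congr rfl fun b _ => ?_
    rw [e b, Finset.smul_sum]
    refine Finset.sum_congr rfl fun a _ => ?_
    rw [smul_smul, mul_comm]
  have hAA : ∀ k j, A k x * A j x = ∑ a, ∑ b, (jac τ x a k * jac τ x b j) •
      (conn G' a (τ x) * conn G' b (τ x)) := fun k j => by
    simp only [hA, Finset.sum_mul_sum, smul_mul_smul_comm]
  have hAA' : ∀ k j, A j x * A k x = ∑ a, ∑ b, (jac τ x a k * jac τ x b j) •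
      (conn G' b (τ x) * conn G' a (τ x)) := fun k j => by
    rw [hAA, Finset.sum_comm]
    simp only [mul_comm (jac τ x _ j)]
  have hdA' : ∀ k j, dM j (A k) x = ∑ a, dM j (jac τ) x a k • conn G' a (τ x) +
      ∑ a, ∑ b, (jac τ x a k * jac τ x b j) • dM b (conn G' a) (τ x) := fun k j => by
    rw [hdA, Finset.sum_comm]
    simp only [mul_comm (jac τ x _ j)]
  have hsum : ∑ a, ∑ b, (jac τ x a k * jac τ x b j) • curvM G' a b (τ x) =
      dM k (A j) x - dM j (A k) x + A k x * A j x - A j x * A k x := by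
    rw [hdA, hdA', hAA, hAA']
    simp only [dM_jac hU hτ hx k j, curvM_eq, smul_add, smul_sub, Finset.sum_add_distrib,
      Finset.sum_sub_distrib]
    abel
  have hc : ∀ i, ∀ y ∈ U, jac τ y * conn G i y = A i y * jac τ y + dM i (jac τ) y :=
    fun i y hy => jac_mul_conn hG hG' hτ hm hP hGG hy i
  have hd : ∀ k j, dM k (jac τ) x * conn G j x + jac τ x * dM k (conn G j) x =
      dM k (A j) x * jac τ x + A j x * dM k (jac τ) x + dM k (dM j (jac τ)) x := fun k j => by
    rw [← dM_mul k hU hJ (hG.smooth_conn j) hx, dM_congr k hU hx (hc j),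
      dM_add k hU ((hAs j).mul hJ) (hJ.dM j hU) hx, dM_mul k hU (hAs j) hJ hx]
  rw [hsum, curvM_eq]
  have h1 := hd k j
  have h2 := hd j k
  rw [dM_comm j k hU hJ hx] at h2
  have c1 := hc j x hx
  have c2 := hc k x hx
  have e1 : jac τ x * dM k (conn G j) x = dM k (A j) x * jac τ x + A j x * dM k (jac τ) x
      + dM k (dM j (jac τ)) x - dM k (jac τ) x * conn G j x := by rw [← h1]; abel
  have e2 : jac τ x * dM j (conn G k) x = dM j (A k) x * jac τ x + A k x * dM j (jac τ) x
      + dM k (dM j (jac τ)) x - dM j (jac τ) x * conn G k x := by rw [← h2]; abel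
  have e3 : jac τ x * (conn G k x * conn G j x) =
      A k x * (A j x * jac τ x + dM j (jac τ) x) + dM k (jac τ) x * conn G j x := by
    rw [← Matrix.mul_assoc, c2, Matrix.add_mul, Matrix.mul_assoc, c1]
  have e4 : jac τ x * (conn G j x * conn G k x) =
      A j x * (A k x * jac τ x + dM k (jac τ) x) + dM j (jac τ) x * conn G k x := by
    rw [← Matrix.mul_assoc, c1, Matrix.add_mul, Matrix.mul_assoc, c2]
  rw [Matrix.mul_sub, Matrix.mul_add, Matrix.mul_sub, e1, e2, e3, e4]
  noncomm_ring

end Change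

/-! ### Sasakian structures in coordinates -/

theorem pd_mulVec {d : ℕ} {x : Coord d} {U : Set (Coord d)} (i : Fin d)
    {F : Coord d → Matrix (Fin d) (Fin d) ℝ}
    {v : Coord d → Fin d → ℝ} (hU : IsOpen U) (hF : SmoothM F U)
    (hv : ∀ a, ContDiffOn ℝ ∞ (fun y => v y a) U) (hx : x ∈ U) (h : Fin d) :
    pd i (fun y => (F y).mulVec (v y) h) x =
      (dM i F x).mulVec (v x) h + (F x).mulVec (fun a => pd i (fun y => v y a) x) h := by
  simp only [Matrix.mulVec, dotProduct]
  rw [pd_sum, ← Finset.sum_add_distrib]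
  · exact Finset.sum_congr rfl fun l _ => pd_mul i (diffAt_of_smoothOn hU (hF h l) hx)
      (diffAt_of_smoothOn hU (hv l) hx)
  · exact fun l _ => (diffAt_of_smoothOn hU (hF h l) hx).mul (diffAt_of_smoothOn hU (hv l) hx)

/-- The components of a Sasakian structure in a chart: `G` is the metric, `J` the matrix
`J^k_j = φ_j{}^k`. The last field says `∇_i φ_j{}^k = g_{ij} ξ^k - η_j δ_i{}^k`; the condition
`φ_{ij} = -(dη)_{ij}` follows from the others (see `deriv_η`) and is not included. -/
structure LocalSasaki {d : ℕ} (G J : Coord d → Matrix (Fin d) (Fin d) ℝ)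
    (ξ η : Coord d → Fin d → ℝ) (U : Set (Coord d)) : Prop where
  metric : IsMetric G U
  smooth_J : SmoothM J U
  smooth_ξ : ∀ a, ContDiffOn ℝ ∞ (fun y => ξ y a) U
  smooth_η : ∀ a, ContDiffOn ℝ ∞ (fun y => η y a) U
  J_mul_J : ∀ y ∈ U, J y * J y = -1 + Matrix.vecMulVec (ξ y) (η y)
  η_ξ : ∀ y ∈ U, η y ⬝ᵥ ξ y = 1
  J_ξ : ∀ y ∈ U, (J y).mulVec (ξ y) = 0
  η_J : ∀ y ∈ U, Matrix.vecMul (η y) (J y) = 0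
  G_eq : ∀ y ∈ U, G y = (J y).transpose * G y * J y + Matrix.vecMulVec (η y) (η y)
  normal : ∀ y ∈ U, ∀ i, dM i J y = J y * conn G i y - conn G i y * J y
    + Matrix.vecMulVec (ξ y) (G y i) - Matrix.vecMulVec (Pi.single i 1) (η y)

namespace LocalSasaki
variable {d : ℕ} {G J : Coord d → Matrix (Fin d) (Fin d) ℝ}
    {ξ η : Coord d → Fin d → ℝ} {U : Set (Coord d)} {x : Coord d}

theorem G_ξ (S : LocalSasaki G J ξ η U) (hx : x ∈ U) : (G x).mulVec (ξ x) = η x := by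
  rw [S.G_eq x hx, Matrix.add_mulVec, ← Matrix.mulVec_mulVec, S.J_ξ x hx, Matrix.mulVec_zero,
    zero_add, Matrix.vecMulVec_mulVec, S.η_ξ x hx]
  simp

theorem ξ_G (S : LocalSasaki G J ξ η U) (hx : x ∈ U) : Matrix.vecMul (ξ x) (G x) = η x := by
  rw [← S.G_ξ hx, ← Matrix.vecMul_transpose, (S.metric.symm x).eq]

/-- The tensor `φ_{ij}` is skew. -/
theorem transpose_mul (S : LocalSasaki G J ξ η U) (hx : x ∈ U) :
    (J x).transpose * G x = -(G x * J x) := by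
  have h1 : (J x).transpose * G x * Matrix.vecMulVec (ξ x) (η x) = 0 := by
    rw [Matrix.mul_vecMulVec, ← Matrix.mulVec_mulVec, S.G_ξ hx, Matrix.mulVec_transpose,
      S.η_J x hx]
    ext; simp [Matrix.vecMulVec_apply]
  have h2 : G x * J x = (J x).transpose * G x * (J x * J x) := by
    conv_lhs => rw [S.G_eq x hx, Matrix.add_mul, Matrix.vecMulVec_mul, S.η_J x hx]
    ext; simp [Matrix.mul_assoc]
  rw [h2, S.J_mul_J x hx, Matrix.mul_add, h1]
  simp

theorem skew_apply (S : LocalSasaki G J ξ η U) (hx : x ∈ U) (i j : Fin d) :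
    (G x * J x) i j = -(G x * J x) j i := by
  have h := congrFun (congrFun (S.transpose_mul hx) j) i
  rw [Matrix.neg_apply] at h
  rw [← h, Matrix.mul_apply, Matrix.mul_apply]
  refine Finset.sum_congr rfl fun l _ => ?_
  rw [(S.metric.symm x).apply l i, mul_comm, Matrix.transpose_apply]

/-- `∇_i ξ^h = -φ_i{}^h`. -/
theorem deriv_ξ (S : LocalSasaki G J ξ η U) (hx : x ∈ U) (i h : Fin d) :
    pd i (fun y => ξ y h) x = -(conn G i x).mulVec (ξ x) h - J x h i := by
  set dξ : Fin d → ℝ := fun a => pd i (fun y => ξ y a) x with hdξ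
  set u : Fin d → ℝ := dξ + (conn G i x).mulVec (ξ x) with hu
  have hU := S.metric.isOpen
  -- the derivative of `φ ξ = 0` determines `u = ∇_i ξ` up to a multiple of `ξ`
  have h1 : (J x).mulVec u = Pi.single i 1 - η x i • ξ x := by
    have e : (dM i J x).mulVec (ξ x) + (J x).mulVec dξ = 0 := by
      ext a
      have e1 := pd_mulVec (x := x) i hU S.smooth_J S.smooth_ξ hx a
      rw [pd_congr_on (g := fun _ => 0) i hU hx (fun y hy => by rw [S.J_ξ y hy]; rfl),
        pd_const] at e1
      exact e1.symm
    rw [S.normal x hx, Matrix.sub_mulVec, Matrix.add_mulVec, Matrix.sub_mulVec,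
      Matrix.vecMulVec_mulVec, Matrix.vecMulVec_mulVec, ← Matrix.mulVec_mulVec,
      ← Matrix.mulVec_mulVec, S.J_ξ x hx, Matrix.mulVec_zero, S.η_ξ x hx] at e
    have e2 : G x i ⬝ᵥ ξ x = η x i := congrFun (S.G_ξ hx) i
    rw [e2] at e
    rw [hu, Matrix.mulVec_add]
    simp only [MulOpposite.op_one, one_smul, op_smul_eq_smul, sub_zero] at e
    rw [← sub_eq_zero, ← e]
    abel
  -- and the derivative of `g(ξ, ξ) = 1` shows that it is orthogonal to `ξ`
  have h2 : η x ⬝ᵥ u = 0 := by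
    have e1 : ∀ y ∈ U, ∑ a, ξ y a * (G y).mulVec (ξ y) a = 1 := fun y hy => by
      rw [S.G_ξ hy, ← S.η_ξ y hy, dotProduct_comm]; rfl
    have hGξ : ∀ a, ContDiffOn ℝ ∞ (fun y => (G y).mulVec (ξ y) a) U := fun a => by
      simp only [Matrix.mulVec, dotProduct]
      exact ContDiffOn.sum fun l _ => (S.metric.smooth a l).mul (S.smooth_ξ l)
    have e2 : pd i (fun y => ∑ a, ξ y a * (G y).mulVec (ξ y) a) x = 0 := by
      rw [pd_congr_on (g := fun _ => 1) i hU hx e1, pd_const]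
    rw [pd_sum _ _ _ (fun a _ => (diffAt_of_smoothOn hU (S.smooth_ξ a) hx).fun_mul
      (diffAt_of_smoothOn hU (hGξ a) hx))] at e2
    simp only [fun a => pd_mul i (diffAt_of_smoothOn hU (S.smooth_ξ a) hx)
      (diffAt_of_smoothOn hU (hGξ a) hx),
      fun a => pd_mulVec i hU S.metric.smooth S.smooth_ξ hx a, S.G_ξ hx] at e2
    have e3 : dξ ⬝ᵥ η x + (ξ x ⬝ᵥ (dM i G x).mulVec (ξ x) + ξ x ⬝ᵥ (G x).mulVec dξ) = 0 := by
      rw [← e2]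
      simp only [dotProduct, Finset.sum_add_distrib, mul_add]
      rfl
    rw [S.metric.dM_eq hx, Matrix.add_mulVec, ← Matrix.mulVec_mulVec, ← Matrix.mulVec_mulVec,
      S.G_ξ hx, dotProduct_add, Matrix.dotProduct_mulVec _ (G x), Matrix.dotProduct_mulVec _ (G x),
      S.ξ_G hx, Matrix.dotProduct_mulVec, Matrix.vecMul_transpose, dotProduct_comm dξ,
      dotProduct_comm _ (η x)] at e3
    rw [hu, dotProduct_add]
    linarith
  have h3 := congrArg (J x).mulVec h1
  rw [Matrix.mulVec_mulVec, S.J_mul_J x hx, Matrix.add_mulVec, Matrix.vecMulVec_mulVec, h2,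
    Matrix.mulVec_sub, Matrix.mulVec_smul, S.J_ξ x hx] at h3
  have h4 := congrFun h3 h
  simp [hu, hdξ, Matrix.neg_mulVec] at h4
  linarith

/-- `∇_i η_j = -φ_{ij}`. -/
theorem deriv_η (S : LocalSasaki G J ξ η U) (hx : x ∈ U) (i j : Fin d) :
    pd i (fun y => η y j) x = Matrix.vecMul (η x) (conn G i x) j - (G x * J x) j i := by
  have hU := S.metric.isOpen
  rw [pd_congr_on (g := fun y => (G y).mulVec (ξ y) j) i hU hx (fun y hy => by rw [S.G_ξ hy]),
    pd_mulVec i hU S.metric.smooth S.smooth_ξ hx, S.metric.dM_eq hx]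
  have h : (fun a => pd i (fun y => ξ y a) x) =
      -(conn G i x).mulVec (ξ x) - (J x).col i := by
    ext a; exact S.deriv_ξ hx i a
  rw [h, Matrix.add_mulVec, Matrix.mulVec_sub, Matrix.mulVec_neg, ← Matrix.mulVec_mulVec,
    S.G_ξ hx, Matrix.mulVec_mulVec, Matrix.mulVec_transpose]
  simp only [Pi.add_apply, Pi.sub_apply, Pi.neg_apply, Matrix.mul_apply, Matrix.mulVec, dotProduct,
    Matrix.col_apply]
  ring

theorem dM_J_apply (S : LocalSasaki G J ξ η U) (hx : x ∈ U) (k h j : Fin d) :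
    pd k (fun y => J y h j) x = (J x * conn G k x) h j - (conn G k x * J x) h j
      + ξ x h * G x k j - (if h = k then 1 else 0) * η x j := by
  have := congrFun (congrFun (S.normal x hx k) h) j
  simpa [dM, Matrix.vecMulVec_apply, Pi.single_apply] using this

theorem mul_conn_comm (S : LocalSasaki G J ξ η U) (A : Matrix (Fin d) (Fin d) ℝ) (h k j : Fin d) :
    (A * conn G k x) h j = (A * conn G j x) h k := by
  simp only [Matrix.mul_apply, conn, Matrix.of_apply]
  exact Finset.sum_congr rfl fun l _ => by rw [S.metric.christoffel_symm]

theorem vecMul_conn_comm (S : LocalSasaki G J ξ η U) (v : Fin d → ℝ) (k j : Fin d) :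
    Matrix.vecMul v (conn G k x) j = Matrix.vecMul v (conn G j x) k := by
  simp only [Matrix.vecMul, dotProduct, conn, Matrix.of_apply]
  exact Finset.sum_congr rfl fun l _ => by rw [S.metric.christoffel_symm]

/-- The Ricci identity for the characteristic vector field. -/
theorem curvM_ξ (S : LocalSasaki G J ξ η U) (hx : x ∈ U) (k j h : Fin d) :
    (curvM G k j x).mulVec (ξ x) h =
      η x j * (if h = k then 1 else 0) - η x k * (if h = j then 1 else 0) := by
  have hU := S.metric.isOpen
  have hc := S.metric.smooth_conn
  have hωξ : ∀ j a, ContDiffOn ℝ ∞ (fun y => (conn G j y).mulVec (ξ y) a) U := fun j a => by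
    simp only [Matrix.mulVec, dotProduct]
    exact ContDiffOn.sum fun l _ => (hc j a l).mul (S.smooth_ξ l)
  have key : ∀ k j, pd k (pd j (fun y => ξ y h)) x =
      -((dM k (conn G j) x).mulVec (ξ x) h) + (conn G j x * conn G k x).mulVec (ξ x) h
      + (conn G j x * J x) h k - pd k (fun y => J y h j) x := fun k j => by
    rw [pd_congr_on (g := fun y => -(conn G j y).mulVec (ξ y) h - J y h j) k hU hx
      (fun y hy => S.deriv_ξ hy j h),
      pd_sub k (diffAt_of_smoothOn hU (hωξ j h) hx).fun_neg (diffAt_of_smoothOn hU (S.smooth_J h j) hx),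
      pd_neg, pd_mulVec k hU (hc j) S.smooth_ξ hx]
    have e : (fun a => pd k (fun y => ξ y a) x) = -(conn G k x).mulVec (ξ x) - (J x).col k := by
      ext a; exact S.deriv_ξ hx k a
    rw [e, Matrix.mulVec_sub, Matrix.mulVec_neg, Matrix.mulVec_mulVec]
    simp only [Pi.sub_apply, Pi.neg_apply, Matrix.mul_apply (N := J x), Matrix.mulVec, dotProduct,
      Matrix.col_apply]
    ring
  have hcomm := pd_comm k j hU (S.smooth_ξ h) hx
  rw [key k j, key j k, S.dM_J_apply hx, S.dM_J_apply hx, S.mul_conn_comm (J x) h j k,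
    (S.metric.symm x).apply k j] at hcomm
  rw [curvM_eq, Matrix.sub_mulVec, Matrix.add_mulVec, Matrix.sub_mulVec]
  simp only [Pi.add_apply, Pi.sub_apply]
  linarith

/-! ### The deformed metric -/

variable (G η) in
/-- The components of `h_ρ = g + t η ⊗ η`, with `t = ρ²`. -/
def defG (t : ℝ) (y : Coord d) : Matrix (Fin d) (Fin d) ℝ :=
  G y + t • Matrix.vecMulVec (η y) (η y)

variable (J η) in
/-- The difference of the Levi-Civita connections of `h_ρ` and of `g`. -/
def defA (t : ℝ) (i : Fin d) (y : Coord d) : Matrix (Fin d) (Fin d) ℝ :=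
  Matrix.of fun h j => -t * (J y h i * η y j + η y i * J y h j)

theorem isMetric_def (S : LocalSasaki G J ξ η U) {t : ℝ} (ht : 0 ≤ t) :
    IsMetric (defG G η t) U where
  isOpen := S.metric.isOpen
  smooth a b := by
    simp only [defG, Matrix.add_apply, Matrix.smul_apply, Matrix.vecMulVec_apply, smul_eq_mul]
    exact (S.metric.smooth a b).add (contDiffOn_const.mul ((S.smooth_η a).mul (S.smooth_η b)))
  symm y := by
    ext a b
    simp only [defG, Matrix.transpose_apply, Matrix.add_apply, Matrix.smul_apply,
      Matrix.vecMulVec_apply, smul_eq_mul, (S.metric.symm y).apply a b]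
    ring
  unit y hy := by
    -- `(g + t η ⊗ η)⁻¹ = g⁻¹ - t / (1 + t) ξ ⊗ ξ`
    refine Matrix.isUnit_det_of_right_inverse
      (B := (G y)⁻¹ - (t / (1 + t)) • Matrix.vecMulVec (ξ y) (ξ y)) ?_
    have h1 : Matrix.vecMul (η y) (G y)⁻¹ = ξ y := by
      rw [← S.ξ_G hy, Matrix.vecMul_vecMul, Matrix.mul_nonsing_inv _ (S.metric.unit y hy),
        Matrix.vecMul_one]
    rw [defG, Matrix.add_mul, Matrix.mul_sub, Matrix.mul_sub,
      Matrix.mul_nonsing_inv _ (S.metric.unit y hy), Matrix.mul_smul, Matrix.mul_vecMulVec,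
      S.G_ξ hy, Matrix.smul_mul, Matrix.vecMulVec_mul, h1, Matrix.smul_mul, Matrix.mul_smul,
      Matrix.vecMulVec_mul_vecMulVec, S.η_ξ y hy]
    have h2 : (1 + t) ≠ 0 := by positivity
    ext a b
    simp [Matrix.vecMulVec_apply]
    field_simp
    ring

/-- The Levi-Civita connection of the deformed metric. -/
theorem conn_def (S : LocalSasaki G J ξ η U) {t : ℝ} (ht : 0 ≤ t) (hx : x ∈ U) (i : Fin d) :
    conn (defG G η t) i x = conn G i x + defA J η t i x := by
  symm
  have hU := S.metric.isOpen
  refine (S.isMetric_def ht).eq_conn hx (fun i => conn G i x + defA J η t i x) ?_ ?_ i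
  · intro i j k
    simp only [Matrix.add_apply, conn, defA, Matrix.of_apply]
    rw [S.metric.christoffel_symm k j i]
    ring
  · intro i
    have hHJ : ∀ a b, (defG G η t x * J x) a b = (G x * J x) a b := fun a b => by
      rw [defG, Matrix.add_mul, Matrix.smul_mul, Matrix.vecMulVec_mul, S.η_J x hx]
      simp
    have hHA : ∀ a b, (defG G η t x * defA J η t i x) a b =
        -t * ((G x * J x) a i * η x b + η x i * (G x * J x) a b) := fun a b => by
      rw [← hHJ, ← hHJ]
      simp only [Matrix.mul_apply, defA, Matrix.of_apply, Finset.sum_mul, Finset.mul_sum,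
        ← Finset.sum_add_distrib]
      exact Finset.sum_congr rfl fun l _ => by ring
    have hHc : ∀ a b, (defG G η t x * conn G i x) a b = (G x * conn G i x) a b +
        t * (η x a * Matrix.vecMul (η x) (conn G i x) b) := fun a b => by
      rw [defG, Matrix.add_mul, Matrix.smul_mul, Matrix.vecMulVec_mul]
      simp [Matrix.vecMulVec_apply]
    have hT : (conn G i x + defA J η t i x).transpose * defG G η t x =
        (defG G η t x * (conn G i x + defA J η t i x)).transpose := by
      rw [Matrix.transpose_mul, ((S.isMetric_def ht).symm x).eq]
    have hT' : (conn G i x).transpose * G x = (G x * conn G i x).transpose := by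
      rw [Matrix.transpose_mul, (S.metric.symm x).eq]
    have hG := S.metric.dM_eq hx i
    rw [hT'] at hG
    rw [hT]
    ext a b
    have hGab := congrFun (congrFun hG a) b
    simp only [dM, Matrix.of_apply, Matrix.add_apply, Matrix.transpose_apply] at hGab
    simp only [Matrix.add_apply, Matrix.transpose_apply, Matrix.mul_add, hHA, hHc, dM,
      Matrix.of_apply]
    simp only [defG, Matrix.add_apply, Matrix.smul_apply, Matrix.vecMulVec_apply, smul_eq_mul]
    have da := diffAt_of_smoothOn hU (S.smooth_η a) hx
    have db := diffAt_of_smoothOn hU (S.smooth_η b) hx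
    rw [pd_add i (diffAt_of_smoothOn hU (S.metric.smooth a b) hx)
      ((differentiableAt_const t).fun_mul (da.fun_mul db)),
      pd_mul i (differentiableAt_const t) (da.fun_mul db), pd_const, pd_mul i da db, hGab,
      S.deriv_η hx, S.deriv_η hx, S.skew_apply hx b a]
    ring

/-- The curvature of the deformed metric. -/
theorem curvM_def (S : LocalSasaki G J ξ η U) {t : ℝ} (ht : 0 ≤ t) (hx : x ∈ U)
    (k j h i : Fin d) :
    curvM (defG G η t) k j x h i = curvM G k j x h i
      + t * (2 * η x i * (η x j * (if h = k then 1 else 0) - η x k * (if h = j then 1 else 0))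
        - (G x k i * η x j - G x j i * η x k) * ξ x h
        + J x h j * (G x * J x) i k - J x h k * (G x * J x) i j
        + 2 * J x h i * (G x * J x) j k)
      + t ^ 2 * (η x i * (η x j * (if h = k then 1 else 0) - η x k * (if h = j then 1 else 0))) := by
  have hU := S.metric.isOpen
  have hAs : ∀ j, SmoothM (defA J η t j) U := fun j a b =>
    contDiffOn_const.mul (((S.smooth_J a j).mul (S.smooth_η b)).add
      ((S.smooth_η j).mul (S.smooth_J a b)))
  have hd : ∀ k j, dM k (conn (defG G η t) j) x = dM k (conn G j) x + dM k (defA J η t j) x :=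
    fun k j => by
      rw [dM_congr k hU hx (fun y hy => S.conn_def ht hy j),
        dM_add k hU (S.metric.smooth_conn j) (hAs j) hx]
  have hdA : ∀ k j, dM k (defA J η t j) x h i = -t *
      (pd k (fun y => J y h j) x * η x i + J x h j * pd k (fun y => η y i) x
        + (pd k (fun y => η y j) x * J x h i + η x j * pd k (fun y => J y h i) x)) := fun k j => by
    have d1 := fun a b => diffAt_of_smoothOn hU (S.smooth_J a b) hx
    have d2 := fun a => diffAt_of_smoothOn hU (S.smooth_η a) hx
    simp only [dM, defA, Matrix.of_apply]
    rw [pd_mul k (differentiableAt_const _) (((d1 h j).fun_mul (d2 i)).fun_add ((d2 j).fun_mul (d1 h i))),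
      pd_const, pd_add k ((d1 h j).fun_mul (d2 i)) ((d2 j).fun_mul (d1 h i)), pd_mul k (d1 h j) (d2 i),
      pd_mul k (d2 j) (d1 h i)]
    ring
  have hcA : ∀ k j, (conn G k x * defA J η t j x) h i = -t *
      ((conn G k x * J x) h j * η x i + η x j * (conn G k x * J x) h i) := fun k j => by
    simp only [Matrix.mul_apply, defA, Matrix.of_apply, Finset.sum_mul, Finset.mul_sum,
      ← Finset.sum_add_distrib]
    exact Finset.sum_congr rfl fun l _ => by ring
  have hAc : ∀ k j, (defA J η t j x * conn G k x) h i = -t *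
      (J x h j * Matrix.vecMul (η x) (conn G k x) i + η x j * (J x * conn G k x) h i) :=
    fun k j => by
      simp only [Matrix.mul_apply, defA, Matrix.of_apply, Matrix.vecMul, dotProduct,
        Finset.mul_sum, ← Finset.sum_add_distrib]
      exact Finset.sum_congr rfl fun l _ => by ring
  have hJJ : ∀ a b, ∑ l, J x a l * J x l b = -(if a = b then 1 else 0) + ξ x a * η x b :=
    fun a b => by
      rw [← Matrix.mul_apply, S.J_mul_J x hx]
      simp [Matrix.one_apply, Matrix.vecMulVec_apply]
  have hηJ : ∀ b, ∑ l, η x l * J x l b = 0 := fun b => congrFun (S.η_J x hx) b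
  have hAA : ∀ k j, (defA J η t k x * defA J η t j x) h i = t ^ 2 *
      (η x k * (-(if h = j then 1 else 0) + ξ x h * η x j) * η x i
        + η x k * η x j * (-(if h = i then 1 else 0) + ξ x h * η x i)) := fun k j => by
    have e : (defA J η t k x * defA J η t j x) h i = t ^ 2 *
        (J x h k * (∑ l, η x l * J x l j) * η x i + J x h k * η x j * (∑ l, η x l * J x l i)
          + η x k * (∑ l, J x h l * J x l j) * η x i
          + η x k * η x j * (∑ l, J x h l * J x l i)) := by
      simp only [Matrix.mul_apply, defA, Matrix.of_apply, Finset.sum_mul, Finset.mul_sum,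
        ← Finset.sum_add_distrib]
      exact Finset.sum_congr rfl fun l _ => by ring
    rw [e, hηJ, hηJ, hJJ, hJJ]
    ring
  rw [curvM_eq, curvM_eq, hd, hd, S.conn_def ht hx, S.conn_def ht hx]
  simp only [Matrix.sub_apply, Matrix.add_apply, Matrix.add_mul, Matrix.mul_add, hdA, hcA, hAc, hAA,
    S.dM_J_apply hx, S.deriv_η hx]
  rw [S.mul_conn_comm (J x) h j k, S.vecMul_conn_comm (η x) j k, S.skew_apply hx k j,
    (S.metric.symm x).apply k j]
  ring

theorem curvM_def_ξ (S : LocalSasaki G J ξ η U) {t : ℝ} (ht : 0 ≤ t) (hx : x ∈ U)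
    (k j h : Fin d) :
    (curvM (defG G η t) k j x).mulVec (ξ x) h = (1 + t) ^ 2 *
      (η x j * (if h = k then 1 else 0) - η x k * (if h = j then 1 else 0)) := by
  have h1 : ∑ i, η x i * ξ x i = 1 := S.η_ξ x hx
  have h2 : ∀ a, ∑ i, G x a i * ξ x i = η x a := fun a => congrFun (S.G_ξ hx) a
  have h3 : ∑ i, J x h i * ξ x i = 0 := congrFun (S.J_ξ x hx) h
  have h4 : ∀ a, ∑ i, (G x * J x) i a * ξ x i = 0 := fun a => by
    have : Matrix.vecMul (ξ x) (G x * J x) a = 0 := by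
      rw [← Matrix.vecMul_vecMul, S.ξ_G hx, S.η_J x hx]; rfl
    rw [← this]
    simp only [Matrix.vecMul, dotProduct, mul_comm]
  have e : (curvM (defG G η t) k j x).mulVec (ξ x) h = (curvM G k j x).mulVec (ξ x) h
      + t * (2 * (∑ i, η x i * ξ x i) *
          (η x j * (if h = k then 1 else 0) - η x k * (if h = j then 1 else 0))
        - ((∑ i, G x k i * ξ x i) * η x j - (∑ i, G x j i * ξ x i) * η x k) * ξ x h
        + J x h j * (∑ i, (G x * J x) i k * ξ x i) - J x h k * (∑ i, (G x * J x) i j * ξ x i)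
        + 2 * (∑ i, J x h i * ξ x i) * (G x * J x) j k)
      + t ^ 2 * ((∑ i, η x i * ξ x i) *
        (η x j * (if h = k then 1 else 0) - η x k * (if h = j then 1 else 0))) := by
    simp only [Matrix.mulVec, dotProduct, S.curvM_def ht hx, Finset.sum_mul, Finset.mul_sum,
      ← Finset.sum_add_distrib, ← Finset.sum_sub_distrib]
    exact Finset.sum_congr rfl fun l _ => by ring
  rw [e, h1, h2, h2, h3, h4, h4, S.curvM_ξ hx]
  ring

end LocalSasaki

/-! ### Forms of degree one and two -/

/-- The 1-form `∑ a_i dx^i`. -/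
def lin {d : ℕ} (a : Fin d → ℝ) : Ext d := ∑ i, a i • th i

/-- The 2-form `∑ S_{kj} dx^k ∧ dx^j`. -/
def quad {d : ℕ} (S : Matrix (Fin d) (Fin d) ℝ) : Ext d := ∑ k, ∑ j, S k j • (th k * th j)

section forms
variable {d : ℕ}

theorem lin_sum {ι : Type*} (s : Finset ι) (c : ι → ℝ) (a : ι → Fin d → ℝ) :
    ∑ l ∈ s, c l • lin (a l) = lin (fun i => ∑ l ∈ s, c l * a l i) := by
  simp only [lin, Finset.smul_sum, smul_smul, Finset.sum_smul]
  exact Finset.sum_comm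

theorem quad_add (S T : Matrix (Fin d) (Fin d) ℝ) : quad (S + T) = quad S + quad T := by
  simp only [quad, Matrix.add_apply, add_smul, Finset.sum_add_distrib]

theorem quad_smul (c : ℝ) (S : Matrix (Fin d) (Fin d) ℝ) : quad (c • S) = c • quad S := by
  simp only [quad, Matrix.smul_apply, smul_assoc, Finset.smul_sum]

theorem quad_neg (S : Matrix (Fin d) (Fin d) ℝ) : quad (-S) = -quad S := by
  simp only [quad, Matrix.neg_apply, neg_smul, Finset.sum_neg_distrib]

theorem quad_sum {ι : Type*} (s : Finset ι) (S : ι → Matrix (Fin d) (Fin d) ℝ) :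
    quad (∑ l ∈ s, S l) = ∑ l ∈ s, quad (S l) := by
  classical
  induction s using Finset.induction_on with
  | empty => simp [quad]
  | insert a s ha ih => rw [Finset.sum_insert ha, Finset.sum_insert ha, quad_add, ih]

theorem quad_transpose (S : Matrix (Fin d) (Fin d) ℝ) : quad S.transpose = -quad S := by
  simp only [quad, Matrix.transpose_apply]
  rw [Finset.sum_comm, ← Finset.sum_neg_distrib]
  refine Finset.sum_congr rfl fun k _ => ?_
  rw [← Finset.sum_neg_distrib]
  refine Finset.sum_congr rfl fun j _ => ?_
  rw [th_mul_swap, smul_neg]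

theorem quad_eq_zero {S : Matrix (Fin d) (Fin d) ℝ} (hS : S.transpose = S) : quad S = 0 := by
  have h := quad_transpose S
  rw [hS] at h
  have h2 : (2 : ℝ) • quad S = 0 := by
    rw [two_smul]; nth_rewrite 1 [h]; exact neg_add_cancel _
  exact (smul_eq_zero.1 h2).resolve_left two_ne_zero

theorem quad_commute (S : Matrix (Fin d) (Fin d) ℝ) (x : Ext d) : Commute (quad S) x := by
  unfold quad
  exact Commute.sum_left _ _ _ fun k _ => Commute.sum_left _ _ _ fun j _ =>
    (th_mul_th_commute k j x).smul_left _

theorem lin_mul_lin (a b : Fin d → ℝ) : lin a * lin b = quad (Matrix.vecMulVec a b) := by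
  simp only [lin, quad, Finset.sum_mul_sum, smul_mul_smul_comm, Matrix.vecMulVec_apply]

theorem sum_lin_mul_lin {ι : Type*} (s : Finset ι) (a b : ι → Fin d → ℝ) :
    ∑ l ∈ s, lin (a l) * lin (b l) = quad (Matrix.of fun k j => ∑ l ∈ s, a l k * b l j) := by
  simp only [lin_mul_lin, ← quad_sum]
  congr 1
  ext k j
  simp [Matrix.sum_apply, Matrix.vecMulVec_apply]

theorem lin_mul_self (a : Fin d → ℝ) : lin a * lin a = 0 := by
  rw [lin_mul_lin]
  exact quad_eq_zero (Matrix.transpose_vecMulVec a a)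

/-! ### Contraction with a vector -/

/-- The contraction of a form with a vector. -/
def contr (v : Fin d → ℝ) : Ext d →ₗ[ℝ] Ext d :=
  CliffordAlgebra.contractLeft (Q := (0 : QuadraticForm ℝ (Fin d → ℝ)))
    (∑ i, v i • LinearMap.proj i)

theorem contr_th_mul (v : Fin d → ℝ) (i : Fin d) (x : Ext d) :
    contr v (th i * x) = v i • x - th i * contr v x := by
  unfold contr th
  erw [CliffordAlgebra.contractLeft_ι_mul]
  congr 2
  simp [Pi.single_apply]

theorem contr_one (v : Fin d → ℝ) : contr v (1 : Ext d) = 0 :=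
  CliffordAlgebra.contractLeft_one _ _

theorem contr_lin_mul (v a : Fin d → ℝ) (x : Ext d) :
    contr v (lin a * x) = (a ⬝ᵥ v) • x - lin a * contr v x := by
  simp only [lin, Finset.sum_mul, map_sum, smul_mul_assoc, map_smul, contr_th_mul, smul_sub,
    Finset.sum_sub_distrib, smul_smul, dotProduct, Finset.sum_smul]

theorem contr_quad_mul (v : Fin d → ℝ) {S : Matrix (Fin d) (Fin d) ℝ} (hS : S.transpose = -S)
    (x : Ext d) :
    contr v (quad S * x) = (2 : ℝ) • (lin (Matrix.vecMul v S) * x) + quad S * contr v x := by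
  have h1 : lin (Matrix.vecMul v S) = ∑ k, ∑ j, S k j • v k • th j := by
    simp only [lin, Matrix.vecMul, dotProduct, Finset.sum_smul]
    rw [Finset.sum_comm]
    simp only [smul_smul, mul_comm]
  have h2 : lin (Matrix.vecMul v S) = -∑ k, ∑ j, S k j • v j • th k := by
    have hs : ∀ i j, S j i = -S i j := fun i j => congrFun (congrFun hS i) j
    simp only [lin, Matrix.vecMul, dotProduct, Finset.sum_smul, ← Finset.sum_neg_distrib, smul_smul]
    refine Finset.sum_congr rfl fun k _ => Finset.sum_congr rfl fun j _ => ?_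
    rw [hs k j, mul_neg, neg_smul, mul_comm]
  have h3 : contr v (quad S * x) = (∑ k, ∑ j, S k j • v k • th j) * x
      - (∑ k, ∑ j, S k j • v j • th k) * x + quad S * contr v x := by
    simp only [quad, Finset.sum_mul, map_sum, smul_mul_assoc, map_smul, mul_assoc, contr_th_mul,
      smul_sub, Finset.sum_sub_distrib, mul_sub, mul_smul_comm]
    abel
  rw [h3, ← h1, two_smul, sub_eq_add_neg, ← neg_mul, ← h2]

theorem contr_quad_pow (v : Fin d → ℝ) {S : Matrix (Fin d) (Fin d) ℝ} (hS : S.transpose = -S)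
    (m : ℕ) : quad S * contr v (quad S ^ m) =
      (2 * m : ℝ) • (lin (Matrix.vecMul v S) * quad S ^ m) ∧
    contr v (quad S ^ (m + 1)) = (2 * (m + 1) : ℝ) • (lin (Matrix.vecMul v S) * quad S ^ m) := by
  have step : ∀ m : ℕ, quad S * contr v (quad S ^ m) =
      (2 * m : ℝ) • (lin (Matrix.vecMul v S) * quad S ^ m) →
      contr v (quad S ^ (m + 1)) = (2 * (m + 1) : ℝ) • (lin (Matrix.vecMul v S) * quad S ^ m) := by
    intro m h
    rw [pow_succ', contr_quad_mul v hS, h, ← add_smul]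
    congr 1; ring
  have main : quad S * contr v (quad S ^ m) =
      (2 * m : ℝ) • (lin (Matrix.vecMul v S) * quad S ^ m) := by
    induction m with
    | zero => simp [contr_one]
    | succ m ih =>
      rw [step m ih, mul_smul_comm, ← mul_assoc, (quad_commute S _).eq, mul_assoc, ← pow_succ']
      push_cast
      rfl
  exact ⟨main, step m main⟩

end forms

/-! ### Matrices of forms -/

section matrices
variable {d : ℕ}

/-- The entries of the matrix commute with all forms, as 2-forms do. -/
def Central (A : Matrix (Fin d) (Fin d) (Ext d)) : Prop := ∀ h i x, Commute (A h i) x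

theorem Central.pow {A : Matrix (Fin d) (Fin d) (Ext d)} (hA : Central A) (m : ℕ) :
    Central (A ^ m) := by
  induction m with
  | zero =>
    intro h i x
    rw [pow_zero, Matrix.one_apply]
    split_ifs
    · exact Commute.one_left x
    · exact Commute.zero_left x
  | succ m ih =>
    intro h i x
    rw [pow_succ, Matrix.mul_apply]
    exact Commute.sum_left _ _ _ fun l _ => (ih h l x).mul_left (hA l i x)

/-- Powers of matrices of forms may be computed modulo the annihilator of a form. -/
theorem mul_pow_apply_congr {A B : Matrix (Fin d) (Fin d) (Ext d)} (hB : Central B) (e : Ext d)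
    (h : ∀ p q, e * A p q = e * B p q) (m : ℕ) (p q : Fin d) :
    e * (A ^ m) p q = e * (B ^ m) p q := by
  induction m generalizing p q with
  | zero => rfl
  | succ m ih =>
    rw [pow_succ, pow_succ, Matrix.mul_apply, Matrix.mul_apply, Finset.mul_sum, Finset.mul_sum]
    refine Finset.sum_congr rfl fun l _ => ?_
    rw [← mul_assoc, ih p l, ← (hB.pow m p l e).eq, mul_assoc, h l q, ← mul_assoc, ← mul_assoc,
      (hB.pow m p l e).eq]

/-- The entries of a power of a matrix as sums over paths. -/
theorem sum_path {R : Type*} [Semiring R] (M : Matrix (Fin d) (Fin d) R) (n : ℕ)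
    (g : Fin d → Fin d → R) :
    ∑ κ : Fin (n + 1) → Fin d, g (κ 0) (κ (Fin.last n)) *
      (List.ofFn fun s : Fin n => M (κ s.castSucc) (κ s.succ)).prod =
    ∑ a, ∑ b, g a b * (M ^ n) a b := by
  induction n generalizing g with
  | zero =>
    rw [← Equiv.sum_comp (Equiv.funUnique (Fin 1) (Fin d)).symm]
    simp [Matrix.one_apply]
  | succ n ih =>
    rw [← Equiv.sum_comp (Fin.consEquiv fun _ => Fin d), Fintype.sum_prod_type, Finset.sum_comm]
    have h : ∀ (κ : Fin (n + 1) → Fin d) (x : Fin d),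
        g ((Fin.consEquiv fun _ => Fin d) (x, κ) 0)
          ((Fin.consEquiv fun _ => Fin d) (x, κ) (Fin.last (n + 1))) *
        (List.ofFn fun s : Fin (n + 1) => M ((Fin.consEquiv fun _ => Fin d) (x, κ) s.castSucc)
          ((Fin.consEquiv fun _ => Fin d) (x, κ) s.succ)).prod =
        (g x (κ (Fin.last n)) * M x (κ 0)) *
          (List.ofFn fun s : Fin n => M (κ s.castSucc) (κ s.succ)).prod := by
      intro κ x
      rw [List.ofFn_succ, List.prod_cons, ← mul_assoc]
      simp only [Fin.consEquiv, Equiv.coe_fn_mk, Fin.cons_succ, ← Fin.succ_last, Fin.cons_zero,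
        Fin.castSucc_zero, ← Fin.succ_castSucc]
    simp only [h, ← Finset.sum_mul]
    rw [ih fun c b => ∑ x, g x b * M x c]
    simp only [Finset.sum_mul, pow_succ', Matrix.mul_apply, Finset.mul_sum, mul_assoc]
    calc _ = ∑ a, ∑ x, ∑ b, g x b * (M x a * (M ^ n) a b) :=
          Finset.sum_congr rfl fun a _ => Finset.sum_comm
      _ = ∑ x, ∑ a, ∑ b, g x b * (M x a * (M ^ n) a b) := Finset.sum_comm
      _ = _ := Finset.sum_congr rfl fun x _ => Finset.sum_comm

/-- A cyclic form of `sum_path`. -/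
theorem sum_cycle {R : Type*} [Semiring R] (M : Matrix (Fin d) (Fin d) R) (n : ℕ)
    (g : Fin d → Fin d → R) :
    ∑ κ : Fin (n + 1) → Fin d, g (κ 1) (κ 0) *
      (List.ofFn fun s : Fin n => M (κ s.succ) (κ (s.succ + 1))).prod =
    ∑ a, ∑ b, g a b * (M ^ n) a b := by
  rw [← sum_path, ← Equiv.sum_comp (Equiv.arrowCongr (Equiv.addRight (1 : Fin (n + 1)))
    (Equiv.refl (Fin d)))]
  refine Finset.sum_congr rfl fun κ _ => ?_
  have h : ∀ j, Equiv.arrowCongr (Equiv.addRight (1 : Fin (n + 1))) (Equiv.refl (Fin d)) κ (j + 1)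
      = κ j := fun j => by simp [Equiv.arrowCongr]
  have h0 := h (Fin.last n)
  rw [Fin.last_add_one] at h0
  have h1 := h 0
  rw [zero_add] at h1
  have h2 : ∀ s : Fin n, s.succ = s.castSucc + 1 := fun s => by
    rw [Fin.coeSucc_eq_succ]
  rw [h0, h1]
  simp only [h]
  congr 3
  ext s
  congr 2
  rw [h2 s, h]

/-- The expansion of `(a + t b)^n` in powers of the real parameter `t`. -/
theorem exists_pow_expansion {A : Type*} [Ring A] [Algebra ℝ A] (a b : A) (n : ℕ) :
    ∃ c : ℕ → A, (∀ t : ℝ, (a + t • b) ^ n = ∑ r ∈ Finset.range (n + 1), t ^ r • c r) ∧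
      c n = b ^ n := by
  induction n with
  | zero => exact ⟨fun _ => 1, fun t => by simp, by simp⟩
  | succ n ih =>
    obtain ⟨c, h1, h2⟩ := ih
    refine ⟨fun r => (if r ≤ n then c r * a else 0) + (if r = 0 then 0 else c (r - 1) * b),
      fun t => ?_, by simp [h2, pow_succ]⟩
    rw [pow_succ, h1, mul_add, Finset.sum_mul]
    simp only [smul_add, Finset.sum_add_distrib]
    congr 1
    · rw [Finset.sum_range_succ _ (n + 1)]
      simp only [show ¬ (n + 1 ≤ n) by omega, if_false, smul_zero, add_zero]
      refine Finset.sum_congr rfl fun r hr => ?_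
      rw [if_pos (by have := Finset.mem_range.1 hr; omega), smul_mul_assoc]
    · rw [Finset.sum_range_succ' _ (n + 1), Finset.sum_mul]
      rw [if_pos rfl, smul_zero, add_zero]
      refine Finset.sum_congr rfl fun r _ => ?_
      rw [if_neg (Nat.succ_ne_zero r), Nat.add_sub_cancel]
      rw [smul_mul_smul_comm, pow_succ]

/-- The even powers of `W J - N` for elements that multiply like the matrices `φ_i{}^h` and
`Φ^h ∧ Φ_i` of forms. -/
theorem pow_two_mul_sub {R : Type*} [Ring R] {J N W : R} (hJW : J * W = W * J) (hNW : N * W = W * N)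
    (hNN : N * N = 0) (hNJN : N * J * N = -(W * N)) (hJJN : J * J * N = -N)
    (hNJJ : N * J * J = -N) (hJJJ : J * J * J = -J) (m : ℕ) :
    (W * J - N) ^ (2 * (m + 1)) =
      (-1) ^ (m + 1) * W ^ (2 * m + 1) * (-(W * (J * J)) + J * N + N * J) := by
  -- `(W J - N)² = -W Q` and `Q² = W Q`
  set Q := -(W * (J * J)) + J * N + N * J with hQ
  have a1 : ∀ x, J * (W * x) = W * (J * x) := fun x => by rw [← mul_assoc, hJW, mul_assoc]
  have a2 : ∀ x, N * (W * x) = W * (N * x) := fun x => by rw [← mul_assoc, hNW, mul_assoc]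
  have a3 : ∀ x, N * (N * x) = 0 := fun x => by rw [← mul_assoc, hNN, zero_mul]
  have a4 : N * (J * N) = -(W * N) := by rw [← mul_assoc, hNJN]
  have a5 : ∀ x, N * (J * (N * x)) = -(W * (N * x)) := fun x => by
    rw [← mul_assoc, ← mul_assoc, hNJN, neg_mul, mul_assoc]
  have a6 : J * (J * N) = -N := by rw [← mul_assoc, hJJN]
  have a7 : ∀ x, J * (J * (N * x)) = -(N * x) := fun x => by
    rw [← mul_assoc, ← mul_assoc, hJJN, neg_mul]
  have a8 : N * (J * J) = -N := by rw [← mul_assoc, hNJJ]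
  have a10 : J * (J * J) = -J := by rw [← mul_assoc, hJJJ]
  have hBB : (W * J - N) ^ 2 = -(W * Q) := by
    rw [sq, hQ]
    simp only [mul_add, mul_sub, sub_mul, mul_neg, mul_assoc, a1, a2, hNN]
    abel
  have hQQ : Q * Q = W * Q := by
    rw [hQ]
    simp only [mul_add, add_mul, mul_neg, neg_mul, mul_assoc, a1, a2, a3, a4, a5, a6, a7, a8, a10,
      hNN, neg_neg, mul_zero]
    abel
  have hQW : Q * W = W * Q := by
    rw [hQ]
    simp only [mul_add, add_mul, mul_neg, neg_mul, mul_assoc, a1, a2, hJW, hNW]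
  rw [pow_mul, hBB]
  have hc : Commute W Q := hQW.symm
  have hp : ∀ m : ℕ, Q ^ (m + 1) = W ^ m * Q := fun m => by
    induction m with
    | zero => simp
    | succ m ih => rw [pow_succ, ih, mul_assoc, hQQ, ← mul_assoc, ← pow_succ]
  rw [neg_pow, hc.mul_pow, hp, ← mul_assoc (W ^ (m + 1)), ← pow_add, mul_assoc,
    show m + 1 + m = 2 * m + 1 by ring, ← mul_assoc]

end matrices

/-! ### The curvature forms -/

/-- The matrix of curvature forms `R_{kji}{}^h dx^k ∧ dx^j`. -/
def Om {d : ℕ} (G : Coord d → Matrix (Fin d) (Fin d) ℝ) (x : Coord d) :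
    Matrix (Fin d) (Fin d) (Ext d) :=
  Matrix.of fun h i => quad (Matrix.of fun k j => curvM G k j x h i)

section curvature
variable {d : ℕ} {G : Coord d → Matrix (Fin d) (Fin d) ℝ} {U : Set (Coord d)} {x : Coord d}

theorem central_Om : Central (Om G x) := fun _ _ y => quad_commute _ y

/-- The first Bianchi identity. -/
theorem IsMetric.bianchi (hG : IsMetric G U) (h : Fin d) :
    ∑ i, Om G x h i * th i = 0 := by
  let T : Fin d → Matrix (Fin d) (Fin d) ℝ := fun k => Matrix.of fun j i =>
    dM k (conn G j) x h i + (conn G k x * conn G j x) h i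
  have hT : ∀ k, (T k).transpose = T k := fun k => by
    ext j i
    simp only [T, Matrix.transpose_apply, Matrix.of_apply, dM, conn, Matrix.mul_apply,
      fun y => hG.christoffel_symm h i j y]
    congr 1
    exact Finset.sum_congr rfl fun l _ => by rw [hG.christoffel_symm l i j]
  have hR : ∀ k j i, curvM G k j x h i = T k j i - T j k i := fun k j i => by
    simp only [curvM_eq, T, Matrix.of_apply, Matrix.sub_apply, Matrix.add_apply]
    ring
  have h1 : ∑ k, th k * quad (T k) = 0 :=
    Finset.sum_eq_zero fun k _ => by rw [quad_eq_zero (hT k), mul_zero]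
  have h2 : ∑ i, ∑ k, ∑ j, T k j i • (th k * th j * th i) = 0 := by
    rw [← h1]
    simp only [quad, Finset.mul_sum, mul_smul_comm, ← mul_assoc]
    calc _ = ∑ k, ∑ i, ∑ j, T k j i • (th k * th j * th i) := Finset.sum_comm
      _ = _ := Finset.sum_congr rfl fun k _ => Finset.sum_comm
  have h3 : ∑ i, ∑ k, ∑ j, T j k i • (th k * th j * th i) = 0 := by
    rw [← neg_eq_zero, ← h2, ← Finset.sum_neg_distrib]
    refine Finset.sum_congr rfl fun i _ => ?_
    rw [Finset.sum_comm, ← Finset.sum_neg_distrib]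
    refine Finset.sum_congr rfl fun k _ => ?_
    rw [← Finset.sum_neg_distrib]
    refine Finset.sum_congr rfl fun j _ => ?_
    rw [th_mul_swap j k, neg_mul, smul_neg, neg_neg]
  rw [← sub_zero (0 : Ext d)]
  nth_rewrite 1 [← h2]
  rw [← h3]
  simp only [Om, quad, Matrix.of_apply, hR, ← Finset.sum_sub_distrib, Finset.sum_mul,
    sub_smul, sub_mul, smul_mul_assoc]

theorem IsMetric.pow_bianchi (hG : IsMetric G U) (m : ℕ) (b : Fin d) :
    ∑ i, (Om G x ^ (m + 1)) b i * th i = 0 := by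
  simp only [pow_succ, Matrix.mul_apply, Finset.sum_mul, mul_assoc]
  rw [Finset.sum_comm]
  simp only [← Finset.mul_sum, hG.bianchi, mul_zero, Finset.sum_const_zero]

/-- The form `K_{ν λ_1 ⋯ λ_{4k+1}} ξ^ν` when `R_{kji}{}^h ξ^i = c (η_j δ_k^h - η_k δ_j^h)`: by the
Bianchi identity only the trace of the powers of the curvature forms is left. -/
theorem IsMetric.br_K (hG : IsMetric G U) {c : ℝ} {ξ η : Fin d → ℝ}
    (hξ : ∀ k j h, (curvM G k j x).mulVec ξ h =
      c * (η j * (if h = k then 1 else 0) - η k * (if h = j then 1 else 0)))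
    {k : ℕ} (hk : 1 ≤ k) :
    br (fun lam : Fin (4 * k + 1) → Fin d => ∑ ν, K k G ν lam x * ξ ν) =
      -(c • (lin η * (Om G x ^ (2 * k)).trace)) := by
  let g : Fin d → Fin d → Ext d := fun a b =>
    lin fun l => c * (η a * (if b = l then 1 else 0) - η l * (if b = a then 1 else 0))
  have h1 : (fun lam : Fin (4 * k + 1) → Fin d => ∑ ν, K k G ν lam x * ξ ν) =
      fun lam => ∑ κ : Fin (2 * k + 1) → Fin d,
        (c * (η (κ 1) * (if κ 0 = lam 0 then 1 else 0) -
          η (lam 0) * (if κ 0 = κ 1 then 1 else 0))) *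
        ∏ s : Fin (2 * k), curv G (lam ⟨2 * s + 1, by omega⟩) (lam ⟨2 * s + 2, by omega⟩)
          (κ (s.succ + 1)) (κ s.succ) x := by
    ext lam
    simp only [K, Finset.sum_mul]
    rw [Finset.sum_comm]
    refine Finset.sum_congr rfl fun κ _ => ?_
    rw [← hξ]
    simp only [Matrix.mulVec, dotProduct, Finset.sum_mul, curvM, Matrix.of_apply]
    exact Finset.sum_congr rfl fun ν _ => by ring
  have h2 : br (fun lam : Fin (4 * k + 1) → Fin d => ∑ ν, K k G ν lam x * ξ ν) =
      ∑ κ : Fin (2 * k + 1) → Fin d, g (κ 1) (κ 0) *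
        (List.ofFn fun s : Fin (2 * k) => Om G x (κ s.succ) (κ (s.succ + 1))).prod := by
    rw [h1]
    have e : ∀ κ : Fin (2 * k + 1) → Fin d, g (κ 1) (κ 0) *
        (List.ofFn fun s : Fin (2 * k) => Om G x (κ s.succ) (κ (s.succ + 1))).prod = _ := fun κ =>
      (br_pairs (P := 4 * k + 1) (m := 2 * k) (by omega)
        (fun l => c * (η (κ 1) * (if κ 0 = l then 1 else 0) -
          η l * (if κ 0 = κ 1 then 1 else 0)))
        (fun s a b => curv G a b (κ (s.succ + 1)) (κ s.succ) x)).symm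
    simp only [e]
    unfold br
    rw [Finset.sum_comm]
    refine Finset.sum_congr rfl fun lam _ => ?_
    rw [← Finset.sum_smul]
    rfl
  have hg : ∀ a b, g a b = c • (η a • th b - (if b = a then 1 else 0 : ℝ) • lin η) := fun a b => by
    simp only [g, lin, mul_sub, sub_smul, Finset.sum_sub_distrib, smul_sub, Finset.smul_sum,
      smul_smul]
    congr 1
    · simp
    · exact Finset.sum_congr rfl fun l _ => by ring_nf
  obtain ⟨m, hm⟩ : ∃ m, 2 * k = m + 1 := ⟨2 * k - 1, by omega⟩
  rw [h2, sum_cycle (Om G x) (2 * k) g]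
  simp only [hg, smul_mul_assoc, sub_mul, smul_sub, Finset.sum_sub_distrib]
  have h3 : ∀ a, ∑ b, c • η a • (th b * (Om G x ^ (2 * k)) a b) = 0 := fun a => by
    simp only [← Finset.smul_sum]
    rw [hm]
    simp only [fun b => ((central_Om (G := G) (x := x)).pow (m + 1) a b (th b)).symm.eq,
      hG.pow_bianchi, smul_zero]
  simp only [h3, Finset.sum_const_zero, zero_sub, Matrix.trace, Matrix.diag, Finset.mul_sum,
    Finset.smul_sum]
  simp

end curvature

/-! ### The leading coefficient -/

section leading
variable {d : ℕ} (G J : Matrix (Fin d) (Fin d) ℝ)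

/-- The fundamental 2-form `φ_{kj} dx^k ∧ dx^j`. -/
def fund : Ext d := quad (G * J).transpose

/-- The matrix of the endomorphism `φ`, with entries regarded as 0-forms. -/
def matJ : Matrix (Fin d) (Fin d) (Ext d) := J.map (algebraMap ℝ (Ext d))

/-- The matrix of the 2-forms `α^h ∧ β_i`, for the 1-forms `α^h` and `β_i` with components in the
rows of `A` and `B`. -/
def outer (A B : Matrix (Fin d) (Fin d) ℝ) : Matrix (Fin d) (Fin d) (Ext d) :=
  Matrix.of fun h i => lin (A.row h) * lin (B.row i)

/-- The matrix of the 2-forms `Φ^h ∧ Φ_i`, where `Φ^h = φ_j{}^h dx^j` and `Φ_i = φ_{ji} dx^j`. -/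
def matN : Matrix (Fin d) (Fin d) (Ext d) := outer J (G * J)

/-- The coefficient of `ρ²` in the curvature forms of `h_ρ`, modulo `η`. -/
def matPsi : Matrix (Fin d) (Fin d) (Ext d) :=
  (2 : ℝ) • (Matrix.diagonal (fun _ => fund G J) * matJ J - matN G J)

theorem sum_row_mul_row (A B : Matrix (Fin d) (Fin d) ℝ) :
    ∑ l, lin (A.row l) * lin (B.row l) = quad (A.transpose * B) := by
  rw [sum_lin_mul_lin]
  congr 1

theorem sum_smul_row (A B : Matrix (Fin d) (Fin d) ℝ) (p : Fin d) :
    ∑ l, A p l • lin (B.row l) = lin ((A * B).row p) :=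
  lin_sum _ _ _

theorem matJ_mul_apply (A : Matrix (Fin d) (Fin d) ℝ) (N : Matrix (Fin d) (Fin d) (Ext d))
    (p q : Fin d) : (matJ A * N) p q = ∑ l, A p l • N l q := by
  simp only [Matrix.mul_apply, matJ, Matrix.map_apply, Algebra.smul_def]

theorem mul_matJ_apply (A : Matrix (Fin d) (Fin d) ℝ) (N : Matrix (Fin d) (Fin d) (Ext d))
    (p q : Fin d) : (N * matJ A) p q = ∑ l, A l q • N p l := by
  simp only [Matrix.mul_apply, matJ, Matrix.map_apply, Algebra.smul_def, Algebra.commutes]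

theorem matJ_mul_matJ (A B : Matrix (Fin d) (Fin d) ℝ) : matJ A * matJ B = matJ (A * B) :=
  (Matrix.map_mul (f := algebraMap ℝ (Ext d))).symm

theorem matJ_neg (A : Matrix (Fin d) (Fin d) ℝ) : matJ (-A) = -matJ A := by
  ext p q; simp [matJ]

theorem matJ_mul_outer (A B C : Matrix (Fin d) (Fin d) ℝ) :
    matJ C * outer A B = outer (C * A) B := by
  ext p q
  rw [matJ_mul_apply, outer, outer, Matrix.of_apply, ← sum_smul_row, Finset.sum_mul]
  simp only [Matrix.of_apply, smul_mul_assoc]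

theorem outer_mul_matJ (A B C : Matrix (Fin d) (Fin d) ℝ) :
    outer A B * matJ C = outer A (C.transpose * B) := by
  ext p q
  rw [mul_matJ_apply, outer, outer, Matrix.of_apply, ← sum_smul_row, Finset.mul_sum]
  simp only [Matrix.of_apply, mul_smul_comm, Matrix.transpose_apply]

theorem outer_mul_outer (A B C D : Matrix (Fin d) (Fin d) ℝ) :
    outer A B * outer C D = Matrix.diagonal (fun _ => quad (B.transpose * C)) * outer A D := by
  ext p q
  rw [Matrix.diagonal_mul, outer, outer, outer, Matrix.of_apply, ← mul_assoc,
    (quad_commute _ _).eq, ← sum_row_mul_row, Finset.mul_sum, Finset.sum_mul, Matrix.mul_apply]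
  simp only [Matrix.of_apply, mul_assoc]

theorem outer_neg_left (A B : Matrix (Fin d) (Fin d) ℝ) : outer (-A) B = -outer A B := by
  ext p q; simp [outer, lin]

theorem outer_neg_right (A B : Matrix (Fin d) (Fin d) ℝ) : outer A (-B) = -outer A B := by
  ext p q; simp [outer, lin]

theorem trace_outer (A B : Matrix (Fin d) (Fin d) ℝ) :
    (outer A B).trace = quad (A.transpose * B) := by
  rw [← sum_row_mul_row]; rfl

end leading

namespace LocalSasaki
variable {d : ℕ} {G J : Coord d → Matrix (Fin d) (Fin d) ℝ}
    {ξ η : Coord d → Fin d → ℝ} {U : Set (Coord d)} {x : Coord d}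

theorem J_cube (S : LocalSasaki G J ξ η U) (hx : x ∈ U) : J x * J x * J x = -J x := by
  rw [S.J_mul_J x hx, Matrix.add_mul, Matrix.vecMulVec_mul, S.η_J x hx]
  simp

theorem transpose_GJ (S : LocalSasaki G J ξ η U) (hx : x ∈ U) :
    (G x * J x).transpose = -(G x * J x) := by
  rw [Matrix.transpose_mul, (S.metric.symm x).eq, S.transpose_mul hx]

theorem fund_eq (G J : Matrix (Fin d) (Fin d) ℝ) : fund G J = -quad (G * J) := by
  rw [fund, quad_transpose]

/-- `GJ³ = -GJ`. -/
theorem GJ_mul_J_mul_J (S : LocalSasaki G J ξ η U) (hx : x ∈ U) :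
    G x * J x * J x * J x = -(G x * J x) := by
  rw [Matrix.mul_assoc, Matrix.mul_assoc, ← Matrix.mul_assoc (J x), S.J_cube hx, Matrix.mul_neg]

theorem transpose_mul_transpose_mul_GJ (S : LocalSasaki G J ξ η U) (hx : x ∈ U) :
    (J x).transpose * ((J x).transpose * (G x * J x)) = -(G x * J x) := by
  rw [← Matrix.mul_assoc _ (G x), S.transpose_mul hx, Matrix.neg_mul, Matrix.mul_neg,
    ← Matrix.mul_assoc, ← Matrix.mul_assoc, S.transpose_mul hx, Matrix.neg_mul, Matrix.neg_mul,
    neg_neg, S.GJ_mul_J_mul_J hx]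

theorem matN_mul_matN (S : LocalSasaki G J ξ η U) :
    matN (G x) (J x) * matN (G x) (J x) = 0 := by
  rw [matN, outer_mul_outer, quad_eq_zero, Matrix.diagonal_zero, Matrix.zero_mul]
  rw [Matrix.transpose_mul, Matrix.transpose_transpose, Matrix.transpose_mul,
    (S.metric.symm x).eq, Matrix.mul_assoc]

theorem matJ_mul_matJ_mul_matN (S : LocalSasaki G J ξ η U) (hx : x ∈ U) :
    matJ (J x) * matJ (J x) * matN (G x) (J x) = -matN (G x) (J x) := by
  rw [matJ_mul_matJ, matN, matJ_mul_outer, S.J_cube hx, outer_neg_left]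

theorem matN_mul_matJ_mul_matJ (S : LocalSasaki G J ξ η U) (hx : x ∈ U) :
    matN (G x) (J x) * matJ (J x) * matJ (J x) = -matN (G x) (J x) := by
  rw [matN, outer_mul_matJ, outer_mul_matJ, S.transpose_mul_transpose_mul_GJ hx, outer_neg_right]

theorem matN_mul_matJ_mul_matN (S : LocalSasaki G J ξ η U) (hx : x ∈ U) :
    matN (G x) (J x) * matJ (J x) * matN (G x) (J x) =
      -(Matrix.diagonal (fun _ => fund (G x) (J x)) * matN (G x) (J x)) := by
  rw [matN, outer_mul_matJ, outer_mul_outer, fund_eq, Matrix.transpose_mul,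
    Matrix.transpose_transpose, S.transpose_GJ hx, Matrix.neg_mul, Matrix.neg_mul,
    S.GJ_mul_J_mul_J hx, neg_neg, ← Matrix.neg_mul, Matrix.diagonal_neg]
  simp

theorem trace_matJ_mul_matN (S : LocalSasaki G J ξ η U) (hx : x ∈ U) :
    (matJ (J x) * matN (G x) (J x)).trace = fund (G x) (J x) := by
  rw [matN, matJ_mul_outer, trace_outer, Matrix.transpose_mul, Matrix.mul_assoc,
    S.transpose_mul_transpose_mul_GJ hx, quad_neg, fund_eq]

theorem trace_matN_mul_matJ (S : LocalSasaki G J ξ η U) (hx : x ∈ U) :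
    (matN (G x) (J x) * matJ (J x)).trace = fund (G x) (J x) := by
  rw [matN, outer_mul_matJ, trace_outer, S.transpose_mul_transpose_mul_GJ hx, quad_neg,
    fund_eq]

theorem trace_J_mul_J (S : LocalSasaki G J ξ η U) (hx : x ∈ U) :
    (J x * J x).trace = 1 - d := by
  rw [S.J_mul_J x hx, Matrix.trace_add, Matrix.trace_vecMulVec, dotProduct_comm, S.η_ξ x hx]
  simp
  ring

theorem trace_matPsi_pow (S : LocalSasaki G J ξ η U) (hx : x ∈ U) (m : ℕ) :
    (matPsi (G x) (J x) ^ (2 * (m + 1))).trace =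
      ((-1) ^ (m + 1) * 4 ^ (m + 1) * (d + 1) : ℝ) • fund (G x) (J x) ^ (2 * (m + 1)) := by
  have hW : ∀ A : Matrix (Fin d) (Fin d) (Ext d),
      A * Matrix.diagonal (fun _ => fund (G x) (J x)) =
        Matrix.diagonal (fun _ => fund (G x) (J x)) * A := fun A => by
    ext p q
    rw [Matrix.mul_diagonal, Matrix.diagonal_mul]
    exact (quad_commute _ (A p q)).eq.symm
  rw [matPsi, smul_pow, pow_two_mul_sub (hW _) (hW _) S.matN_mul_matN
    (S.matN_mul_matJ_mul_matN hx) (S.matJ_mul_matJ_mul_matN hx) (S.matN_mul_matJ_mul_matJ hx)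
    (by rw [matJ_mul_matJ, matJ_mul_matJ, S.J_cube hx, matJ_neg]), Matrix.diagonal_pow]
  have h1 : ∀ (n : ℕ) (A : Matrix (Fin d) (Fin d) (Ext d)),
      ((-1) ^ n * A).trace = ((-1) ^ n : ℝ) • A.trace := fun n A => by
    rcases neg_one_pow_eq_or ℤ n with h | h
    · have e1 : ((-1) ^ n : ℝ) = 1 := by exact_mod_cast congrArg (Int.cast : ℤ → ℝ) h
      have e2 : ((-1) ^ n : Matrix (Fin d) (Fin d) (Ext d)) = 1 := by
        have := congrArg (Int.cast : ℤ → Matrix (Fin d) (Fin d) (Ext d)) h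
        push_cast at this; exact this
      rw [e1, e2, one_mul, one_smul]
    · have e1 : ((-1) ^ n : ℝ) = -1 := by exact_mod_cast congrArg (Int.cast : ℤ → ℝ) h
      have e2 : ((-1) ^ n : Matrix (Fin d) (Fin d) (Ext d)) = -1 := by
        have := congrArg (Int.cast : ℤ → Matrix (Fin d) (Fin d) (Ext d)) h
        push_cast at this; exact this
      rw [e1, e2, neg_one_mul, neg_one_smul, Matrix.trace_neg]
  have h2 : ∀ (w : Ext d) (A : Matrix (Fin d) (Fin d) (Ext d)),
      (Matrix.diagonal (fun _ => w) * A).trace = w * A.trace := fun w A => by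
    simp only [Matrix.trace, Matrix.diag, Matrix.diagonal_mul, Finset.mul_sum]
  have h3 : (matJ (J x) * matJ (J x)).trace = (1 - d : ℝ) • (1 : Ext d) := by
    rw [matJ_mul_matJ, ← S.trace_J_mul_J hx]
    simp only [Matrix.trace, Matrix.diag, matJ, Matrix.map_apply, Finset.sum_smul,
      Algebra.algebraMap_eq_smul_one]
  have h4 : (Matrix.diagonal fun _ => fund (G x) (J x)) ^ (2 * m + 1) =
      Matrix.diagonal (fun _ : Fin d => fund (G x) (J x) ^ (2 * m + 1)) := by
    rw [Matrix.diagonal_pow]; rfl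
  rw [Matrix.trace_smul, mul_assoc, h1, ← Matrix.diagonal_pow, h4, h2, Matrix.trace_add,
    Matrix.trace_add, Matrix.trace_neg, h2, h3, S.trace_matJ_mul_matN hx,
    S.trace_matN_mul_matJ hx]
  have h5 : -(fund (G x) (J x) * (1 - d : ℝ) • (1 : Ext d)) + fund (G x) (J x) + fund (G x) (J x) =
      (d + 1 : ℝ) • fund (G x) (J x) := by
    rw [mul_smul_comm, mul_one]; module
  rw [h5, mul_smul_comm, ← pow_succ, smul_smul, smul_smul, show 2 * m + 1 + 1 = 2 * (m + 1) by ring]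
  congr 1
  rw [pow_mul, show (2 : ℝ) ^ 2 = 4 by norm_num]
  ring

/-- Modulo `η` the curvature forms of `h_ρ` are affine in `t = ρ²`. -/
theorem lin_η_mul_Om (S : LocalSasaki G J ξ η U) {t : ℝ} (ht : 0 ≤ t) (hx : x ∈ U)
    (p q : Fin d) :
    lin (η x) * Om (defG G η t) x p q =
      lin (η x) * (Om G x + t • matPsi (G x) (J x)) p q := by
  set A1 := Matrix.vecMulVec (Pi.single p 1) (η x) - Matrix.vecMulVec (η x) (Pi.single p 1)
  set A2 := Matrix.vecMulVec (fun k => G x k q) (η x) - Matrix.vecMulVec (η x) (fun k => G x k q)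
  set A3 := Matrix.vecMulVec ((G x * J x).row q) ((J x).row p) -
    Matrix.vecMulVec ((J x).row p) ((G x * J x).row q)
  have h0 : (Matrix.of fun k j => curvM (defG G η t) k j x p q) =
      (Matrix.of fun k j => curvM G k j x p q)
      + t • ((2 * η x q) • A1 + (-ξ x p) • A2 + A3 + (2 * J x p q) • (G x * J x).transpose)
      + (t ^ 2 * η x q) • A1 := by
    ext k j
    have e : ∀ a, (Pi.single p (1 : ℝ) : Fin d → ℝ) a = if p = a then 1 else 0 := fun a => by
      simp [Pi.single_apply, eq_comm]
    simp only [A1, A2, A3, Matrix.of_apply, Matrix.add_apply, Matrix.smul_apply, Matrix.sub_apply,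
      Matrix.vecMulVec_apply, smul_eq_mul, Matrix.transpose_apply, Matrix.row_apply,
      S.curvM_def ht hx, e]
    ring
  have hswap : ∀ a b : Fin d → ℝ, lin a * lin b = -(lin b * lin a) := fun a b => by
    rw [lin_mul_lin, lin_mul_lin, ← quad_transpose, Matrix.transpose_vecMulVec]
  have hη : ∀ a : Fin d → ℝ, lin (η x) * quad (Matrix.vecMulVec a (η x) -
      Matrix.vecMulVec (η x) a) = 0 := fun a => by
    rw [sub_eq_add_neg, quad_add, quad_neg, ← lin_mul_lin, ← lin_mul_lin, hswap a, mul_add,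
      mul_neg, ← mul_assoc, lin_mul_self]
    simp
  have h3 : quad A3 = -((2 : ℝ) • matN (G x) (J x) p q) := by
    simp only [A3]
    rw [sub_eq_add_neg, quad_add, quad_neg, ← lin_mul_lin, ← lin_mul_lin,
      hswap ((G x * J x).row q), matN, outer, Matrix.of_apply]
    module
  have h4 : matPsi (G x) (J x) p q =
      (2 * J x p q) • fund (G x) (J x) - (2 : ℝ) • matN (G x) (J x) p q := by
    simp only [matPsi, Matrix.smul_apply, Matrix.sub_apply, Matrix.diagonal_mul, matJ,
      Matrix.map_apply, ← Algebra.commutes, ← Algebra.smul_def]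
    module
  rw [Om, Matrix.of_apply, h0, quad_add, quad_add, quad_smul, quad_smul, quad_add, quad_add,
    quad_add, quad_smul, quad_smul, quad_smul, h3, Matrix.add_apply, Matrix.smul_apply, h4, Om,
    Matrix.of_apply, fund]
  have e1 : lin (η x) * quad A1 = 0 := hη _
  have e2 : lin (η x) * quad A2 = 0 := hη _
  simp only [mul_add, mul_smul_comm, e1, e2, smul_zero, zero_add, add_zero, mul_sub, mul_neg]
  module

/-- The form `K_{ν λ_1 ⋯ λ_{4k+1}} ξ^ν` of `h_ρ` as a polynomial in `t = ρ²`. -/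
theorem exists_expansion (S : LocalSasaki G J ξ η U) (hx : x ∈ U) {k : ℕ} (hk : 1 ≤ k) :
    ∃ c : ℕ → Ext d,
      (∀ t : ℝ, 0 ≤ t →
        br (fun lam : Fin (4 * k + 1) → Fin d => ∑ ν, K k (defG G η t) ν lam x * ξ x ν) =
          -((1 + t) ^ 2 • ∑ r ∈ Finset.range (2 * k + 1), t ^ r • c r)) ∧
      c (2 * k) = ((-1) ^ k * 4 ^ k * (d + 1) : ℝ) •
        (lin (η x) * fund (G x) (J x) ^ (2 * k)) := by
  obtain ⟨c, h1, h2⟩ := exists_pow_expansion (Om G x) (matPsi (G x) (J x)) (2 * k)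
  refine ⟨fun r => lin (η x) * (c r).trace, fun t ht => ?_, ?_⟩
  · rw [(S.isMetric_def ht).br_K (fun k j h => S.curvM_def_ξ ht hx k j h) hk]
    congr 2
    have hC : Central (Om G x + t • matPsi (G x) (J x)) := by
      intro p q y
      have hΨ : Commute (matPsi (G x) (J x) p q) y := by
        simp only [matPsi, Matrix.smul_apply, Matrix.sub_apply, Matrix.diagonal_mul, matJ, matN, outer,
          Matrix.map_apply, Matrix.of_apply, lin_mul_lin, fund]
        exact (((quad_commute _ y).mul_left (Algebra.commutes _ y)).sub_left
          (quad_commute _ y)).smul_left _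
      exact (quad_commute _ y).add_left (hΨ.smul_left t)
    have e : lin (η x) * (Om (defG G η t) x ^ (2 * k)).trace =
        lin (η x) * ((Om G x + t • matPsi (G x) (J x)) ^ (2 * k)).trace := by
      simp only [Matrix.trace, Matrix.diag, Finset.mul_sum]
      exact Finset.sum_congr rfl fun p _ =>
        mul_pow_apply_congr hC _ (S.lin_η_mul_Om ht hx) _ _ _
    rw [e, h1, Matrix.trace_sum, Finset.mul_sum]
    simp only [Matrix.trace_smul, mul_smul_comm]
  · obtain ⟨m, rfl⟩ : ∃ m, k = m + 1 := ⟨k - 1, by omega⟩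
    simp only [h2, S.trace_matPsi_pow hx m, mul_smul_comm]

/-! ### The contact form -/

/-- The fundamental form is of maximal rank on the kernel of `η`. -/
theorem lin_η_mul_fund_pow_ne_zero (S : LocalSasaki G J ξ η U) (hx : x ∈ U) {n : ℕ}
    (hd : d = 2 * n + 1) : lin (η x) * fund (G x) (J x) ^ n ≠ 0 := by
  set T := (G x * J x).transpose with hT
  have hTs : T.transpose = -T := by
    rw [hT, Matrix.transpose_transpose, S.transpose_GJ hx, neg_neg]
  have hfund : fund (G x) (J x) = quad T := rfl
  intro h0
  rw [hfund] at h0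
  -- contraction with `ξ` removes the factor `η`
  have hn : quad T ^ n = 0 := by
    have h1 := congrArg (contr (ξ x)) h0
    rw [contr_lin_mul, S.η_ξ x hx, one_smul, map_zero] at h1
    have h2 : Matrix.vecMul (ξ x) T = 0 := by
      rw [hT, Matrix.vecMul_transpose, ← Matrix.mulVec_mulVec, S.J_ξ x hx, Matrix.mulVec_zero]
    have h3 : contr (ξ x) (quad T ^ n) = 0 := by
      cases n with
      | zero => rw [pow_zero, contr_one]
      | succ m =>
        rw [(contr_quad_pow (ξ x) hTs m).2, h2]
        simp [lin]
    rwa [h3, mul_zero, sub_zero] at h1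
  -- two contractions, summed against the bivector `J G⁻¹`, lower the vanishing power
  have step : ∀ m, m < n → quad T ^ (m + 1) = 0 → quad T ^ m = 0 := by
    intro m hm h
    have h1 : ∀ v, lin (Matrix.vecMul v T) * quad T ^ m = 0 := fun v => by
      have e := (contr_quad_pow v hTs m).2
      rw [h, map_zero] at e
      exact (smul_eq_zero.1 e.symm).resolve_left (by positivity)
    have h2 : ∀ v w, (Matrix.vecMul v T ⬝ᵥ w) • quad T ^ m =
        lin (Matrix.vecMul v T) * contr w (quad T ^ m) := fun v w => by
      have e := congrArg (contr w) (h1 v)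
      rw [contr_lin_mul, map_zero, sub_eq_zero] at e
      exact e
    let V := J x * (G x)⁻¹
    have hG := S.metric.unit x hx
    have hVT : T.transpose * V * T = -T := by
      rw [hTs, hT, S.transpose_GJ hx, neg_neg, Matrix.mul_neg, ← Matrix.mul_assoc (G x * J x),
        Matrix.mul_assoc _ (G x)⁻¹, ← Matrix.mul_assoc (G x)⁻¹, Matrix.nonsing_inv_mul _ hG, Matrix.one_mul,
        S.GJ_mul_J_mul_J hx, neg_neg]
    -- the trace of `-1` on the kernel of `η`
    have htr : ∑ a, ∑ b, V a b * T a b = 1 - d := by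
      have e1 : (T.transpose * V).trace = 1 - d := by
        simp only [hT, Matrix.transpose_transpose, V]
        rw [← Matrix.mul_assoc, Matrix.trace_mul_comm, ← Matrix.mul_assoc, ← Matrix.mul_assoc,
          Matrix.nonsing_inv_mul _ hG, Matrix.one_mul, S.trace_J_mul_J hx]
      rw [← e1, Finset.sum_comm]
      simp only [Matrix.trace, Matrix.diag, Matrix.mul_apply, Matrix.transpose_apply, mul_comm]
    have h3 : ∀ a b, V a b • T a b • quad T ^ m = V a b • (lin (T.row a) *
        contr (Pi.single b 1) (quad T ^ m)) := fun a b => by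
      have e := h2 (Pi.single a 1) (Pi.single b 1)
      rw [Matrix.single_one_vecMul, dotProduct_single, mul_one] at e
      exact congrArg (V a b • ·) e
    have h4 : (∑ a, ∑ b, V a b * T a b) • quad T ^ m =
        ∑ a, ∑ b, V a b • (lin (T.row a) * contr (Pi.single b 1) (quad T ^ m)) := by
      simp only [← h3, Finset.sum_smul, smul_smul]
    have h5 : ∑ a, ∑ b, V a b • (lin (T.row a) * lin (T.row b)) = -quad T := by
      rw [← quad_neg, ← hVT]
      have e1 : ∀ b, lin ((V.transpose * T).row b) = ∑ a, V a b • lin (T.row a) := fun b =>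
        (sum_smul_row V.transpose T b).symm
      have e2 : quad (T.transpose * V * T) = ∑ b, lin ((V.transpose * T).row b) * lin (T.row b) := by
        rw [sum_row_mul_row, Matrix.transpose_mul, Matrix.transpose_transpose V]
      rw [e2]
      simp only [e1, Finset.sum_mul, smul_mul_assoc]
      exact Finset.sum_comm
    have h6 : ∑ a, ∑ b, V a b • (lin (T.row a) * contr (Pi.single b 1) (quad T ^ m)) =
        (-(2 * m : ℝ)) • quad T ^ m := by
      cases m with
      | zero => simp [contr_one]
      | succ l =>
        have e : ∀ b, contr (Pi.single b 1) (quad T ^ (l + 1)) =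
            (2 * (l + 1) : ℝ) • (lin (T.row b) * quad T ^ l) := fun b => by
          rw [(contr_quad_pow _ hTs l).2, Matrix.single_one_vecMul]
        simp only [e, mul_smul_comm, ← mul_assoc]
        have e' : ∑ a, ∑ b, V a b • (2 * (l + 1) : ℝ) • (lin (T.row a) * lin (T.row b) * quad T ^ l) =
            (2 * (l + 1) : ℝ) • ((∑ a, ∑ b, V a b • (lin (T.row a) * lin (T.row b))) * quad T ^ l) := by
          simp only [Finset.sum_mul, Finset.smul_sum, smul_mul_assoc]
          exact Finset.sum_congr rfl fun a _ => Finset.sum_congr rfl fun b _ => smul_comm _ _ _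
        rw [e', h5, neg_mul, ← pow_succ']
        push_cast
        module
    -- the factor `1 - d + 2m = 2m - 2n` is not zero
    rw [htr, h6, ← sub_eq_zero, ← sub_smul] at h4
    refine (smul_eq_zero.1 h4).resolve_left ?_
    have : (m : ℝ) < n := by exact_mod_cast hm
    rw [hd]
    push_cast
    intro hc
    linarith
  have all : ∀ j, j ≤ n → quad T ^ (n - j) = 0 := by
    intro j
    induction j with
    | zero => intro _; exact hn
    | succ j ih =>
      intro hj
      refine step _ (by omega) ?_
      rw [show n - (j + 1) + 1 = n - j by omega]
      exact ih (by omega)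
  have := all n le_rfl
  rw [Nat.sub_self, pow_zero] at this
  exact one_ne_zero this

end LocalSasaki

/-! ### Components in the charts of a manifold -/

section Chart

variable {d : ℕ} {M : Type*} [TopologicalSpace M] [ChartedSpace (Coord d) M]
  {e e' : OpenPartialHomeomorph M (Coord d)}

theorem mdifferentiable_of_mem (he : e ∈ IsManifold.maximalAtlas (𝓡 d) ∞ M) :
    e.MDifferentiable (𝓡 d) (𝓡 d) :=
  ⟨(contMDiffOn_of_mem_maximalAtlas he).mdifferentiableOn (by simp),
    (contMDiffOn_symm_of_mem_maximalAtlas he).mdifferentiableOn (by simp)⟩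

theorem coord_eq_sum (v : Coord d) : v = ∑ i, v i • (EuclideanSpace.single i 1 : Coord d) := by
  ext j
  simp [Finset.sum_apply, Pi.single_apply]

/-- The components of tangent vectors at `p` as linear forms. -/
def compL (e : OpenPartialHomeomorph M (Coord d)) (p : M) (i : Fin d) :
    TangentSpace (𝓡 d) p →ₗ[ℝ] ℝ :=
  ((EuclideanSpace.proj i : Coord d →L[ℝ] ℝ) ∘L (mfderiv (𝓡 d) (𝓡 d) e p :)).toLinearMap

theorem comp_add {p : M} (v w : TangentSpace (𝓡 d) p) (i : Fin d) :
    comp e (v + w) i = comp e v i + comp e w i :=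
  (compL e p i).map_add v w

theorem comp_smul {p : M} (c : ℝ) (v : TangentSpace (𝓡 d) p) (i : Fin d) :
    comp e (c • v) i = c * comp e v i :=
  (compL e p i).map_smul c v

theorem comp_sum {p : M} {ι : Type*} (s : Finset ι) (v : ι → TangentSpace (𝓡 d) p) (i : Fin d) :
    comp e (∑ a ∈ s, v a) i = ∑ a ∈ s, comp e (v a) i :=
  map_sum (compL e p i) v s

theorem comp_neg {p : M} (v : TangentSpace (𝓡 d) p) (i : Fin d) :
    comp e (-v) i = -comp e v i :=
  (compL e p i).map_neg v

theorem mfderiv_frame (he : e ∈ IsManifold.maximalAtlas (𝓡 d) ∞ M) {x : Coord d}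
    (hx : x ∈ e.target) (j : Fin d) :
    (mfderiv (𝓡 d) (𝓡 d) e (e.symm x) (frame e x j) : Coord d) = EuclideanSpace.single j 1 := by
  have h := (mdifferentiable_of_mem he).comp_symm_deriv hx
  exact DFunLike.congr_fun h (EuclideanSpace.single j 1 : Coord d)

theorem comp_frame (he : e ∈ IsManifold.maximalAtlas (𝓡 d) ∞ M) {x : Coord d}
    (hx : x ∈ e.target) (j i : Fin d) : comp e (frame e x j) i = if i = j then 1 else 0 := by
  rw [comp, mfderiv_frame he hx]
  simp

/-- A tangent vector is the combination of the coordinate vectors given by its components. -/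
theorem eq_sum_comp_frame (he : e ∈ IsManifold.maximalAtlas (𝓡 d) ∞ M) {x : Coord d}
    (hx : x ∈ e.target) (v : TangentSpace (𝓡 d) (e.symm x)) :
    v = ∑ i, comp e v i • frame e x i := by
  have h := (mdifferentiable_of_mem he).symm_comp_deriv (e.map_target hx)
  rw [e.right_inv hx] at h
  have h1 := DFunLike.congr_fun h v
  have h2 : (mfderiv (𝓡 d) (𝓡 d) e.symm x) (mfderiv (𝓡 d) (𝓡 d) e (e.symm x) v : Coord d) = v := h1
  conv_lhs => rw [← h2]
  have key : ∀ (L : Coord d →L[ℝ] TangentSpace (𝓡 d) (e.symm x)) (u : Coord d),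
      L u = ∑ i, u i • L (EuclideanSpace.single i 1) := fun L u => by
    conv_lhs => rw [coord_eq_sum u]
    rw [map_sum]
    exact Finset.sum_congr rfl fun i _ => by rw [map_smul]
  exact key _ _

theorem comp_injective (he : e ∈ IsManifold.maximalAtlas (𝓡 d) ∞ M) {p : M} (hp : p ∈ e.source)
    {v w : TangentSpace (𝓡 d) p} (h : ∀ i, comp e v i = comp e w i) : v = w := by
  apply (mdifferentiable_of_mem he).mfderiv_injective hp
  exact PiLp.ext h

variable [IsManifold (𝓡 d) ∞ M]

theorem chartAt_mem (p : M) : chartAt (Coord d) p ∈ IsManifold.maximalAtlas (𝓡 d) ∞ M :=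
  IsManifold.chart_mem_maximalAtlas p

theorem exists_chart (p : M) :
    ∃ e ∈ IsManifold.maximalAtlas (𝓡 d) ∞ M, ∃ x ∈ e.target, e.symm x = p :=
  ⟨_, chartAt_mem p, _, mem_chart_target _ p, (chartAt _ p).left_inv (mem_chart_source _ p)⟩

theorem contMDiffOn_frame (he : e ∈ IsManifold.maximalAtlas (𝓡 d) ∞ M) (i : Fin d) :
    ContMDiffOn (𝓡 d) (𝓡 d).tangent ∞
      (fun x => (Bundle.TotalSpace.mk' (Coord d) (e.symm x) (frame e x i) : TangentBundle (𝓡 d) M))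
      e.target := by
  have h := (contMDiffOn_symm_of_mem_maximalAtlas he).contMDiffOn_tangentMapWithin (m := ∞)
    (by simp) e.open_target.uniqueMDiffOn
  have hs : ContMDiff (𝓡 d) (𝓡 d).tangent ∞
      (fun x : Coord d => (⟨x, (EuclideanSpace.single i 1 : Coord d)⟩ : TangentBundle (𝓡 d) (Coord d))) := by
    exact contMDiff_vectorSpace_iff_contDiff.2 contDiff_const
  have := h.comp hs.contMDiffOn (s := e.target) (fun x hx => hx)
  refine this.congr fun x hx => ?_
  simp only [Function.comp, tangentMapWithin, mfderivWithin_of_isOpen e.open_target hx]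
  rfl

theorem contDiffOn_comp01 {β : (p : M) → TangentSpace (𝓡 d) p →L[ℝ] ℝ}
    (hβ : ContMDiff (𝓡 d) ((𝓡 d).prod 𝓘(ℝ, Coord d →L[ℝ] ℝ)) ∞
      (fun p : M => Bundle.TotalSpace.mk' (Coord d →L[ℝ] ℝ)
        (E := fun p : M => TangentSpace (𝓡 d) p →L[ℝ] ℝ) p (β p)))
    (he : e ∈ IsManifold.maximalAtlas (𝓡 d) ∞ M) (i : Fin d) :
    ContDiffOn ℝ ∞ (fun x => comp01 β e x i) e.target := by
  rw [← contMDiffOn_iff_contDiffOn]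
  intro x hx
  have : ContMDiffWithinAt (𝓡 d) ((𝓡 d).prod 𝓘(ℝ)) ∞
      (fun x ↦ Bundle.TotalSpace.mk' ℝ (E := Bundle.Trivial M ℝ) (e.symm x)
        (β (e.symm x) (frame e x i))) e.target x := by
    apply ContMDiffWithinAt.clm_bundle_apply (F₁ := Coord d)
    · exact ContMDiffAt.comp_contMDiffWithinAt x hβ.contMDiffAt
        (contMDiffOn_symm_of_mem_maximalAtlas he x hx)
    · exact contMDiffOn_frame he i x hx
  simp only [Bundle.contMDiffWithinAt_totalSpace] at this
  exact this.2

theorem contDiffOn_comp02 {B : Tensor02 d M}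
    (hB : ContMDiff (𝓡 d) ((𝓡 d).prod 𝓘(ℝ, Coord d →L[ℝ] Coord d →L[ℝ] ℝ)) ∞
      (fun p : M => Bundle.TotalSpace.mk' (Coord d →L[ℝ] Coord d →L[ℝ] ℝ)
        (E := fun p : M => TangentSpace (𝓡 d) p →L[ℝ] TangentSpace (𝓡 d) p →L[ℝ] ℝ) p (B p)))
    (he : e ∈ IsManifold.maximalAtlas (𝓡 d) ∞ M) (i j : Fin d) :
    ContDiffOn ℝ ∞ (fun x => comp02 B e x i j) e.target := by
  rw [← contMDiffOn_iff_contDiffOn]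
  intro x hx
  have : ContMDiffWithinAt (𝓡 d) ((𝓡 d).prod 𝓘(ℝ)) ∞
      (fun x ↦ Bundle.TotalSpace.mk' ℝ (E := Bundle.Trivial M ℝ) (e.symm x)
        (B (e.symm x) (frame e x i) (frame e x j))) e.target x := by
    apply ContMDiffWithinAt.clm_bundle_apply₂ (F₁ := Coord d) (F₂ := Coord d)
    · exact ContMDiffAt.comp_contMDiffWithinAt x hB.contMDiffAt
        (contMDiffOn_symm_of_mem_maximalAtlas he x hx)
    · exact contMDiffOn_frame he i x hx
    · exact contMDiffOn_frame he j x hx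
  simp only [Bundle.contMDiffWithinAt_totalSpace] at this
  exact this.2

/-- The components of a smooth field of tangent vectors along the inverse of a chart are smooth. -/
theorem contDiffOn_comp {X : (x : Coord d) → TangentSpace (𝓡 d) (e.symm x)}
    (he : e ∈ IsManifold.maximalAtlas (𝓡 d) ∞ M)
    (hX : ContMDiffOn (𝓡 d) (𝓡 d).tangent ∞
      (fun x => (Bundle.TotalSpace.mk' (Coord d) (e.symm x) (X x) : TangentBundle (𝓡 d) M))
      e.target) (i : Fin d) :
    ContDiffOn ℝ ∞ (fun x => comp e (X x) i) e.target := by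
  have h := (contMDiffOn_of_mem_maximalAtlas he).contMDiffOn_tangentMapWithin (m := ∞)
    (by simp) e.open_source.uniqueMDiffOn
  have h1 := h.comp hX (fun x hx => e.map_target hx)
  have h2 := (contMDiff_snd_tangentBundle_modelSpace (Coord d) (𝓡 d)
    (n := ∞)).comp_contMDiffOn h1
  have h3 := contMDiffOn_iff_contDiffOn.1 h2
  have h4 := (EuclideanSpace.proj i : Coord d →L[ℝ] ℝ).contDiff.comp_contDiffOn h3
  refine h4.congr fun x hx => ?_
  simp only [Function.comp, tangentMapWithin,
    mfderivWithin_of_isOpen e.open_source (e.map_target hx)]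
  rfl

theorem contDiffOn_comp10 {X : (p : M) → TangentSpace (𝓡 d) p}
    (hX : ContMDiff (𝓡 d) ((𝓡 d).prod 𝓘(ℝ, Coord d)) ∞
      (fun p : M => Bundle.TotalSpace.mk' (Coord d)
        (E := (TangentSpace (𝓡 d) : M → Type _)) p (X p)))
    (he : e ∈ IsManifold.maximalAtlas (𝓡 d) ∞ M) (i : Fin d) :
    ContDiffOn ℝ ∞ (fun x => comp10 X e x i) e.target :=
  contDiffOn_comp he (hX.comp_contMDiffOn (contMDiffOn_symm_of_mem_maximalAtlas he)) i

theorem contDiffOn_comp11 {F : (p : M) → TangentSpace (𝓡 d) p →L[ℝ] TangentSpace (𝓡 d) p}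
    (hF : ContMDiff (𝓡 d) ((𝓡 d).prod 𝓘(ℝ, Coord d →L[ℝ] Coord d)) ∞
      (fun p : M => Bundle.TotalSpace.mk' (Coord d →L[ℝ] Coord d)
        (E := fun p : M => TangentSpace (𝓡 d) p →L[ℝ] TangentSpace (𝓡 d) p) p (F p)))
    (he : e ∈ IsManifold.maximalAtlas (𝓡 d) ∞ M) (j i : Fin d) :
    ContDiffOn ℝ ∞ (fun x => comp11 F e x j i) e.target := by
  refine contDiffOn_comp he (fun x hx => ?_) i
  apply ContMDiffWithinAt.clm_bundle_apply (F₁ := Coord d) (F₂ := Coord d)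
  · exact ContMDiffAt.comp_contMDiffWithinAt x hF.contMDiffAt
      (contMDiffOn_symm_of_mem_maximalAtlas he x hx)
  · exact contMDiffOn_frame he j x hx

end Chart

/-! ### A Sasakian structure in a chart -/

section SasakianChart

variable {d : ℕ} {M : Type*} [TopologicalSpace M] [ChartedSpace (Coord d) M]
  {e : OpenPartialHomeomorph M (Coord d)} {x : Coord d}

theorem apply_eq_sum_comp01 (he : e ∈ IsManifold.maximalAtlas (𝓡 d) ∞ M) (hx : x ∈ e.target)
    (β : (p : M) → TangentSpace (𝓡 d) p →L[ℝ] ℝ) (v : TangentSpace (𝓡 d) (e.symm x)) :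
    β (e.symm x) v = ∑ i, comp e v i * comp01 β e x i := by
  conv_lhs => rw [eq_sum_comp_frame he hx v]
  rw [map_sum]
  exact Finset.sum_congr rfl fun i _ => by rw [map_smul]; rfl

theorem comp_apply_eq_sum_comp11 (he : e ∈ IsManifold.maximalAtlas (𝓡 d) ∞ M) (hx : x ∈ e.target)
    (F : (p : M) → TangentSpace (𝓡 d) p →L[ℝ] TangentSpace (𝓡 d) p)
    (v : TangentSpace (𝓡 d) (e.symm x)) (i : Fin d) :
    comp e (F (e.symm x) v) i = ∑ j, comp e v j * comp11 F e x j i := by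
  conv_lhs => rw [eq_sum_comp_frame he hx v]
  rw [map_sum, comp_sum]
  exact Finset.sum_congr rfl fun j _ => by rw [map_smul, comp_smul]; rfl

theorem apply_eq_sum_comp02 (he : e ∈ IsManifold.maximalAtlas (𝓡 d) ∞ M) (hx : x ∈ e.target)
    (B : Tensor02 d M) (v w : TangentSpace (𝓡 d) (e.symm x)) :
    B (e.symm x) v w = ∑ i, ∑ j, comp e v i * comp e w j * comp02 B e x i j := by
  conv_lhs => rw [eq_sum_comp_frame he hx v, eq_sum_comp_frame he hx w]
  have key : ∀ L : TangentSpace (𝓡 d) (e.symm x) →L[ℝ] TangentSpace (𝓡 d) (e.symm x) →L[ℝ] ℝ,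
      L (∑ i, comp e v i • frame e x i) (∑ j, comp e w j • frame e x j) =
        ∑ i, ∑ j, comp e v i * comp e w j * L (frame e x i) (frame e x j) := fun L => by
    rw [map_sum L, sum_apply]
    refine Finset.sum_congr rfl fun i _ => ?_
    rw [map_sum]
    refine Finset.sum_congr rfl fun j _ => ?_
    rw [map_smul, map_smul, smul_apply, smul_eq_mul, smul_eq_mul]
    ring
  exact key _

variable [IsManifold (𝓡 d) ∞ M]

namespace Sasakian

/-- The matrix `J^k_j = φ_j{}^k` in the chart `e`. -/
def chartJ (S : Sasakian d M) (e : OpenPartialHomeomorph M (Coord d)) (y : Coord d) :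
    Matrix (Fin d) (Fin d) ℝ := Matrix.of fun k j => comp11 S.φ e y j k

theorem isMetric_chart (S : Sasakian d M) (he : e ∈ IsManifold.maximalAtlas (𝓡 d) ∞ M) :
    IsMetric (comp02 S.g.inner e) e.target where
  isOpen := e.open_target
  smooth := fun a b => contDiffOn_comp02 S.g.contMDiff he a b
  symm := fun y => Matrix.IsSymm.ext fun i j => S.g.symm _ _ _
  unit := fun y hy => by
    rw [isUnit_iff_ne_zero]
    intro h0
    obtain ⟨v, hv, hGv⟩ := Matrix.exists_mulVec_eq_zero_iff.2 h0
    set w : TangentSpace (𝓡 d) (e.symm y) := ∑ i, v i • frame e y i with hw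
    have hcw : ∀ i, comp e w i = v i := fun i => by
      rw [hw, comp_sum]
      simp [comp_smul, comp_frame he hy]
    have hne : w ≠ 0 := by
      rintro h
      apply hv
      ext i
      rw [← hcw i, h]
      exact (compL e _ i).map_zero
    refine (S.g.pos (e.symm y) w hne).ne' ?_
    rw [apply_eq_sum_comp02 he hy S.g.inner w w]
    have : ∀ i, ∑ j, comp02 S.g.inner e y i j * v j = 0 := fun i => congrFun hGv i
    simp only [hcw, mul_assoc, ← Finset.mul_sum]
    refine Finset.sum_eq_zero fun i _ => ?_
    rw [← mul_zero (v i), ← this i]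
    exact congrArg _ (Finset.sum_congr rfl fun j _ => mul_comm _ _)

theorem comp02_h (S : Sasakian d M) (e : OpenPartialHomeomorph M (Coord d)) (ρ : ℝ) :
    comp02 (S.h ρ) e = LocalSasaki.defG (comp02 S.g.inner e) (comp01 S.η e) (ρ ^ 2) := by
  funext y
  ext i j
  simp [comp02, LocalSasaki.defG, Sasakian.h, comp01, Matrix.vecMulVec_apply]

theorem localSasaki (S : Sasakian d M) (he : e ∈ IsManifold.maximalAtlas (𝓡 d) ∞ M) :
    LocalSasaki (comp02 S.g.inner e) (S.chartJ e) (comp10 S.ξ e) (comp01 S.η e) e.target where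
  metric := S.isMetric_chart he
  smooth_J := fun a b => contDiffOn_comp11 S.smooth_φ he b a
  smooth_ξ := fun a => contDiffOn_comp10 S.smooth_ξ he a
  smooth_η := fun a => contDiffOn_comp01 S.smooth_η he a
  J_mul_J := fun y hy => by
    ext i j
    have h := congrArg (fun v => comp e v i) (S.φ_φ (e.symm y) (frame e y j))
    simp only [comp_apply_eq_sum_comp11 he hy S.φ, comp_add, comp_neg, comp_smul,
      comp_frame he hy] at h
    simp only [Matrix.mul_apply, chartJ, Matrix.of_apply, Matrix.add_apply, Matrix.neg_apply,
      Matrix.one_apply, Matrix.vecMulVec_apply]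
    simp only [ite_mul, one_mul, zero_mul, Finset.sum_ite_eq',
      Finset.mem_univ, if_true] at h
    rw [Finset.sum_congr rfl fun l _ => mul_comm _ _, h, mul_comm (comp10 S.ξ e y i)]
    rfl
  η_ξ := fun y hy => by
    have h := S.η_ξ (e.symm y)
    rw [apply_eq_sum_comp01 he hy] at h
    exact h ▸ Finset.sum_congr rfl fun i _ => mul_comm (comp01 S.η e y i) (comp10 S.ξ e y i)
  J_ξ := fun y hy => by
    ext i
    have h := congrArg (fun v => comp e v i) (S.φ_ξ (e.symm y))
    simp only [comp_apply_eq_sum_comp11 he hy S.φ] at h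
    refine Eq.trans ?_ (h.trans ((compL e _ i).map_zero))
    simp only [Matrix.mulVec, dotProduct]
    exact Finset.sum_congr rfl fun j _ => mul_comm (comp11 S.φ e y j i) (comp10 S.ξ e y j)
  η_J := fun y hy => by
    ext j
    have h := S.η_φ (e.symm y) (frame e y j)
    rw [apply_eq_sum_comp01 he hy] at h
    refine Eq.trans ?_ h
    simp only [Matrix.vecMul, dotProduct]
    exact Finset.sum_congr rfl fun i _ => mul_comm (comp01 S.η e y i) (comp11 S.φ e y j i)
  G_eq := fun y hy => by
    ext i j
    have h := S.g_eq (e.symm y) (frame e y i) (frame e y j)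
    rw [apply_eq_sum_comp02 he hy S.g.inner (S.φ _ _)] at h
    refine h.trans ?_
    simp only [Matrix.add_apply, Matrix.mul_apply, Matrix.vecMulVec_apply, Matrix.transpose_apply,
      Finset.sum_mul]
    congr 1
    rw [Finset.sum_comm]
    refine Finset.sum_congr rfl fun a _ => Finset.sum_congr rfl fun b _ => ?_
    simp only [chartJ, Matrix.of_apply, comp11]
    ring
  normal := fun y hy i => by
    ext k j
    have h := S.normal e he y hy i j k
    simp only [nabla11] at h
    simp only [dM, conn, Matrix.add_apply, Matrix.sub_apply, Matrix.mul_apply,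
      Matrix.vecMulVec_apply, Matrix.of_apply, chartJ]
    have h1 : ∀ l, comp11 S.φ e y l k * christoffel (comp02 S.g.inner e) l i j y
      = christoffel (comp02 S.g.inner e) l i j y * comp11 S.φ e y l k := fun l => mul_comm _ _
    simp only [h1]
    have h2 : (Pi.single i (1 : ℝ) : Fin d → ℝ) k = if i = k then 1 else 0 := by
      rw [Pi.single_apply]; simp [eq_comm]
    rw [h2]
    linarith

theorem comp02_φLow (S : Sasakian d M) (he : e ∈ IsManifold.maximalAtlas (𝓡 d) ∞ M)
    (hx : x ∈ e.target) :
    comp02 S.φLow e x = (comp02 S.g.inner e x * S.chartJ e x).transpose := by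
  ext a b
  have : comp02 S.φLow e x a b = S.g.inner (e.symm x) (S.φ (e.symm x) (frame e x a)) (frame e x b) :=
    rfl
  rw [this, S.g.symm, apply_eq_sum_comp02 he hx S.g.inner, Matrix.transpose_apply, Matrix.mul_apply]
  simp only [comp_frame he hx, ite_mul, one_mul, zero_mul]
  rw [Finset.sum_eq_single b (by simp +contextual) (by simp)]
  simp only [if_true, chartJ, Matrix.of_apply, comp11]
  exact Finset.sum_congr rfl fun i _ => mul_comm _ _

theorem dComp_η (S : Sasakian d M) (he : e ∈ IsManifold.maximalAtlas (𝓡 d) ∞ M)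
    (hx : x ∈ e.target) (i j : Fin d) : dComp S.η e x i j = -comp02 S.φLow e x i j := by
  have h := S.contact e he x hx i j
  have : comp02 S.φLow e x i j = S.g.inner (e.symm x) (S.φ (e.symm x) (frame e x i)) (frame e x j) :=
    rfl
  rw [this, h, neg_neg]

end Sasakian

end SasakianChart

/-! ### Curvature forms and components in two charts -/

section Pullback
variable {d : ℕ}

/-- The substitution `dx^a ↦ ∑ P^a_i dx^i` in the exterior algebra. -/
def pull (P : Matrix (Fin d) (Fin d) ℝ) : Ext d →ₐ[ℝ] Ext d :=
  ExteriorAlgebra.map (Matrix.toLin' P.transpose)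

theorem pull_th (P : Matrix (Fin d) (Fin d) ℝ) (a : Fin d) :
    pull P (th a) = ∑ i, P a i • th i := by
  rw [pull, th, ExteriorAlgebra.map_apply_ι]
  have : Matrix.toLin' P.transpose (Pi.single a 1) = ∑ i, P a i • (Pi.single i 1 : Fin d → ℝ) := by
    ext j
    simp [Matrix.toLin'_apply, Finset.sum_apply, Pi.single_apply]
  rw [this, map_sum]
  exact Finset.sum_congr rfl fun i _ => by rw [map_smul]; rfl

theorem pull_lin (P : Matrix (Fin d) (Fin d) ℝ) (v : Fin d → ℝ) :
    pull P (lin v) = lin (Matrix.vecMul v P) := by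
  simp only [lin, map_sum, map_smul, pull_th, Finset.smul_sum, Matrix.vecMul, dotProduct,
    Finset.sum_smul, smul_smul]
  exact Finset.sum_comm

theorem top_pull (P : Matrix (Fin d) (Fin d) ℝ) (y : Ext d) :
    top d (pull P y) = P.det * top d y := by
  rw [pull, top_map, LinearMap.det_toLin', Matrix.det_transpose]

/-- Conjugation by a matrix of scalars does not change the traces of powers, although the entries
need not commute. -/
theorem trace_conj {P Q : Matrix (Fin d) (Fin d) ℝ} (h : Q * P = 1)
    {A B : Matrix (Fin d) (Fin d) (Ext d)} (hAB : matJ P * A = B * matJ P) (m : ℕ) :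
    (A ^ m).trace = (B ^ m).trace := by
  have h1 : matJ Q * matJ P = 1 := by
    rw [matJ_mul_matJ, h, matJ, Matrix.map_one _ (map_zero _) (map_one _)]
  have h1' : matJ P * matJ Q = 1 := by
    rw [matJ_mul_matJ, mul_eq_one_comm.1 h, matJ, Matrix.map_one _ (map_zero _) (map_one _)]
  have h2 : ∀ m, matJ P * A ^ m = B ^ m * matJ P := fun m => by
    induction m with
    | zero => simp
    | succ m ih => rw [pow_succ, ← mul_assoc, ih, mul_assoc, hAB, ← mul_assoc, ← pow_succ]
  have h3 : ∀ X : Matrix (Fin d) (Fin d) (Ext d), (matJ Q * X).trace = (X * matJ Q).trace := by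
    intro X
    simp only [Matrix.trace, Matrix.diag_apply, Matrix.mul_apply]
    rw [Finset.sum_comm]
    simp only [matJ, Matrix.map_apply]
    exact Finset.sum_congr rfl fun i _ => Finset.sum_congr rfl fun j _ => Algebra.commutes _ _
  calc (A ^ m).trace = (matJ Q * (matJ P * A ^ m)).trace := by rw [← mul_assoc, h1, one_mul]
    _ = (B ^ m * matJ P * matJ Q).trace := by rw [h3, h2]
    _ = _ := by rw [mul_assoc, h1', mul_one]

variable {G G' : Coord d → Matrix (Fin d) (Fin d) ℝ} {U V : Set (Coord d)}
  {τ : Coord d → Coord d} {x : Coord d}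

/-- The forms `tr Ω^m` do not depend on the coordinates. -/
theorem trace_Om_pow_eq_pull (hG : IsMetric G U) (hG' : IsMetric G' V) (hτ : ContDiffOn ℝ ∞ τ U)
    (hm : Set.MapsTo τ U V) (hP : ∀ y ∈ U, IsUnit (jac τ y).det)
    (hGG : ∀ y ∈ U, G y = (jac τ y).transpose * G' (τ y) * jac τ y) (hx : x ∈ U) (m : ℕ) :
    (Om G x ^ m).trace = pull (jac τ x) (Om G' (τ x) ^ m).trace := by
  have h1 : matJ (jac τ x) * Om G x =
      ((pull (jac τ x)).mapMatrix (Om G' (τ x))) * matJ (jac τ x) := by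
    ext h i
    have key : ∀ k j, ∑ l, jac τ x h l * curvM G k j x l i =
        ∑ l, (∑ a, ∑ b, (jac τ x a k * jac τ x b j) * curvM G' a b (τ x) h l) * jac τ x l i :=
      fun k j => by
        have := congrFun (congrFun (jac_mul_curvM hG hG' hτ hm hP hGG hx k j) h) i
        simpa only [Matrix.mul_apply, Matrix.sum_apply, Matrix.smul_apply, smul_eq_mul] using this
    have hq : ∀ a b, pull (jac τ x) (th a * th b) =
        ∑ k, ∑ j, (jac τ x a k * jac τ x b j) • (th k * th j) := fun a b => by
      rw [map_mul, pull_th, pull_th, Finset.sum_mul_sum]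
      simp only [smul_mul_assoc, mul_smul_comm, smul_smul, mul_comm]
    have mv : ∀ f : Fin d → Fin d → Fin d → Ext d,
        ∑ k, ∑ j, ∑ l, f k j l = ∑ l, ∑ k, ∑ j, f k j l := fun f => by
      rw [Finset.sum_congr rfl fun k _ => Finset.sum_comm]
      exact Finset.sum_comm
    rw [matJ_mul_apply, mul_matJ_apply]
    simp only [AlgHom.mapMatrix_apply, Matrix.map_apply, Om, Matrix.of_apply, quad, map_sum,
      map_smul, hq]
    calc _ = ∑ k, ∑ j, (∑ l, jac τ x h l * curvM G k j x l i) • (th k * th j) := by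
          simp only [Finset.smul_sum, smul_smul, Finset.sum_smul]
          rw [Finset.sum_comm]
          exact Finset.sum_congr rfl fun k _ => Finset.sum_comm
      _ = _ := by
          simp only [key]
          simp only [Finset.smul_sum, smul_smul, Finset.sum_smul, Finset.sum_mul]
          rw [mv]
          refine Finset.sum_congr rfl fun l _ => ?_
          rw [mv]
          refine Finset.sum_congr rfl fun a _ => ?_
          rw [mv]
          exact Finset.sum_congr rfl fun b _ => Finset.sum_congr rfl fun k _ =>
            Finset.sum_congr rfl fun j _ => congrArg (· • _) (by ring)
  have hu := Matrix.nonsing_inv_mul _ (hP x hx)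
  rw [trace_conj hu h1, ← map_pow]
  exact (AddMonoidHom.map_trace (pull (jac τ x)) _).symm

end Pullback

section ChartChange

variable {d : ℕ} {M : Type*} [TopologicalSpace M] [ChartedSpace (Coord d) M]
  {e e' : OpenPartialHomeomorph M (Coord d)} {x : Coord d}

theorem contDiffOn_transition (he : e ∈ IsManifold.maximalAtlas (𝓡 d) ∞ M)
    (he' : e' ∈ IsManifold.maximalAtlas (𝓡 d) ∞ M) :
    ContDiffOn ℝ ∞ (fun y => e' (e.symm y)) (e.target ∩ e.symm ⁻¹' e'.source) :=
  contMDiffOn_iff_contDiffOn.1 ((contMDiffOn_of_mem_maximalAtlas he').comp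
    ((contMDiffOn_symm_of_mem_maximalAtlas he).mono Set.inter_subset_left) fun _ hy => hy.2)

/-- The Jacobian of a transition map has the components of one frame in the other chart as
entries. -/
theorem jac_transition (he : e ∈ IsManifold.maximalAtlas (𝓡 d) ∞ M)
    (he' : e' ∈ IsManifold.maximalAtlas (𝓡 d) ∞ M) (hx : x ∈ e.target)
    (hx' : e.symm x ∈ e'.source) (a i : Fin d) :
    jac (fun y => e' (e.symm y)) x a i = comp e' (frame e x i) a := by
  have hd : DifferentiableAt ℝ (fun y => e' (e.symm y)) x :=
    ((contDiffOn_transition he he').contDiffAt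
      ((e.isOpen_inter_preimage_symm e'.open_source).mem_nhds ⟨hx, hx'⟩)).differentiableAt (by simp)
  have h1 : mfderiv (𝓡 d) (𝓡 d) (fun y => e' (e.symm y)) x =
      (mfderiv (𝓡 d) (𝓡 d) e' (e.symm x)).comp (mfderiv (𝓡 d) (𝓡 d) e.symm x) :=
    mfderiv_comp x ((mdifferentiable_of_mem he').mdifferentiableAt hx')
      ((mdifferentiable_of_mem he).mdifferentiableAt_symm hx)
  rw [mfderiv_eq_fderiv] at h1
  have h2 : HasFDerivAt (fun y => e' (e.symm y) a)
      ((EuclideanSpace.proj a : Coord d →L[ℝ] ℝ) ∘L fderiv ℝ (fun y => e' (e.symm y)) x) x :=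
    (EuclideanSpace.proj a : Coord d →L[ℝ] ℝ).hasFDerivAt.comp x hd.hasFDerivAt
  simp only [jac, Matrix.of_apply, pd]
  rw [h2.fderiv, h1]
  rfl

theorem apply_eq_sum_comp02_of_mem (he : e ∈ IsManifold.maximalAtlas (𝓡 d) ∞ M) {p : M}
    (hp : p ∈ e.source) (B : Tensor02 d M) (v w : TangentSpace (𝓡 d) p) :
    B p v w = ∑ i, ∑ j, comp e v i * comp e w j * comp02 B e (e p) i j := by
  obtain ⟨y, hy, rfl⟩ : ∃ y ∈ e.target, e.symm y = p := ⟨e p, e.map_source hp, e.left_inv hp⟩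
  rw [apply_eq_sum_comp02 he hy, e.right_inv hy]

theorem apply_eq_sum_comp01_of_mem (he : e ∈ IsManifold.maximalAtlas (𝓡 d) ∞ M) {p : M}
    (hp : p ∈ e.source) (β : (p : M) → TangentSpace (𝓡 d) p →L[ℝ] ℝ) (v : TangentSpace (𝓡 d) p) :
    β p v = ∑ i, comp e v i * comp01 β e (e p) i := by
  obtain ⟨y, hy, rfl⟩ : ∃ y ∈ e.target, e.symm y = p := ⟨e p, e.map_source hp, e.left_inv hp⟩
  rw [apply_eq_sum_comp01 he hy, e.right_inv hy]

theorem comp02_eq_transition (he : e ∈ IsManifold.maximalAtlas (𝓡 d) ∞ M)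
    (he' : e' ∈ IsManifold.maximalAtlas (𝓡 d) ∞ M) (hx : x ∈ e.target)
    (hx' : e.symm x ∈ e'.source) (B : Tensor02 d M) :
    comp02 B e x = (jac (fun y => e' (e.symm y)) x).transpose * comp02 B e' (e' (e.symm x)) *
      jac (fun y => e' (e.symm y)) x := by
  ext i j
  have h : comp02 B e x i j = B (e.symm x) (frame e x i) (frame e x j) := rfl
  rw [h, apply_eq_sum_comp02_of_mem he' hx' B]
  simp only [Matrix.mul_apply, Matrix.transpose_apply, jac_transition he he' hx hx',
    Finset.sum_mul]
  rw [Finset.sum_comm]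
  exact Finset.sum_congr rfl fun a _ => Finset.sum_congr rfl fun b _ => by ring

theorem comp01_eq_transition (he : e ∈ IsManifold.maximalAtlas (𝓡 d) ∞ M)
    (he' : e' ∈ IsManifold.maximalAtlas (𝓡 d) ∞ M) (hx : x ∈ e.target)
    (hx' : e.symm x ∈ e'.source) (β : (p : M) → TangentSpace (𝓡 d) p →L[ℝ] ℝ) :
    comp01 β e x = Matrix.vecMul (comp01 β e' (e' (e.symm x)))
      (jac (fun y => e' (e.symm y)) x) := by
  ext i
  have h : comp01 β e x i = β (e.symm x) (frame e x i) := rfl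
  rw [h, apply_eq_sum_comp01_of_mem he' hx' β]
  simp only [Matrix.vecMul, dotProduct, jac_transition he he' hx hx']
  exact Finset.sum_congr rfl fun a _ => mul_comm _ _

theorem comp_eq_transition (he : e ∈ IsManifold.maximalAtlas (𝓡 d) ∞ M)
    (he' : e' ∈ IsManifold.maximalAtlas (𝓡 d) ∞ M) (hx : x ∈ e.target)
    (hx' : e.symm x ∈ e'.source) (v : TangentSpace (𝓡 d) (e.symm x)) (a : Fin d) :
    comp e' v a = ∑ i, comp e v i * jac (fun y => e' (e.symm y)) x a i := by
  conv_lhs => rw [eq_sum_comp_frame he hx v]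
  rw [comp_sum]
  simp only [comp_smul, jac_transition he he' hx hx']

end ChartChange

/-! ### Forms of top degree -/

section TopForm

variable {d : ℕ} {M : Type*} [TopologicalSpace M] [ChartedSpace (Coord d) M]
  [IsManifold (𝓡 d) ∞ M]

/-- A smooth form of top degree, given by its coefficients in all charts. The coefficient is the
value on the coordinate frame, so it changes by the determinant of the Jacobian. -/
structure Density (d : ℕ) (M : Type*) [TopologicalSpace M] [ChartedSpace (Coord d) M]
    [IsManifold (𝓡 d) ∞ M] where
  /-- the coefficient in the chart `e` -/
  coeff : OpenPartialHomeomorph M (Coord d) → Coord d → ℝ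
  smooth : ∀ e ∈ IsManifold.maximalAtlas (𝓡 d) ∞ M, ContDiffOn ℝ ∞ (coeff e) e.target
  transition : ∀ e ∈ IsManifold.maximalAtlas (𝓡 d) ∞ M, ∀ e' ∈ IsManifold.maximalAtlas (𝓡 d) ∞ M,
    ∀ x ∈ e.target, e.symm x ∈ e'.source →
      coeff e x = (jac (fun y => e' (e.symm y)) x).det * coeff e' (e' (e.symm x))

/-- The matrix of the components of vectors `v_1, …, v_d`, one vector in each row. -/
def compMatrix (e : OpenPartialHomeomorph M (Coord d)) {p : M}
    (v : Fin d → TangentSpace (𝓡 d) p) : Matrix (Fin d) (Fin d) ℝ :=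
  Matrix.of fun q i => comp e (v q) i

variable {e : OpenPartialHomeomorph M (Coord d)} {x : Coord d}

theorem Density.coeff_mul_det (β : Density d M)
    (he : e ∈ IsManifold.maximalAtlas (𝓡 d) ∞ M) {e' : OpenPartialHomeomorph M (Coord d)}
    (he' : e' ∈ IsManifold.maximalAtlas (𝓡 d) ∞ M) (hx : x ∈ e.target) (hx' : e.symm x ∈ e'.source)
    (v : Fin d → TangentSpace (𝓡 d) (e.symm x)) :
    β.coeff e' (e' (e.symm x)) * (compMatrix e' v).det = β.coeff e x * (compMatrix e v).det := by
  have h : compMatrix e' v = compMatrix e v * (jac (fun y => e' (e.symm y)) x).transpose := by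
    ext q a
    simp only [compMatrix, Matrix.of_apply, Matrix.mul_apply, Matrix.transpose_apply,
      comp_eq_transition he he' hx hx']
  rw [h, Matrix.det_mul, Matrix.det_transpose, β.transition e he e' he' x hx hx']
  ring

/-- The differential form with given coefficients, evaluated in the preferred chart at each
point. -/
def Density.toDForm (β : Density d M) : DForm d d M where
  val p := β.coeff (chartAt (Coord d) p) (chartAt (Coord d) p p) •
    (Matrix.detRowAlternating (n := Fin d) (R := ℝ)).compLinearMap
      (LinearMap.pi (compL (chartAt (Coord d) p) p))
  smooth e he i := by
    refine ((β.smooth e he).mul (contDiffOn_const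
      (c := (Matrix.of fun q => (Pi.single (i q) 1 : Fin d → ℝ)).det))).congr fun x hx => ?_
    refine (β.coeff_mul_det he (chartAt_mem _) hx (mem_chart_source _ _) _).trans ?_
    congr 2
    ext q j
    simp [compMatrix, comp_frame he hx, Pi.single_apply]

theorem Density.toDForm_val (β : Density d M) (p : M) (v : Fin d → TangentSpace (𝓡 d) p) :
    β.toDForm.val p v =
      β.coeff (chartAt (Coord d) p) (chartAt (Coord d) p p) *
        (compMatrix (chartAt (Coord d) p) v).det := rfl

theorem Density.toDForm_val_symm (β : Density d M) (he : e ∈ IsManifold.maximalAtlas (𝓡 d) ∞ M)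
    (hx : x ∈ e.target) (v : Fin d → TangentSpace (𝓡 d) (e.symm x)) :
    β.toDForm.val (e.symm x) v = β.coeff e x * (compMatrix e v).det :=
  β.coeff_mul_det he (chartAt_mem _) hx (mem_chart_source _ _) v

theorem Density.toDForm_comp (β : Density d M) (he : e ∈ IsManifold.maximalAtlas (𝓡 d) ∞ M)
    (hx : x ∈ e.target) (i : Fin d → Fin d) :
    β.toDForm.comp e x i =
      (Matrix.of fun q => (Pi.single (i q) 1 : Fin d → ℝ)).det * β.coeff e x := by
  rw [DForm.comp, β.toDForm_val_symm he hx, mul_comm]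
  congr 2
  ext q j
  simp [compMatrix, comp_frame he hx, Pi.single_apply]

/-- Linear combinations of densities. -/
def Density.sum {ι : Type*} (s : Finset ι) (c : ι → ℝ) (β : ι → Density d M) : Density d M where
  coeff e x := ∑ a ∈ s, c a * (β a).coeff e x
  smooth e he := ContDiffOn.sum fun a _ => contDiffOn_const.mul ((β a).smooth e he)
  transition e he e' he' x hx hx' := by
    rw [Finset.mul_sum]
    exact Finset.sum_congr rfl fun a _ => by
      rw [(β a).transition e he e' he' x hx hx']; ring

end TopForm

/-! ### The contraction of `K` with the characteristic vector field -/

theorem skew_sum_mul {ι κ : Type*} [Fintype κ] {P : ℕ} (f : κ → (Fin P → ι) → ℝ) (c : κ → ℝ)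
    (i : Fin P → ι) :
    skew (fun lam => ∑ j, f j lam * c j) i = ∑ j, skew (f j) i * c j := by
  simp only [skew, Finset.mul_sum, Finset.sum_mul]
  rw [Finset.sum_comm]
  exact Finset.sum_congr rfl fun _ _ => Finset.sum_congr rfl fun _ _ => by ring

theorem IsMetric.contDiffOn_KSkew {d : ℕ} {G : Coord d → Matrix (Fin d) (Fin d) ℝ}
    {U : Set (Coord d)} (hG : IsMetric G U) (k : ℕ) (ν : Fin d) (lam : Fin (4 * k + 1) → Fin d) :
    ContDiffOn ℝ ∞ (KSkew k G ν lam) U := by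
  have hc : ∀ k j i h, ContDiffOn ℝ ∞ (fun x => curv G k j i h x) U := fun k j i h =>
    hG.smooth_curvM k j h i
  unfold KSkew skew K
  exact contDiffOn_const.mul <| ContDiffOn.sum fun σ _ => contDiffOn_const.mul <|
    ContDiffOn.sum fun κ _ => (hc _ _ _ _).mul <| contDiffOn_prod fun s _ => hc _ _ _ _

section Contraction

variable {k : ℕ} {M : Type*} [TopologicalSpace M] [ChartedSpace (Coord (4 * k + 1)) M]
  [IsManifold (𝓡 (4 * k + 1)) ∞ M] {e : OpenPartialHomeomorph M (Coord (4 * k + 1))}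
  {x : Coord (4 * k + 1)}

namespace Sasakian

theorem isMetric_h {d : ℕ} {M : Type*} [TopologicalSpace M] [ChartedSpace (Coord d) M]
    [IsManifold (𝓡 d) ∞ M] {e : OpenPartialHomeomorph M (Coord d)} (S : Sasakian d M)
    (he : e ∈ IsManifold.maximalAtlas (𝓡 d) ∞ M) (ρ : ℝ) :
    IsMetric (comp02 (S.h ρ) e) e.target := by
  rw [comp02_h]
  exact (S.localSasaki he).isMetric_def (sq_nonneg ρ)

theorem sum_KSkew_mul_ξ (S : Sasakian (4 * k + 1) M) (ρ : ℝ)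
    (e : OpenPartialHomeomorph M (Coord (4 * k + 1))) (x : Coord (4 * k + 1))
    (i : Fin (4 * k + 1) → Fin (4 * k + 1)) :
    ∑ j, KSkew k (comp02 (S.h ρ) e) j i x * comp10 S.ξ e x j =
      skew (fun lam => ∑ ν, K k (comp02 (S.h ρ) e) ν lam x * comp10 S.ξ e x ν) i :=
  (skew_sum_mul _ _ _).symm

/-- The contraction of `K` with `ξ` as the form `-(1 + ρ²)² η ∧ tr Ω^{2k}`. -/
theorem factorial_mul_sum_KSkew_mul_ξ (S : Sasakian (4 * k + 1) M) (hk : 1 ≤ k)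
    (he : e ∈ IsManifold.maximalAtlas (𝓡 (4 * k + 1)) ∞ M) (hx : x ∈ e.target) (ρ : ℝ) :
    ((4 * k + 1).factorial : ℝ) *
      ∑ j, KSkew k (comp02 (S.h ρ) e) j id x * comp10 S.ξ e x j =
      -((1 + ρ ^ 2) ^ 2 * top (4 * k + 1)
        (lin (comp01 S.η e x) * (Om (comp02 (S.h ρ) e) x ^ (2 * k)).trace)) := by
  rw [sum_KSkew_mul_ξ, ← top_br, (S.isMetric_h he ρ).br_K (fun k j h => ?_) hk, map_neg, map_smul,
    smul_eq_mul]
  rw [comp02_h]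
  exact (S.localSasaki he).curvM_def_ξ (sq_nonneg ρ) hx k j h

/-- The form `K_{ν [λ_1 ⋯ λ_{4k+1}]} ξ^ν` of the metric `h_ρ`. -/
def contraction (S : Sasakian (4 * k + 1) M) (hk : 1 ≤ k) (ρ : ℝ) : Density (4 * k + 1) M where
  coeff e x := ∑ j, KSkew k (comp02 (S.h ρ) e) j id x * comp10 S.ξ e x j
  smooth e he := ContDiffOn.sum fun j _ =>
    ((S.isMetric_h he ρ).contDiffOn_KSkew k j id).mul (contDiffOn_comp10 S.smooth_ξ he j)
  transition e he e' he' x hx hx' := by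
    have hf : ((4 * k + 1).factorial : ℝ) ≠ 0 := by positivity
    apply mul_left_cancel₀ hf
    rw [mul_left_comm, S.factorial_mul_sum_KSkew_mul_ξ hk he hx,
      S.factorial_mul_sum_KSkew_mul_ξ hk he' (e'.map_source hx')]
    have hU := e.isOpen_inter_preimage_symm e'.open_source
    have hGG : ∀ y ∈ e.target ∩ e.symm ⁻¹' e'.source, comp02 (S.h ρ) e y =
        (jac (fun y => e' (e.symm y)) y).transpose * comp02 (S.h ρ) e' (e' (e.symm y)) *
          jac (fun y => e' (e.symm y)) y := fun y hy =>
      comp02_eq_transition he he' hy.1 hy.2 (S.h ρ)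
    have hG := S.isMetric_h he ρ
    have hG' := S.isMetric_h he' ρ
    have hP : ∀ y ∈ e.target ∩ e.symm ⁻¹' e'.source,
        IsUnit (jac (fun y => e' (e.symm y)) y).det := fun y hy => by
      have h1 := hG.unit y hy.1
      rw [hGG y hy, Matrix.det_mul] at h1
      exact isUnit_of_mul_isUnit_right h1
    rw [trace_Om_pow_eq_pull (U := e.target ∩ e.symm ⁻¹' e'.source)
      ⟨hU, fun a b => (hG.smooth a b).mono Set.inter_subset_left, hG.symm,
        fun y hy => hG.unit y hy.1⟩ hG' (contDiffOn_transition he he')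
        (fun y hy => e'.map_source hy.2) hP hGG ⟨hx, hx'⟩,
      comp01_eq_transition he he' hx hx', ← pull_lin, ← map_mul, top_pull]
    ring

/-- The expansion of `K_{ν [λ_1 ⋯ λ_{4k+1}]} ξ^ν` in powers of `ρ` at a point. -/
theorem exists_contraction_expansion (S : Sasakian (4 * k + 1) M) (hk : 1 ≤ k)
    (he : e ∈ IsManifold.maximalAtlas (𝓡 (4 * k + 1)) ∞ M) (hx : x ∈ e.target) :
    ∃ q : ℕ → ℝ, (∀ ρ, (S.contraction hk ρ).coeff e x =
        -(1 + ρ ^ 2) ^ 2 * ∑ r ∈ Finset.range (2 * k + 1), q r * (ρ ^ 2) ^ r) ∧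
      ((4 * k + 1).factorial : ℝ) * q (2 * k) = (-1) ^ k * 4 ^ k * (4 * k + 2) *
        top (4 * k + 1) (lin (comp01 S.η e x) *
          fund (comp02 S.g.inner e x) (S.chartJ e x) ^ (2 * k)) := by
  obtain ⟨c, hc, hlead⟩ := (S.localSasaki he).exists_expansion hx hk
  have hf : ((4 * k + 1).factorial : ℝ) ≠ 0 := by positivity
  refine ⟨fun r => top (4 * k + 1) (c r) / (4 * k + 1).factorial, fun ρ => ?_, ?_⟩
  · apply mul_left_cancel₀ hf
    have h1 := congrArg (top (4 * k + 1)) (hc (ρ ^ 2) (sq_nonneg ρ))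
    rw [← comp02_h, top_br, ← sum_KSkew_mul_ξ] at h1
    refine h1.trans ?_
    simp only [map_neg, map_smul, map_sum, smul_eq_mul]
    rw [mul_left_comm, neg_mul, Finset.mul_sum, Finset.mul_sum, Finset.mul_sum]
    congr 1
    refine Finset.sum_congr rfl fun r _ => ?_
    field_simp
  · rw [mul_div_cancel₀ _ hf, hlead, map_smul, smul_eq_mul]
    push_cast
    ring

end Sasakian

end Contraction

/-! ### The coefficients of the expansion in powers of `ρ` -/

/-- Interpolation: the coefficients of a polynomial of degree less than `n` are linear functions
of its values at `0, …, n - 1`. -/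
theorem exists_interpolation_weights (n : ℕ) : ∃ w : ℕ → ℕ → ℝ, ∀ q : ℕ → ℝ, ∀ r < n,
    ∑ s ∈ Finset.range n, w r s * ∑ t ∈ Finset.range n, q t * (s : ℝ) ^ t = q r := by
  let V : Matrix (Fin n) (Fin n) ℝ := Matrix.vandermonde fun s => ((s : ℕ) : ℝ)
  have hV : IsUnit V.det := by
    rw [isUnit_iff_ne_zero, Matrix.det_vandermonde_ne_zero_iff]
    exact fun a b h => Fin.ext (Nat.cast_injective (R := ℝ) h)
  refine ⟨fun r s => if h : r < n ∧ s < n then V⁻¹ ⟨r, h.1⟩ ⟨s, h.2⟩ else 0, fun q r hr => ?_⟩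
  have h1 : V⁻¹.mulVec (V.mulVec fun t => q t) = fun t : Fin n => q t := by
    rw [Matrix.mulVec_mulVec, Matrix.nonsing_inv_mul _ hV, Matrix.one_mulVec]
  have h2 := congrFun h1 ⟨r, hr⟩
  simp only at h2
  rw [← h2, Finset.sum_range]
  simp only [Matrix.mulVec, dotProduct]
  refine Finset.sum_congr rfl fun s _ => ?_
  rw [dif_pos ⟨hr, s.2⟩, Finset.sum_range]
  congr 1
  exact Finset.sum_congr rfl fun t _ => mul_comm _ _

theorem skew_cast {ι : Type*} {P Q : ℕ} (h : Q = P) (T : (Fin Q → ι) → ℝ) (i : Fin P → ι) :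
    skew T (fun q => i (Fin.cast h q)) = skew (fun j => T (fun q => j (Fin.cast h q))) i := by
  subst h
  rfl

section Contraction

variable {k : ℕ} {M : Type*} [TopologicalSpace M] [ChartedSpace (Coord (4 * k + 1)) M]
  [IsManifold (𝓡 (4 * k + 1)) ∞ M] {e : OpenPartialHomeomorph M (Coord (4 * k + 1))}
  {x : Coord (4 * k + 1)}

namespace Sasakian

theorem fund_chart (S : Sasakian (4 * k + 1) M)
    (he : e ∈ IsManifold.maximalAtlas (𝓡 (4 * k + 1)) ∞ M) (hx : x ∈ e.target) :
    fund (comp02 S.g.inner e x) (S.chartJ e x) = quad (comp02 S.φLow e x) := by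
  rw [fund, S.comp02_φLow he hx]

theorem br_eta_phi (S : Sasakian (4 * k + 1) M)
    (he : e ∈ IsManifold.maximalAtlas (𝓡 (4 * k + 1)) ∞ M) (hx : x ∈ e.target) :
    br (fun j : Fin (4 * k + 1) → Fin (4 * k + 1) => comp01 S.η e x (j 0) * ∏ s : Fin (2 * k),
      comp02 S.φLow e x (j ⟨2 * s + 1, by omega⟩) (j ⟨2 * s + 2, by omega⟩)) =
    lin (comp01 S.η e x) * fund (comp02 S.g.inner e x) (S.chartJ e x) ^ (2 * k) := by
  refine (br_pairs (m := 2 * k) (by ring) (comp01 S.η e x) fun _ => comp02 S.φLow e x).trans ?_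
  rw [S.fund_chart he hx, List.ofFn_const, List.prod_replicate]
  rfl

theorem factorial_mul_etaPhi (S : Sasakian (4 * k + 1) M)
    (he : e ∈ IsManifold.maximalAtlas (𝓡 (4 * k + 1)) ∞ M) (hx : x ∈ e.target)
    (i : Fin (4 * k + 1) → Fin (4 * k + 1)) :
    ((4 * k + 1).factorial : ℝ) * S.etaPhi k e x i =
      (Matrix.of fun q => (Pi.single (i q) 1 : Fin (4 * k + 1) → ℝ)).det *
        top (4 * k + 1) (lin (comp01 S.η e x) *
          fund (comp02 S.g.inner e x) (S.chartJ e x) ^ (2 * k)) := by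
  rw [etaPhi, skew_eq_det_mul, mul_left_comm, ← top_br, S.br_eta_phi he hx]

theorem factorial_mul_etaDeta (S : Sasakian (4 * k + 1) M)
    (he : e ∈ IsManifold.maximalAtlas (𝓡 (4 * k + 1)) ∞ M) (hx : x ∈ e.target)
    (i : Fin (4 * k + 1) → Fin (4 * k + 1)) :
    ((4 * k + 1).factorial : ℝ) * S.etaDeta k e x i =
      (Matrix.of fun q => (Pi.single (i q) 1 : Fin (4 * k + 1) → ℝ)).det *
        top (4 * k + 1) (lin (comp01 S.η e x) *
          fund (comp02 S.g.inner e x) (S.chartJ e x) ^ (2 * k)) := by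
  have h2 : br (fun j : Fin 2 → Fin (4 * k + 1) => dComp S.η e x (j 0) (j 1)) =
      -quad (comp02 S.φLow e x) := by
    rw [br_two]
    simp only [S.dComp_η he hx, neg_smul, Finset.sum_neg_distrib]
    rfl
  let A : (Fin 1 → Fin (4 * k + 1)) → ℝ := fun j => comp01 S.η e x (j 0)
  let B := wedgePow (fun j => dComp S.η e x (j 0) (j 1)) (2 * k)
  have h3 : br (fun i : Fin (1 + 2 * (2 * k)) → Fin (4 * k + 1) =>
      A (fun q => i (Fin.castAdd _ q)) * B (fun q => i (Fin.natAdd 1 q))) =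
      lin (comp01 S.η e x) * fund (comp02 S.g.inner e x) (S.chartJ e x) ^ (2 * k) := by
    rw [← br_skew]
    refine (br_wedge A B).trans ?_
    rw [br_one, br_wedgePow, h2, Even.neg_pow (even_two_mul k), S.fund_chart he hx]
    rfl
  rw [← h3, ← br_cast (P := 4 * k + 1) (by ring), top_br, etaDeta, wedge, skew_cast,
    skew_eq_det_mul, mul_left_comm]

theorem top_ne_zero (S : Sasakian (4 * k + 1) M)
    (he : e ∈ IsManifold.maximalAtlas (𝓡 (4 * k + 1)) ∞ M) (hx : x ∈ e.target) :
    top (4 * k + 1) (lin (comp01 S.η e x) *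
      fund (comp02 S.g.inner e x) (S.chartJ e x) ^ (2 * k)) ≠ 0 := by
  have h := (S.localSasaki he).lin_η_mul_fund_pow_ne_zero (n := 2 * k) hx (by ring)
  rw [← S.br_eta_phi he hx] at h ⊢
  exact fun h0 => h (br_eq_zero_of_top _ h0)

/-- The coefficients of `K_{ν [λ_1 ⋯ λ_{4k+1}]} ξ^ν`, divided by `-(1 + ρ²)²`, as a polynomial in
`ρ²` are smooth: they are combinations of its values for finitely many `ρ`. -/
theorem exists_coefficients (S : Sasakian (4 * k + 1) M) (hk : 1 ≤ k) :
    ∃ b : ℕ → Density (4 * k + 1) M,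
      ∀ e ∈ IsManifold.maximalAtlas (𝓡 (4 * k + 1)) ∞ M, ∀ x ∈ e.target,
        (∀ ρ, (S.contraction hk ρ).coeff e x = -(1 + ρ ^ 2) ^ 2 *
          ∑ r ∈ Finset.range (2 * k + 1), (b r).coeff e x * (ρ ^ 2) ^ r) ∧
        ((4 * k + 1).factorial : ℝ) * (b (2 * k)).coeff e x = (-1) ^ k * 4 ^ k * (4 * k + 2) *
          top (4 * k + 1) (lin (comp01 S.η e x) *
            fund (comp02 S.g.inner e x) (S.chartJ e x) ^ (2 * k)) ∧
        (b (2 * k)).coeff e x ≠ 0 := by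
  obtain ⟨w, hw⟩ := exists_interpolation_weights (2 * k + 1)
  -- the values at `ρ² = 0, …, 2k` are divided by `-(1 + ρ²)²` and interpolated
  refine ⟨fun r => Density.sum (Finset.range (2 * k + 1))
    (fun s => w r s * (-(1 + (s : ℝ)) ^ 2)⁻¹) (fun s => S.contraction hk √s), fun e he x hx => ?_⟩
  obtain ⟨q, hq, hlead⟩ := S.exists_contraction_expansion hk he hx
  have key : ∀ r < 2 * k + 1, ∑ s ∈ Finset.range (2 * k + 1),
      w r s * (-(1 + (s : ℝ)) ^ 2)⁻¹ * (S.contraction hk √s).coeff e x = q r := fun r hr => by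
    rw [← hw q r hr]
    refine Finset.sum_congr rfl fun s _ => ?_
    rw [hq, Real.sq_sqrt (Nat.cast_nonneg s), mul_assoc]
    congr 1
    have : -(1 + (s : ℝ)) ^ 2 ≠ 0 := by
      have : (0 : ℝ) < (1 + s) ^ 2 := by positivity
      linarith
    rw [← mul_assoc, inv_mul_cancel₀ this, one_mul]
  have hq0 : q (2 * k) ≠ 0 := fun h0 => by
    have h3 : ((-1) ^ k * 4 ^ k * (4 * k + 2) : ℝ) ≠ 0 :=
      mul_ne_zero (mul_ne_zero (pow_ne_zero _ (by norm_num)) (by positivity)) (by positivity)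
    rw [h0, mul_zero] at hlead
    exact mul_ne_zero h3 (S.top_ne_zero he hx) hlead.symm
  refine ⟨?_, ?_, fun h => hq0 ((key _ (Nat.lt_succ_self _)).symm.trans h)⟩
  · intro ρ
    rw [hq]
    congr 1
    exact Finset.sum_congr rfl fun r hr => 
      congrArg (· * (ρ ^ 2) ^ r) (key r (Finset.mem_range.1 hr)).symm
  · exact (congrArg _ (key _ (Nat.lt_succ_self _))).trans hlead

end Sasakian

end Contraction

/-! ### Nonvanishing for large `ρ` -/

/-- A real polynomial with leading coefficient `1` is positive beyond an explicit bound. -/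
theorem sum_mul_pow_pos {n : ℕ} {f : ℕ → ℝ} {C t : ℝ} (hf : ∀ r < n, |f r| ≤ C) (hn : f n = 1)
    (ht : 1 ≤ t) (htC : n * C < t) : 0 < ∑ r ∈ Finset.range (n + 1), f r * t ^ r := by
  rw [Finset.sum_range_succ, hn, one_mul]
  rcases n with _ | n
  · simp
  have h1 : ∀ r ∈ Finset.range (n + 1), -(C * t ^ n) ≤ f r * t ^ r := fun r hr => by
    have hr' := Finset.mem_range.1 hr
    have hC : 0 ≤ C := (abs_nonneg _).trans (hf r hr')
    have h2 : t ^ r ≤ t ^ n := pow_le_pow_right₀ ht (by omega)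
    have h3 : |f r * t ^ r| ≤ C * t ^ n := by
      rw [abs_mul, abs_of_nonneg (by positivity : 0 ≤ t ^ r)]
      exact mul_le_mul (hf r hr') h2 (by positivity) hC
    exact (abs_le.1 h3).1
  have h4 := Finset.sum_le_sum h1
  rw [Finset.sum_const, Finset.card_range, nsmul_eq_mul] at h4
  have h5 : ((n + 1 : ℕ) * C) * t ^ n < t * t ^ n :=
    mul_lt_mul_of_pos_right htC (by positivity)
  rw [pow_succ]
  linarith

/-- The integral of a continuous function without zeros is not zero. -/
theorem intervalIntegral_ne_zero {f : ℝ → ℝ} (hf : Continuous f) (h0 : ∀ θ, f θ ≠ 0) {a b : ℝ}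
    (hab : a < b) : ∫ θ in a..b, f θ ≠ 0 := by
  have hs : (∀ θ, 0 < f θ) ∨ ∀ θ, 0 < -f θ := by
    by_contra! h
    obtain ⟨⟨s, hs⟩, t, ht⟩ := h
    obtain ⟨u, hu⟩ := mem_range_of_exists_le_of_exists_ge hf ⟨s, hs⟩ ⟨t, by linarith⟩
    exact h0 u hu
  rcases hs with h | h
  · exact (intervalIntegral.intervalIntegral_pos_of_pos (hf.intervalIntegrable a b) h hab).ne'
  · have := intervalIntegral.intervalIntegral_pos_of_pos (f := fun θ => -f θ)
      (hf.neg.intervalIntegrable a b) h hab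
    rw [intervalIntegral.integral_neg] at this
    exact fun h1 => by simp [h1] at this

section Density

variable {d : ℕ} {M : Type*} [TopologicalSpace M] [ChartedSpace (Coord d) M]

/-- The image of the coordinate frame under an injective linear map is a frame. -/
theorem det_compMatrix_ne_zero {e e' : OpenPartialHomeomorph M (Coord d)}
    (he : e ∈ IsManifold.maximalAtlas (𝓡 d) ∞ M) (he' : e' ∈ IsManifold.maximalAtlas (𝓡 d) ∞ M)
    {x : Coord d} (hx : x ∈ e.target) {p : M} (hp : p ∈ e'.source)
    (L : TangentSpace (𝓡 d) (e.symm x) →L[ℝ] TangentSpace (𝓡 d) p) (hL : Function.Injective L) :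
    (compMatrix e' fun i => L (frame e x i)).det ≠ 0 := by
  intro h0
  obtain ⟨a, ha, h⟩ := Matrix.exists_vecMul_eq_zero_iff.2 h0
  apply ha
  have h1 : L (∑ i, a i • frame e x i) = L 0 := by
    apply comp_injective he' hp
    intro j
    rw [map_sum, comp_sum, map_zero]
    refine Eq.trans ?_ ((congrFun h j).trans (compL e' p j).map_zero.symm)
    exact Finset.sum_congr rfl fun i _ => by rw [map_smul, comp_smul]; rfl
  have h2 := hL h1
  ext i
  have h3 := congrArg (fun v => comp e v i) h2
  simp only [comp_sum, comp_smul, comp_frame he hx] at h3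
  simpa using h3.trans (compL e _ i).map_zero

variable [IsManifold (𝓡 d) ∞ M]

/-- The coefficient of a density at `p` in the preferred chart at `p`. -/
def Density.coeffAt (β : Density d M) (p : M) : ℝ :=
  β.coeff (chartAt (Coord d) p) (chartAt (Coord d) p p)

theorem Density.exists_coeffAt_eq {e : OpenPartialHomeomorph M (Coord d)}
    (he : e ∈ IsManifold.maximalAtlas (𝓡 d) ∞ M) {p : M} (hp : p ∈ e.source) :
    ∃ D : ℝ, ∀ β : Density d M, β.coeffAt p = D * β.coeff e (e p) := by
  refine ⟨(jac (fun y => e ((chartAt (Coord d) p).symm y)) (chartAt (Coord d) p p)).det,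
    fun β => ?_⟩
  have h := β.transition _ (chartAt_mem p) e he (chartAt (Coord d) p p)
    (mem_chart_target _ p) (by rwa [(chartAt (Coord d) p).left_inv (mem_chart_source _ p)])
  rw [(chartAt (Coord d) p).left_inv (mem_chart_source _ p)] at h
  exact h

/-- The quotient of two densities is a function. -/
theorem Density.continuous_div (α β : Density d M) (hβ : ∀ p, β.coeffAt p ≠ 0) :
    Continuous fun p => α.coeffAt p / β.coeffAt p := by
  rw [continuous_iff_continuousAt]
  intro p
  set e := chartAt (Coord d) p
  have he : e ∈ IsManifold.maximalAtlas (𝓡 d) ∞ M := chartAt_mem p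
  have hp : p ∈ e.source := mem_chart_source _ p
  have hc : ∀ γ : Density d M, ContinuousAt (fun q => γ.coeff e (e q)) p := fun γ =>
    ((γ.smooth e he).continuousOn.continuousAt
      (e.open_target.mem_nhds (e.map_source hp))).comp (e.continuousAt hp)
  refine ((hc α).div (hc β) (hβ p)).congr ?_
  filter_upwards [e.open_source.mem_nhds hp] with q hq
  obtain ⟨D, hD⟩ := Density.exists_coeffAt_eq he hq
  have hD0 : D ≠ 0 := fun h => hβ q (by rw [hD, h, zero_mul])
  rw [hD, hD, mul_div_mul_left _ _ hD0]
  rfl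

theorem Density.toDForm_val_of_mem (β : Density d M) {e : OpenPartialHomeomorph M (Coord d)}
    (he : e ∈ IsManifold.maximalAtlas (𝓡 d) ∞ M) {p : M} (hp : p ∈ e.source)
    (v : Fin d → TangentSpace (𝓡 d) p) :
    β.toDForm.val p v = β.coeff e (e p) * (compMatrix e v).det := by
  obtain ⟨y, hy, rfl⟩ : ∃ y ∈ e.target, e.symm y = p := ⟨e p, e.map_source hp, e.left_inv hp⟩
  rw [β.toDForm_val_symm he hy, e.right_inv hy]

end Density

section Orbit

variable {d : ℕ} {M : Type*} [TopologicalSpace M] [ChartedSpace (Coord d) M]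
  [MulAction Circle M]

theorem IsSmoothAction.contMDiff_smul (ha : IsSmoothAction d M) (z : Circle) :
    ContMDiff (𝓡 d) (𝓡 d) ∞ (fun p : M => z • p) :=
  ha.comp (contMDiff_const.prodMk contMDiff_id)

theorem IsSmoothAction.injective_mfderiv (ha : IsSmoothAction d M) (z : Circle) (m : M) :
    Function.Injective (mfderiv (𝓡 d) (𝓡 d) (fun p : M => z • p) m) := by
  have h1 : mfderiv (𝓡 d) (𝓡 d) ((fun p : M => z⁻¹ • p) ∘ fun p : M => z • p) m =
      (mfderiv (𝓡 d) (𝓡 d) (fun p : M => z⁻¹ • p) (z • m)).comp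
        (mfderiv (𝓡 d) (𝓡 d) (fun p : M => z • p) m) :=
    mfderiv_comp m ((ha.contMDiff_smul z⁻¹).mdifferentiable (by simp) _)
      ((ha.contMDiff_smul z).mdifferentiable (by simp) _)
  have h2 : ((fun p : M => z⁻¹ • p) ∘ fun p : M => z • p) = id := by
    funext p; simp
  rw [h2, mfderiv_id] at h1
  intro u v huv
  have hu := DFunLike.congr_fun h1 u
  have hv := DFunLike.congr_fun h1 v
  exact hu.trans ((congrArg (mfderiv (𝓡 d) (𝓡 d) (fun p : M => z⁻¹ • p) (z • m)) huv).trans hv.symm)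

/-- The differentials of the action at a fixed point depend continuously on the angle. -/
theorem IsSmoothAction.continuousAt_comp (ha : IsSmoothAction d M)
    {e e' : OpenPartialHomeomorph M (Coord d)} (he : e ∈ IsManifold.maximalAtlas (𝓡 d) ∞ M)
    (he' : e' ∈ IsManifold.maximalAtlas (𝓡 d) ∞ M) {x : Coord d} (hx : x ∈ e.target) {θ₀ : ℝ}
    (hθ₀ : Circle.exp θ₀ • e.symm x ∈ e'.source) (i j : Fin d) :
    ContinuousAt (fun θ => comp e' (mfderiv (𝓡 d) (𝓡 d) (fun p : M => Circle.exp θ • p) (e.symm x)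
      (frame e x i)) j) θ₀ := by
  have hG : ContMDiff (𝓘(ℝ, ℝ).prod (𝓡 d)) (𝓡 d) ∞ (fun q : ℝ × M => Circle.exp q.1 • q.2) :=
    ha.comp ((contMDiff_circleExp.comp contMDiff_fst).prodMk contMDiff_snd)
  have hf : ContMDiffAt (𝓘(ℝ, ℝ).prod (𝓡 d)) (𝓡 d) ∞
      (Function.uncurry fun (θ : ℝ) (y : Coord d) => e' (Circle.exp θ • e.symm y)) (θ₀, x) := by
    have h1 : ContMDiffAt (𝓘(ℝ, ℝ).prod (𝓡 d)) (𝓡 d) ∞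
        (fun q : ℝ × Coord d => Circle.exp q.1 • e.symm q.2) (θ₀, x) :=
      (hG _).comp (θ₀, x) (contMDiffAt_fst.prodMk
        ((contMDiffAt_symm_of_mem_maximalAtlas he hx).comp (θ₀, x) contMDiffAt_snd))
    exact (contMDiffAt_of_mem_maximalAtlas he' hθ₀).comp (θ₀, x) h1
  have h1 := ContMDiffAt.mfderiv (m := 0) (fun (θ : ℝ) (y : Coord d) => e' (Circle.exp θ • e.symm y))
    (fun _ => x) hf contMDiffAt_const (by simp)
  have hi := inTangentCoordinates_model_space (I := 𝓡 d) (I' := 𝓡 d) (fun _ : ℝ => x)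
    (fun θ : ℝ => e' (Circle.exp θ • e.symm x)) (fun θ : ℝ =>
      (mfderiv (𝓡 d) (𝓡 d) (fun y : Coord d => e' (Circle.exp θ • e.symm y)) x :
        Coord d →L[ℝ] Coord d)) θ₀
  have h1' := hi ▸ h1
  have h2 : ContinuousAt (fun θ : ℝ => (EuclideanSpace.proj j : Coord d →L[ℝ] ℝ)
      ((fun θ : ℝ => (mfderiv (𝓡 d) (𝓡 d) (fun y : Coord d => e' (Circle.exp θ • e.symm y)) x :
        Coord d →L[ℝ] Coord d)) θ (EuclideanSpace.single i 1))) θ₀ :=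
    (EuclideanSpace.proj j : Coord d →L[ℝ] ℝ).continuous.continuousAt.comp
      (h1'.continuousAt.clm_apply continuousAt_const)
  refine h2.congr ?_
  have hcont : ContinuousAt (fun θ : ℝ => Circle.exp θ • e.symm x) θ₀ :=
    (hG.continuous.comp (continuous_id.prodMk continuous_const)).continuousAt
  filter_upwards [hcont.preimage_mem_nhds (e'.open_source.mem_nhds hθ₀)] with θ hθ
  have h3 : mfderiv (𝓡 d) (𝓡 d) (e' ∘ (fun p : M => Circle.exp θ • p) ∘ e.symm) x =
      (mfderiv (𝓡 d) (𝓡 d) e' (Circle.exp θ • e.symm x)).comp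
        ((mfderiv (𝓡 d) (𝓡 d) (fun p : M => Circle.exp θ • p) (e.symm x)).comp
          (mfderiv (𝓡 d) (𝓡 d) e.symm x)) := by
    have hd := (mdifferentiable_of_mem he).mdifferentiableAt_symm hx
    have hz : MDifferentiableAt (𝓡 d) (𝓡 d) (fun p : M => Circle.exp θ • p) (e.symm x) :=
      (ha.contMDiff_smul (Circle.exp θ)).mdifferentiable (by simp) _
    have he1 : MDifferentiableAt (𝓡 d) (𝓡 d) e' (Circle.exp θ • e.symm x) :=
      (mdifferentiable_of_mem he').mdifferentiableAt hθ
    rw [mfderiv_comp x he1 (hz.comp x hd), mfderiv_comp x hz hd]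
    rfl
  have h4 := DFunLike.congr_fun h3 (EuclideanSpace.single i 1 : Coord d)
  exact congrArg (EuclideanSpace.proj j : Coord d →L[ℝ] ℝ) h4

variable [IsManifold (𝓡 d) ∞ M]

/-- A form of top degree, evaluated on a frame moved along an orbit of the action. -/
theorem Density.continuous_orbit (β : Density d M) (ha : IsSmoothAction d M)
    {e : OpenPartialHomeomorph M (Coord d)} (he : e ∈ IsManifold.maximalAtlas (𝓡 d) ∞ M)
    {x : Coord d} (hx : x ∈ e.target) :
    Continuous fun θ : ℝ => β.toDForm.val (Circle.exp θ • e.symm x) fun i =>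
      mfderiv (𝓡 d) (𝓡 d) (fun p : M => Circle.exp θ • p) (e.symm x) (frame e x i) := by
  rw [continuous_iff_continuousAt]
  intro θ₀
  set e' := chartAt (Coord d) (Circle.exp θ₀ • e.symm x)
  have he' : e' ∈ IsManifold.maximalAtlas (𝓡 d) ∞ M := chartAt_mem _
  have hp : Circle.exp θ₀ • e.symm x ∈ e'.source := mem_chart_source _ _
  have hcont : ContinuousAt (fun θ : ℝ => Circle.exp θ • e.symm x) θ₀ :=
    ((ha.continuous.comp (Circle.exp.continuous.prodMk continuous_const))).continuousAt
  have h0 : ContinuousAt (fun θ : ℝ => e' (Circle.exp θ • e.symm x)) θ₀ :=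
    ContinuousAt.comp (f := fun θ : ℝ => Circle.exp θ • e.symm x) (g := e')
      (e'.continuousAt hp) hcont
  have h1 : ContinuousAt (fun θ : ℝ => β.coeff e' (e' (Circle.exp θ • e.symm x))) θ₀ :=
    ContinuousAt.comp (f := fun θ : ℝ => e' (Circle.exp θ • e.symm x)) (g := β.coeff e')
      ((β.smooth e' he').continuousOn.continuousAt
        (e'.open_target.mem_nhds (e'.map_source hp))) h0
  have h2 : ContinuousAt (fun θ : ℝ => (compMatrix e' fun i =>
      mfderiv (𝓡 d) (𝓡 d) (fun p : M => Circle.exp θ • p) (e.symm x) (frame e x i)).det) θ₀ := by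
    refine (Continuous.matrix_det continuous_id).continuousAt.comp ?_
    exact continuousAt_pi.2 fun i => continuousAt_pi.2 fun j => ha.continuousAt_comp he he' hx hp i j
  refine (h1.mul h2).congr ?_
  filter_upwards [hcont.preimage_mem_nhds (e'.open_source.mem_nhds hp)] with θ hθ
  exact (β.toDForm_val_of_mem he' hθ _).symm

end Orbit

/-! ### The pulled back form -/

/-- The Leibniz formula as a sum over all maps; those that are not injective contribute zero. -/
theorem sum_det_mul_prod {d : ℕ} (W : Matrix (Fin d) (Fin d) ℝ) :
    ∑ i : Fin d → Fin d, (Matrix.of fun q => (Pi.single (i q) 1 : Fin d → ℝ)).det *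
      ∏ q, W q (i q) = W.det := by
  have h := (Matrix.detRowAlternating (n := Fin d) (R := ℝ)).toMultilinearMap.map_sum
    (fun q j => W q j • (Pi.single j 1 : Fin d → ℝ))
  simp only [MultilinearMap.map_smul_univ] at h
  have hW : (fun q => ∑ j, W q j • (Pi.single j 1 : Fin d → ℝ)) = W.row := by
    ext q j
    simp [Pi.single_apply]
  rw [hW] at h
  refine Eq.trans ?_ h.symm
  exact Finset.sum_congr rfl fun i _ => mul_comm _ _

section Loop

variable {k : ℕ} {M : Type*} [TopologicalSpace M] [ChartedSpace (Coord (4 * k + 1)) M]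
  [IsManifold (𝓡 (4 * k + 1)) ∞ M]

namespace Sasakian

/-- The integrand of the Wodzicki-Chern-Simons form at a velocity proportional to `ξ`. -/
theorem KForm_smul_ξ (S : Sasakian (4 * k + 1) M) (hk : 1 ≤ k) (ρ c : ℝ) (p : M)
    (w : Fin (4 * k + 1) → TangentSpace (𝓡 (4 * k + 1)) p) :
    KForm k (S.h ρ) p (c • S.ξ p) w = c * (S.contraction hk ρ).toDForm.val p w := by
  have hξ : ∀ ν, comp (chartAt (Coord (4 * k + 1)) p) (S.ξ p) ν =
      comp10 S.ξ (chartAt (Coord (4 * k + 1)) p) (chartAt (Coord (4 * k + 1)) p p) ν := fun ν => by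
    have : ∀ q, q = p → comp (chartAt (Coord (4 * k + 1)) p) (S.ξ p) ν =
      comp (chartAt (Coord (4 * k + 1)) p) (S.ξ q) ν := by rintro _ rfl; rfl
    exact this _ ((chartAt (Coord (4 * k + 1)) p).left_inv (mem_chart_source _ p))
  rw [Density.toDForm_val, ← sum_det_mul_prod, KForm, Finset.sum_comm, Finset.mul_sum,
    Finset.mul_sum]
  refine Finset.sum_congr rfl fun lam _ => ?_
  have h1 := S.sum_KSkew_mul_ξ ρ (chartAt (Coord (4 * k + 1)) p)
    (chartAt (Coord (4 * k + 1)) p p) lam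
  rw [skew_eq_det_mul, ← sum_KSkew_mul_ξ] at h1
  simp only [comp_smul, hξ]
  rw [← Finset.sum_mul]
  have h2 : ∀ ν, KSkew k (comp02 (S.h ρ) (chartAt (Coord (4 * k + 1)) p)) ν lam
      (chartAt (Coord (4 * k + 1)) p p) * (c * comp10 S.ξ (chartAt (Coord (4 * k + 1)) p)
        (chartAt (Coord (4 * k + 1)) p p) ν) = c * (KSkew k (comp02 (S.h ρ)
      (chartAt (Coord (4 * k + 1)) p)) ν lam (chartAt (Coord (4 * k + 1)) p p) * comp10 S.ξ
      (chartAt (Coord (4 * k + 1)) p) (chartAt (Coord (4 * k + 1)) p p) ν) := fun ν => by ring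
  rw [Finset.sum_congr rfl fun ν _ => h2 ν, ← Finset.mul_sum, h1]
  simp only [contraction, compMatrix, Matrix.of_apply]
  ring

/-- The leading coefficient has no zeros, and on a compact manifold it dominates the others. -/
theorem exists_contraction_ne_zero [CompactSpace M] (S : Sasakian (4 * k + 1) M) (hk : 1 ≤ k) :
    ∃ ρ₀ : ℝ, ∀ ρ, ρ₀ ≤ ρ → ∀ p : M, (S.contraction hk ρ).coeffAt p ≠ 0 := by
  obtain ⟨b, hb⟩ := S.exists_coefficients hk
  have hlead : ∀ p : M, (b (2 * k)).coeffAt p ≠ 0 := fun p =>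
    (hb _ (chartAt_mem p) _ (mem_chart_target _ p)).2.2
  have hbound : ∀ r, ∃ C : ℝ, ∀ p : M, |(b r).coeffAt p / (b (2 * k)).coeffAt p| ≤ C := fun r => by
    obtain ⟨C, hC⟩ := isCompact_univ.exists_bound_of_continuousOn
      ((b r).continuous_div (b (2 * k)) hlead).continuousOn
    exact ⟨C, fun p => hC p trivial⟩
  choose C hC using hbound
  set D := ∑ r ∈ Finset.range (2 * k), |C r|
  have hD0 : 0 ≤ D := Finset.sum_nonneg fun _ _ => abs_nonneg _
  have hD : ∀ r < 2 * k, ∀ p : M, |(b r).coeffAt p / (b (2 * k)).coeffAt p| ≤ D := fun r hr p =>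
    (hC r p).trans ((le_abs_self _).trans (Finset.single_le_sum (f := fun r => |C r|)
      (fun _ _ => abs_nonneg _) (Finset.mem_range.2 hr)))
  refine ⟨1 + (2 * k : ℕ) * D, fun ρ hρ p => ?_⟩
  have h0 : 0 ≤ ((2 * k : ℕ) : ℝ) * D := by positivity
  have hρ1 : 1 ≤ ρ := by linarith
  have hρ2 : ρ ≤ ρ ^ 2 := by nlinarith
  have h1 : (S.contraction hk ρ).coeffAt p = -(1 + ρ ^ 2) ^ 2 *
      ∑ r ∈ Finset.range (2 * k + 1), (b r).coeffAt p * (ρ ^ 2) ^ r :=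
    (hb _ (chartAt_mem p) _ (mem_chart_target _ p)).1 ρ
  have h2 := sum_mul_pow_pos (f := fun r => (b r).coeffAt p / (b (2 * k)).coeffAt p) (t := ρ ^ 2)
    (fun r hr => hD r hr p) (div_self (hlead p)) (by linarith) (by linarith)
  have h3 : ∑ r ∈ Finset.range (2 * k + 1), (b r).coeffAt p * (ρ ^ 2) ^ r = (b (2 * k)).coeffAt p *
      ∑ r ∈ Finset.range (2 * k + 1), (b r).coeffAt p / (b (2 * k)).coeffAt p * (ρ ^ 2) ^ r := by
    rw [Finset.mul_sum]
    refine Finset.sum_congr rfl fun r _ => ?_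
    have := hlead p
    field_simp
  rw [h1, h3]
  have h4 : (0 : ℝ) < (1 + ρ ^ 2) ^ 2 := by positivity
  exact mul_ne_zero (by linarith) (mul_ne_zero (hlead p) h2.ne')

/-- At each loop `a^L(m)` the integrand is a continuous function of the angle without zeros, if the
vectors are a frame at `m`. -/
theorem pullbackCSW_ne_zero [MulAction Circle M] (S : Sasakian (4 * k + 1) M) (hk : 1 ≤ k)
    (ha : IsSmoothAction (4 * k + 1) M) (hrot : IsRotationAlong (4 * k + 1) S.ξ) {ρ : ℝ}
    (hρ : ∀ p : M, (S.contraction hk ρ).coeffAt p ≠ 0) (m : M) :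
    ∃ v : Fin (4 * k + 1) → TangentSpace (𝓡 (4 * k + 1)) m, pullbackCSW k (S.h ρ) ha m v ≠ 0 := by
  obtain ⟨c, hc, hvel⟩ := hrot
  obtain ⟨e, he, x, hx, rfl⟩ := exists_chart (d := 4 * k + 1) m
  refine ⟨frame e x, ?_⟩
  have hint : ∀ θ : ℝ, KForm k (S.h ρ) (orbitLoop ha (e.symm x) (Circle.exp θ))
      (velocity (orbitLoop ha (e.symm x)) θ)
      (fun s => orbitLoopDeriv ha (e.symm x) (frame e x s) (Circle.exp θ)) =
      c * (S.contraction hk ρ).toDForm.val (Circle.exp θ • e.symm x) fun i =>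
        mfderiv (𝓡 (4 * k + 1)) (𝓡 (4 * k + 1)) (fun p : M => Circle.exp θ • p) (e.symm x)
          (frame e x i) := fun θ => by
    have h1 : velocity (orbitLoop ha (e.symm x)) θ = c • S.ξ (Circle.exp θ • e.symm x) := by
      have h2 := DFunLike.congr_fun (hvel (e.symm x) θ).mfderiv (1 : ℝ)
      exact h2.trans (one_smul ℝ _)
    rw [h1]
    exact S.KForm_smul_ξ hk ρ c _ _
  rw [pullbackCSW, CSW]
  simp only [hint]
  refine intervalIntegral_ne_zero
    (continuous_const.mul ((S.contraction hk ρ).continuous_orbit ha he hx)) (fun θ => ?_)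
    Real.two_pi_pos
  refine mul_ne_zero hc.ne' ?_
  exact mul_ne_zero (hρ _) (det_compMatrix_ne_zero he (chartAt_mem _) hx (mem_chart_source _ _) _
    (ha.injective_mfderiv _ _))

end Sasakian

end Loop

end SasakiCS

end

open SasakiCS in
theorem proposition5p1 (k : ℕ) (hk : 1 ≤ k)
    {M : Type*} [TopologicalSpace M] [T2Space M] [CompactSpace M]
    [ChartedSpace (Coord (4 * k + 1)) M] [IsManifold (𝓡 (4 * k + 1)) ∞ M]
    (S : Sasakian (4 * k + 1) M)
    [MulAction Circle M] (ha : IsSmoothAction (4 * k + 1) M)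
    (hrot : IsRotationAlong (4 * k + 1) S.ξ) :
    -- `a r` is the coefficient of `ρ ^ (2 * r)`, a `(4k+1)`-form on `M` that does not depend on `ρ`
    (∃ a : ℕ → DForm (4 * k + 1) (4 * k + 1) M,
      (∀ ρ : ℝ, ∀ e ∈ IsManifold.maximalAtlas (𝓡 (4 * k + 1)) ∞ M, ∀ x ∈ e.target,
        ∀ i : Fin (4 * k + 1) → Fin (4 * k + 1),
          ∑ j, KSkew k (comp02 (S.h ρ) e) j i x * comp10 S.ξ e x j =
            -(1 + ρ ^ 2) ^ 2 * ∑ r ∈ Finset.range (2 * k + 1), (a r).comp e x i * ρ ^ (2 * r)) ∧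
      (∀ e ∈ IsManifold.maximalAtlas (𝓡 (4 * k + 1)) ∞ M, ∀ x ∈ e.target,
        ∀ i : Fin (4 * k + 1) → Fin (4 * k + 1),
          (a (2 * k)).comp e x i = (-1) ^ k * 4 ^ k * (4 * k + 2) * S.etaPhi k e x i ∧
          (a (2 * k)).comp e x i = (-1) ^ k * 4 ^ k * (4 * k + 2) * S.etaDeta k e x i) ∧
      (∀ m : M, (a (2 * k)).val m ≠ 0)) ∧
    -- the pulled-back Wodzicki-Chern-Simons form of `h_ρ` vanishes nowhere for large `ρ`
    (∃ ρ₀ : ℝ, ∀ ρ : ℝ, ρ₀ ≤ ρ → ∀ m : M,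
      ∃ v : Fin (4 * k + 1) → TangentSpace (𝓡 (4 * k + 1)) m, pullbackCSW k (S.h ρ) ha m v ≠ 0) := by
  obtain ⟨b, hb⟩ := S.exists_coefficients hk
  have hf : ((4 * k + 1).factorial : ℝ) ≠ 0 := by positivity
  refine ⟨⟨fun r => (b r).toDForm, fun ρ e he x hx i => ?_, fun e he x hx i => ?_, fun m h => ?_⟩,
    ?_⟩
  · rw [S.sum_KSkew_mul_ξ, skew_eq_det_mul, ← S.sum_KSkew_mul_ξ]
    have h1 := (hb e he x hx).1 ρ
    simp only [Sasakian.contraction] at h1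
    rw [h1, mul_left_comm, Finset.mul_sum]
    congr 1
    refine Finset.sum_congr rfl fun r _ => ?_
    rw [Density.toDForm_comp _ he hx, pow_mul, mul_assoc]
  · rw [Density.toDForm_comp _ he hx]
    constructor <;> apply mul_left_cancel₀ hf
    · rw [mul_left_comm _ _ (S.etaPhi k e x i), S.factorial_mul_etaPhi he hx, mul_left_comm,
        (hb e he x hx).2.1]
      ring
    · rw [mul_left_comm _ _ (S.etaDeta k e x i), S.factorial_mul_etaDeta he hx, mul_left_comm,
        (hb e he x hx).2.1]
      ring
  · obtain ⟨e, he, x, hx, rfl⟩ := exists_chart (d := 4 * k + 1) m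
    have h1 := (b (2 * k)).toDForm_comp he hx id
    have h2 : (Matrix.of fun q => (Pi.single (id q) 1 : Fin (4 * k + 1) → ℝ)) = 1 := by
      ext q j
      simp [Matrix.one_apply, Pi.single_apply, eq_comm]
    rw [h2, Matrix.det_one, one_mul, DForm.comp, h] at h1
    exact (hb e he x hx).2.2 h1.symm
  · obtain ⟨ρ₀, hρ₀⟩ := S.exists_contraction_ne_zero hk
    exact ⟨ρ₀, fun ρ hρ m => S.pullbackCSW_ne_zero hk ha hrot (hρ₀ ρ hρ) m⟩
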